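/- Let $\mathbb K\in\{\mathbb R,\mathbb C\}$. Lie groups are groups that are smooth manifolds modelled on Hausdorff locally convex $\mathbb K$-vector spaces, with smooth multiplication and inversion (a map is $C^1$ if it is continuous and its directional derivatives exist and depend continuously on the point and the direction, $C^{n+1}$ if it is $C^1$ and its differential is $C^n$, smooth if it is $C^n$ for all $n$). A subgroup $H$ of a Lie group $P$ is a split Lie subgroup if it carries a Lie group structure with smooth inclusion, and $P/H$ a manifold structure, for which $P\to P/H$ is a smooth $H$-principal bundle. A Lie group extension $A\hookrightarrow P\to B$ is a short exact sequence of Lie group morphisms which is a smooth $A$-principal bundle. For a Lie group $\Gamma$ and a Lie group $A$, $C^p_s(\Gamma,A)$ is the set of maps $\Gamma^p\to A$ that are smooth in an identity neighbourhood and equal to $1$ whenever one argument is $1$. $C^2_{ss}(\Gamma,A)$ is the set of those $\omega\in C^2_s(\Gamma,A)$ for which, for every $g\in\Gamma$, the map $x\mapsto\omega(g,x)\,\omega(gxg^{-1},g)^{-1}$ is smooth in an identity neighbourhood. For a smooth $\Gamma$-module $A$, $d$ denotes the group differential, $Z^p$ the cocycles in $C^p$, and $H^3_{ss}(\Gamma,A)=Z^3_s(\Gamma,A)/d\,C^2_{ss}(\Gamma,A)$.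 Let $G$ be a Lie group, $N\trianglelefteq G$ a normal split Lie subgroup, $q_0:G\to G/N$ the quotient map, $Z$ a smooth (abelian) $G$-module, written additively, and $g.n=gng^{-1}$ for $g\in G$, $n\in N$. Let $f\in Z^2_{ss}(N,Z)$ (for the trivial action of $N$ on $Z$) and let $\widehat N=Z\times_fN$ be the set $Z\times N$ with the product $(z,n)(z',n')=(z+z'+f(n,n'),nn')$. Then $\widehat N$ carries a Lie group structure for which, for some open identity neighbourhood $U\subseteq N$, the map $Z\times U\to\widehat N$, $(z,n)\mapsto(z,n)$, is a diffeomorphism onto an open subset; equip $\widehat N$ with it. Let $\theta:G\to C^1_s(N,Z)$ be a $1$-cocycle, i.e. $\theta(gg')(n)=\theta(g)(n)+g.\theta(g')(g^{-1}ng)$, such that $(g,n)\mapsto\theta(g)(n)$ is smooth in an identity neighbourhood of $G\times N$, such that for each $n\in N$ the map $g\mapsto\theta(g)(g.n)+f(g.n,n^{-1})$ is smooth in an identity neighbourhood of $G$, and such that $$\theta(g)(n)+\theta(g)(n')-\theta(g)(nn')=g.f(g^{-1}ng,g^{-1}n'g)-f(n,n')\qquad(g\in G,\ n,n'\in N).$$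 Then $\widehat S(g)(z,n)=(g.z+\theta(g)(g.n),\,g.n)$ defines a homomorphism $\widehat S:G\to\mathrm{Aut}(\widehat N)$ into the automorphism group of the abstract group $\widehat N$. Suppose that $\alpha:\widehat N\to G$, $(z,n)\mapsto n$, together with $\widehat S$ is a smooth crossed module. That is: $\alpha$ and the action map $G\times\widehat N\to\widehat N$ are smooth; $\alpha(\widehat S(g)(x))=g\alpha(x)g^{-1}$ and $\widehat S(\alpha(x))(y)=xyx^{-1}$ for $g\in G$, $x,y\in\widehat N$; $\ker\alpha$ and $\mathrm{im}\,\alpha$ are split Lie subgroups of $\widehat N$ and $G$; and $\alpha$ induces an isomorphism of Lie groups $\widehat N/\ker\alpha\to\mathrm{im}\,\alpha$. (Then $N$ acts trivially on $Z$, so that $Z$ is a $G/N$-module.) Let $\sigma\in C^1_s(G/N,G)$ with $q_0\circ\sigma=\mathrm{id}$ and let $\omega\in C^2_{ss}(G/N,\widehat N)$ be such that the $N$-component of $\omega(x,y)$ is $\delta_\sigma(x,y)=\sigma(x)\sigma(y)\sigma(xy)^{-1}$. Put $S=\widehat S\circ\sigma$ and $$(d_S\omega)(x,y,w)=S(x)(\omega(y,w))\,\omega(x,yw)\,\omega(xy,w)^{-1}\,\omega(x,y)^{-1}.$$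 Then $d_S\omega$ takes values in $Z$ and is an element of $Z^3_s(G/N,Z)$; its class $Q_{ss}(f,\theta)=[d_S\omega]\in H^3_{ss}(G/N,Z)$ is the same for all choices of such $\sigma$ and $\omega$; and the following are equivalent: 1. $Q_{ss}(f,\theta)=0$ in $H^3_{ss}(G/N,Z)$. 2. There exist a Lie group extension $Z\hookrightarrow\widehat G\xrightarrow{q}G$ and a $G$-equivariant equivalence $\varphi:\widehat N\to q^{-1}(N)$ of extensions of $N$ by $Z$, where $q^{-1}(N)$ is regarded as a split Lie subgroup of $\widehat G$; $G$-equivariance means $\varphi(\widehat S(q(a))(x))=a\,\varphi(x)\,a^{-1}$ for $a\in\widehat G$, $x\in\widehat N$. 3. There exists $f_G\in Z^2_{ss}(G,Z)$ with $f_G(n,n')=f(n,n')$ for $n,n'\in N$ and $f_G(g,g^{-1}ng)-f_G(n,g)=\theta(g)(n)$ for $g\in G$, $n\in N$. -/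

import Mathlib

open Set Topology Filter

universe u

/-! ### Differential calculus in locally convex spaces -/

/-- `f` is of class `C^n` (in the sense of Michal and Bastiani) on the set `U`, which is meant to
be open. `f` is `C^0` if it is continuous. It is `C^(n+1)` if it is continuous, all directional
derivatives `df(x)(h) = lim_{t → 0} (f(x + t h) - f(x)) / t` exist for `x ∈ U`, and the
map `(x, h) ↦ df(x)(h)` is of class `C^n` on `U × E`. -/
def LCContDiffOn (𝕜 : Type*) [RCLike 𝕜] {F : Type*} [AddCommGroup F] [Module 𝕜 F]
    [TopologicalSpace F] :
    ℕ → ∀ {E : Type u} [AddCommGroup E] [Module 𝕜 E] [TopologicalSpace E],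
      (E → F) → Set E → Prop
  | 0, _, _, _, _, f, U => ContinuousOn f U
  | n + 1, E, _, _, _, f, U =>
      ContinuousOn f U ∧ ∃ df : E × E → F,
        (∀ x ∈ U, ∀ h : E,
          Tendsto (fun t : 𝕜 => t⁻¹ • (f (x + t • h) - f x)) (𝓝[≠] 0) (𝓝 (df (x, h)))) ∧
        LCContDiffOn 𝕜 n df (U ×ˢ univ)

/-- Smooth maps on open subsets of locally convex spaces. -/
def LCSmoothOn (𝕜 : Type*) [RCLike 𝕜] {E : Type u} {F : Type*}
    [AddCommGroup E] [Module 𝕜 E] [TopologicalSpace E]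
    [AddCommGroup F] [Module 𝕜 F] [TopologicalSpace F] (f : E → F) (U : Set E) : Prop :=
  ∀ n : ℕ, LCContDiffOn 𝕜 n f U

section Calculus

variable {𝕜 : Type*} [RCLike 𝕜] {F F' : Type*}
  [AddCommGroup F] [Module 𝕜 F] [TopologicalSpace F]
  [AddCommGroup F'] [Module 𝕜 F'] [TopologicalSpace F']

theorem LCContDiffOn.continuousOn {n : ℕ} {E : Type u} [AddCommGroup E] [Module 𝕜 E]
    [TopologicalSpace E] {f : E → F} {U : Set E} (h : LCContDiffOn 𝕜 n f U) :
    ContinuousOn f U := by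
  cases n with
  | zero => exact h
  | succ n => exact h.1

theorem LCContDiffOn.comp_linear (n : ℕ) : ∀ {E E' : Type u}
    [AddCommGroup E] [Module 𝕜 E] [TopologicalSpace E]
    [AddCommGroup E'] [Module 𝕜 E'] [TopologicalSpace E']
    (L : E' →L[𝕜] E) {f : E → F} {U : Set E} {V : Set E'},
    LCContDiffOn 𝕜 n f U → MapsTo L V U → LCContDiffOn 𝕜 n (fun x => f (L x)) V := by
  induction n with
  | zero =>
    intro E E' _ _ _ _ _ _ L f U V h hV
    exact ContinuousOn.comp (g := f) h L.continuous.continuousOn hV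
  | succ n ih =>
    intro E E' _ _ _ _ _ _ L f U V h hV
    obtain ⟨hc, df, hdf, hn⟩ := h
    refine ⟨hc.comp L.continuous.continuousOn hV, fun p => df (L.prodMap L p), ?_, ?_⟩
    · intro x hx k
      simpa using hdf (L x) (hV hx) (L k)
    · exact ih (L.prodMap L) hn (fun p hp => ⟨hV hp.1, mem_univ _⟩)

theorem LCContDiffOn.pair (n : ℕ) : ∀ {E : Type u}
    [AddCommGroup E] [Module 𝕜 E] [TopologicalSpace E]
    {f : E → F} {g : E → F'} {U : Set E},
    LCContDiffOn 𝕜 n f U → LCContDiffOn 𝕜 n g U →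
      LCContDiffOn 𝕜 n (fun x => (f x, g x)) U := by
  induction n with
  | zero =>
    intro E _ _ _ f g U hf hg
    exact ContinuousOn.prodMk hf hg
  | succ n ih =>
    intro E _ _ _ f g U hf hg
    obtain ⟨hc, df, hdf, hn⟩ := hf
    obtain ⟨hc', dg, hdg, hn'⟩ := hg
    refine ⟨hc.prodMk hc', fun p => (df p, dg p), ?_, ih hn hn'⟩
    intro x hx k
    exact (hdf x hx k).prodMk_nhds (hdg x hx k)

theorem LCContDiffOn.const (n : ℕ) : ∀ {E : Type u}
    [AddCommGroup E] [Module 𝕜 E] [TopologicalSpace E] (c : F) (U : Set E),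
    LCContDiffOn 𝕜 n (fun _ => c) U := by
  induction n with
  | zero => intro E _ _ _ c U; exact continuousOn_const
  | succ n ih =>
    intro E _ _ _ c U
    refine ⟨continuousOn_const, fun _ => 0, ?_, ih 0 _⟩
    intro x _ k
    simpa using (tendsto_const_nhds : Tendsto (fun _ : 𝕜 => (0 : F)) (𝓝[≠] 0) (𝓝 0))

end Calculus

/-! ### Smooth manifolds modelled on locally convex spaces, Lie groups -/

/-- A smooth (Hausdorff) manifold structure over `𝕜` on the type `M`, modelled on a Hausdorff
locally convex space `E`. -/
structure SmoothMfd (𝕜 : Type*) [RCLike 𝕜] (M : Type u) where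
  /-- the model space -/
  E : Type u
  [instAddCommGroup : AddCommGroup E]
  [instModule : Module 𝕜 E]
  [instModuleReal : Module ℝ E]
  [instScalarTower : IsScalarTower ℝ 𝕜 E]
  [instTopE : TopologicalSpace E]
  [instTopAddGroup : IsTopologicalAddGroup E]
  [instContSMul : ContinuousSMul 𝕜 E]
  [instT2E : T2Space E]
  [instLC : LocallyConvexSpace ℝ E]
  /-- the topology of the manifold -/
  top : TopologicalSpace M
  t2 : T2Space M
  /-- the charts -/
  atlas : Set (OpenPartialHomeomorph M E)
  cover : ∀ x : M, ∃ e ∈ atlas, x ∈ e.source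
  compat : ∀ e ∈ atlas, ∀ e' ∈ atlas,
    LCSmoothOn 𝕜 (fun v => e' (e.symm v)) (e.target ∩ e.symm ⁻¹' e'.source)

attribute [instance] SmoothMfd.instAddCommGroup SmoothMfd.instModule SmoothMfd.instModuleReal
  SmoothMfd.instScalarTower SmoothMfd.instTopE SmoothMfd.instTopAddGroup
  SmoothMfd.instContSMul SmoothMfd.instT2E SmoothMfd.instLC

namespace SmoothMfd

variable {𝕜 : Type*} [RCLike 𝕜] {M M' : Type u}

/-- `U` is open in the manifold `A`. -/
def IsOpenIn (A : SmoothMfd 𝕜 M) (U : Set M) : Prop := IsOpen[A.top] U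

/-- Smoothness of `f : M → M'` on the set `U`, which is meant to be open: `f` is continuous on
`U` and smooth in all charts. -/
def SmoothOn (A : SmoothMfd 𝕜 M) (B : SmoothMfd 𝕜 M') (f : M → M') (U : Set M) : Prop :=
  @ContinuousOn M M' A.top B.top f U ∧
    ∀ e ∈ A.atlas, ∀ e' ∈ B.atlas,
      LCSmoothOn 𝕜 (fun v => e' (f (e.invFun v))) (e.target ∩ e.invFun ⁻¹' (U ∩ f ⁻¹' e'.source))

/-- Smooth maps. -/
def Smooth (A : SmoothMfd 𝕜 M) (B : SmoothMfd 𝕜 M') (f : M → M') : Prop :=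
  A.SmoothOn B f univ

/-- `f` is smooth on some open neighbourhood of `x`. -/
def SmoothNear (A : SmoothMfd 𝕜 M) (B : SmoothMfd 𝕜 M') (f : M → M') (x : M) : Prop :=
  ∃ U : Set M, A.IsOpenIn U ∧ x ∈ U ∧ A.SmoothOn B f U

theorem smoothNear_const (A : SmoothMfd 𝕜 M) (B : SmoothMfd 𝕜 M') (c : M') (x : M) :
    A.SmoothNear B (fun _ => c) x := by
  let := A.top
  let := B.top
  exact ⟨univ, isOpen_univ, mem_univ _, continuousOn_const,
    fun _ _ _ _ n => LCContDiffOn.const n _ _⟩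

/-- The product manifold. -/
def prod (A : SmoothMfd 𝕜 M) (B : SmoothMfd 𝕜 M') : SmoothMfd 𝕜 (M × M') :=
  letI := A.top
  letI := B.top
  { E := A.E × B.E
    top := inferInstance
    t2 := haveI := A.t2; haveI := B.t2; inferInstance
    atlas := {e | ∃ a ∈ A.atlas, ∃ b ∈ B.atlas, e = a.prod b}
    cover := by
      intro x
      obtain ⟨a, ha, hxa⟩ := A.cover x.1
      obtain ⟨b, hb, hxb⟩ := B.cover x.2
      exact ⟨a.prod b, ⟨a, ha, b, hb, rfl⟩, ⟨hxa, hxb⟩⟩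
    compat := by
      rintro _ ⟨a, ha, b, hb, rfl⟩ _ ⟨a', ha', b', hb', rfl⟩ n
      have h1 := LCContDiffOn.comp_linear n (ContinuousLinearMap.fst 𝕜 A.E B.E)
        (V := ((a.prod b).target ∩ (a.prod b).symm ⁻¹' (a'.prod b').source))
        (A.compat a ha a' ha' n) (fun p hp => ⟨hp.1.1, hp.2.1⟩)
      have h2 := LCContDiffOn.comp_linear n (ContinuousLinearMap.snd 𝕜 A.E B.E)
        (V := ((a.prod b).target ∩ (a.prod b).symm ⁻¹' (a'.prod b').source))
        (B.compat b hb b' hb' n) (fun p hp => ⟨hp.1.2, hp.2.2⟩)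
      exact LCContDiffOn.pair n h1 h2 }

end SmoothMfd

/-- A Lie group structure on the group `G`: a smooth manifold structure modelled on a locally
convex space for which multiplication and inversion are smooth. -/
structure LieGroupStr (𝕜 : Type*) [RCLike 𝕜] (G : Type u) [Group G] extends
    SmoothMfd 𝕜 G where
  smooth_mul : (toSmoothMfd.prod toSmoothMfd).Smooth toSmoothMfd (fun p : G × G => p.1 * p.2)
  smooth_inv : toSmoothMfd.Smooth toSmoothMfd (fun g : G => g⁻¹)

/-! ### Split Lie subgroups and extensions of Lie groups -/

section Bundles

variable {𝕜 : Type*} [RCLike 𝕜] {H P B : Type u} [Group H] [Group P]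

/-- The injective homomorphism `ι : H → P` of Lie groups and the smooth map `π : P → B` turn `P`
into a smooth principal bundle over the manifold `B` for the right action `p.h = p ι(h)`
of `H` on `P`: the fibres of `π` are the orbits of `H`, and over suitable open sets `U` covering
`B` there are smooth sections `s` such that `U × H → π⁻¹(U), (b, h) ↦ s(b) ι(h)` is a
diffeomorphism (`k` is the `H`-component of its inverse). -/
structure IsCosetBundle (LH : LieGroupStr 𝕜 H) (LP : LieGroupStr 𝕜 P) (MB : SmoothMfd 𝕜 B)
    (ι : H →* P) (π : P → B) : Prop where
  injective : Function.Injective ι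
  smooth_incl : LH.Smooth LP.toSmoothMfd ι
  smooth_proj : LP.Smooth MB π
  fibre : ∀ p p' : P, π p = π p' ↔ ∃ h : H, p' = p * ι h
  local_triv : ∀ b : B, ∃ U : Set B, MB.IsOpenIn U ∧ b ∈ U ∧
    ∃ (s : B → P) (k : P → H),
      MB.SmoothOn LP.toSmoothMfd s U ∧ (∀ y ∈ U, π (s y) = y) ∧
      LP.SmoothOn LH.toSmoothMfd k (π ⁻¹' U) ∧ (∀ p ∈ π ⁻¹' U, p = s (π p) * ι (k p))

/-- The subgroup `K` of the Lie group `P`, with the Lie group structure `LK` on `K`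
and the manifold structure `MQ` on the space `P ⧸ K` of cosets `p K`, is a split Lie subgroup. -/
def IsSplitLieSubgroup (LP : LieGroupStr 𝕜 P) (K : Subgroup P) (LK : LieGroupStr 𝕜 K)
    (MQ : SmoothMfd 𝕜 (P ⧸ K)) : Prop :=
  IsCosetBundle LK LP MQ K.subtype (fun p => (p : P ⧸ K))

/-- `1 → H → P → B → 1` is an extension of Lie groups: a short exact sequence of Lie group
morphisms for which `P` is a smooth `H`-principal bundle over `B`. -/
def IsLieGroupExtension [Group B] (LH : LieGroupStr 𝕜 H) (LP : LieGroupStr 𝕜 P)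
    (LB : LieGroupStr 𝕜 B) (ι : H →* P) (q : P →* B) : Prop :=
  ι.range = q.ker ∧ Function.Surjective q ∧ IsCosetBundle LH LP LB.toSmoothMfd ι q

/-- A smooth crossed module `α : H → P` with the action `S` of `P` on `H`. -/
structure IsSmoothCrossedModule (LH : LieGroupStr 𝕜 H) (LP : LieGroupStr 𝕜 P)
    (α : H →* P) (S : P →* MulAut H) : Prop where
  smooth_hom : LH.Smooth LP.toSmoothMfd α
  smooth_action : (LP.prod LH.toSmoothMfd).Smooth LH.toSmoothMfd (fun x : P × H => S x.1 x.2)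
  equivariant : ∀ (g : P) (h : H), α (S g h) = g * α h * g⁻¹
  peiffer : ∀ h h' : H, S (α h) h' = h * h' * h⁻¹
  /-- kernel and range of `α` are split Lie subgroups and `α` induces an isomorphism
  `H / ker α → im α` of Lie groups -/
  split : ∃ (LK : LieGroupStr 𝕜 α.ker) (MQ : SmoothMfd 𝕜 (H ⧸ α.ker))
      (LI : LieGroupStr 𝕜 α.range) (MC : SmoothMfd 𝕜 (P ⧸ α.range)),
    IsSplitLieSubgroup LH α.ker LK MQ ∧ IsSplitLieSubgroup LP α.range LI MC ∧
    MQ.Smooth LI.toSmoothMfd (QuotientGroup.quotientKerEquivRange α) ∧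
    LI.Smooth MQ (QuotientGroup.quotientKerEquivRange α).symm

end Bundles

/-! ### Locally smooth cochains -/

section Cochains

variable {𝕜 : Type*} [RCLike 𝕜] {Γ A : Type u} [Group Γ]

/-- Normalized locally smooth `1`-cochains, `C^1_s(Γ, A)`. -/
def IsC1s [Group A] (MΓ : SmoothMfd 𝕜 Γ) (MA : SmoothMfd 𝕜 A) (h : Γ → A) : Prop :=
  h 1 = 1 ∧ MΓ.SmoothNear MA h 1

/-- Normalized locally smooth `2`-cochains, `C^2_s(Γ, A)`. -/
def IsC2s [Group A] (MΓ : SmoothMfd 𝕜 Γ) (MA : SmoothMfd 𝕜 A) (ω : Γ → Γ → A) : Prop :=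
  (∀ g, ω 1 g = 1) ∧ (∀ g, ω g 1 = 1) ∧
    (MΓ.prod MΓ).SmoothNear MA (fun p => ω p.1 p.2) (1, 1)

/-- The set `C^2_ss(Γ, A)` of those `ω ∈ C^2_s(Γ, A)` for which all the functions
`ω_g(x) = ω(g, x) ω(g x g⁻¹, g)⁻¹` are smooth in an identity neighbourhood. -/
def IsC2ss [Group A] (MΓ : SmoothMfd 𝕜 Γ) (MA : SmoothMfd 𝕜 A) (ω : Γ → Γ → A) : Prop :=
  IsC2s MΓ MA ω ∧
    ∀ g, MΓ.SmoothNear MA (fun x => ω g x * (ω (g * x * g⁻¹) g)⁻¹) 1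

/-- Normalized locally smooth `3`-cochains, `C^3_s(Γ, A)`. -/
def IsC3s [Group A] (MΓ : SmoothMfd 𝕜 Γ) (MA : SmoothMfd 𝕜 A) (c : Γ → Γ → Γ → A) : Prop :=
  (∀ g g', c 1 g g' = 1) ∧ (∀ g g', c g 1 g' = 1) ∧ (∀ g g', c g g' 1 = 1) ∧
    (MΓ.prod (MΓ.prod MΓ)).SmoothNear MA (fun p => c p.1 p.2.1 p.2.2) (1, 1, 1)

/-- `δ_σ(g, g') = σ(g) σ(g') σ(g g')⁻¹`. -/
def deltaMap [Group A] (σ : Γ → A) (g g' : Γ) : A := σ g * σ g' * (σ (g * g'))⁻¹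

/-- `(d_S ω)(g, g', g'') = S(g)(ω(g', g'')) ω(g, g' g'') ω(g g', g'')⁻¹ ω(g, g')⁻¹`.
If `A` is abelian and `S` is a homomorphism, this is the group differential on `2`-cochains,
written multiplicatively. -/
def dTwo [Group A] (S : Γ → MulAut A) (ω : Γ → Γ → A) (g g' g'' : Γ) : A :=
  S g (ω g' g'') * ω g (g' * g'') * (ω (g * g') g'')⁻¹ * (ω g g')⁻¹

/-- The group differential on `3`-cochains with values in an abelian group, written
multiplicatively. -/
def dThree [CommGroup A] (ρ : Γ → MulAut A) (c : Γ → Γ → Γ → A) (g₀ g₁ g₂ g₃ : Γ) : A :=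
  ρ g₀ (c g₁ g₂ g₃) * (c (g₀ * g₁) g₂ g₃)⁻¹ * c g₀ (g₁ * g₂) g₃ * (c g₀ g₁ (g₂ * g₃))⁻¹ *
    c g₀ g₁ g₂

/-- `Z^2_ss(Γ, A)` for the abelian group `A` with the action `ρ` of `Γ`. -/
structure Z2ss [CommGroup A] (MΓ : SmoothMfd 𝕜 Γ) (MA : SmoothMfd 𝕜 A) (ρ : Γ →* MulAut A) where
  /-- the underlying function -/
  fn : Γ → Γ → A
  c2ss : IsC2ss MΓ MA fn
  cocycle : ∀ g g' g'', dTwo ρ fn g g' g'' = 1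

/-- `Z^3_s(Γ, A)` for the abelian group `A` with the action `ρ` of `Γ`. -/
structure Z3s [CommGroup A] (MΓ : SmoothMfd 𝕜 Γ) (MA : SmoothMfd 𝕜 A) (ρ : Γ →* MulAut A) where
  /-- the underlying function -/
  fn : Γ → Γ → Γ → A
  c3s : IsC3s MΓ MA fn
  cocycle : ∀ g₀ g₁ g₂ g₃, dThree ρ fn g₀ g₁ g₂ g₃ = 1

/-- The zero cocycle (the constant `1` in multiplicative notation). -/
def Z3s.trivial [CommGroup A] (MΓ : SmoothMfd 𝕜 Γ) (MA : SmoothMfd 𝕜 A) (ρ : Γ →* MulAut A) :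
    Z3s MΓ MA ρ where
  fn := fun _ _ _ => 1
  c3s := ⟨fun _ _ => rfl, fun _ _ => rfl, fun _ _ => rfl, SmoothMfd.smoothNear_const _ _ _ _⟩
  cocycle := by intros; simp [dThree]

/-- `H^3_ss(Γ, A) = Z^3_s(Γ, A) / d(C^2_ss(Γ, A))`: two cocycles define the same class iff
they differ by `d β` for some `β ∈ C^2_ss(Γ, A)`. -/
def H3ss [CommGroup A] (MΓ : SmoothMfd 𝕜 Γ) (MA : SmoothMfd 𝕜 A) (ρ : Γ →* MulAut A) :
    Type u :=
  Quot (fun c c' : Z3s MΓ MA ρ => ∃ β : Γ → Γ → A, IsC2ss MΓ MA β ∧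
    ∀ g g' g'', c'.fn g g' g'' = c.fn g g' g'' * dTwo ρ β g g' g'')

/-- The cohomology class of a cocycle. -/
def H3ss.mk [CommGroup A] {MΓ : SmoothMfd 𝕜 Γ} {MA : SmoothMfd 𝕜 A} {ρ : Γ →* MulAut A}
    (c : Z3s MΓ MA ρ) : H3ss MΓ MA ρ := Quot.mk _ c

/-- The neutral element of `H^3_ss(Γ, A)`. -/
def H3ss.trivial [CommGroup A] (MΓ : SmoothMfd 𝕜 Γ) (MA : SmoothMfd 𝕜 A) (ρ : Γ →* MulAut A) :
    H3ss MΓ MA ρ := H3ss.mk (Z3s.trivial MΓ MA ρ)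

end Cochains

/-! ### Central extensions defined by cocycles -/

/-- The set underlying the central extension `A ×_f Γ` defined by `f ∈ Z^2_ss(Γ, A)`,
where `Γ` acts trivially on `A`. -/
@[ext]
structure CentralExt {𝕜 : Type*} [RCLike 𝕜] {Γ A : Type u} [Group Γ] [CommGroup A]
    {MΓ : SmoothMfd 𝕜 Γ} {MA : SmoothMfd 𝕜 A} (f : Z2ss MΓ MA 1) where
  fst : A
  snd : Γ

namespace CentralExt

variable {𝕜 : Type*} [RCLike 𝕜] {Γ A : Type u} [Group Γ] [CommGroup A]
  {MΓ : SmoothMfd 𝕜 Γ} {MA : SmoothMfd 𝕜 A}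

theorem cocycle_eq (f : Z2ss MΓ MA 1) (a b c : Γ) :
    f.fn b c * f.fn a (b * c) = f.fn a b * f.fn (a * b) c := by
  have h := f.cocycle a b c
  simp only [dTwo, MonoidHom.one_apply, MulAut.one_apply] at h
  rw [mul_inv_eq_one, mul_inv_eq_iff_eq_mul] at h
  exact h

theorem cocycle_inv (f : Z2ss MΓ MA 1) (a : Γ) : f.fn a⁻¹ a = f.fn a a⁻¹ := by
  have h := cocycle_eq f a a⁻¹ a
  simpa [f.c2ss.1.1, f.c2ss.1.2.1] using h

/-- The group structure `(a, n)(a', n') = (a a' f(n, n'), n n')`. -/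
instance (f : Z2ss MΓ MA 1) : Group (CentralExt f) where
  mul x y := ⟨x.fst * y.fst * f.fn x.snd y.snd, x.snd * y.snd⟩
  one := ⟨1, 1⟩
  inv x := ⟨x.fst⁻¹ * (f.fn x.snd⁻¹ x.snd)⁻¹, x.snd⁻¹⟩
  mul_assoc x y z := by
    refine CentralExt.ext ?_ (mul_assoc _ _ _)
    change x.fst * y.fst * f.fn x.snd y.snd * z.fst * f.fn (x.snd * y.snd) z.snd =
      x.fst * (y.fst * z.fst * f.fn y.snd z.snd) * f.fn x.snd (y.snd * z.snd)
    have h := cocycle_eq f x.snd y.snd z.snd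
    calc _ = x.fst * y.fst * z.fst * (f.fn x.snd y.snd * f.fn (x.snd * y.snd) z.snd) := by
          simp only [mul_assoc, mul_comm, mul_left_comm]
      _ = _ := by rw [← h]; simp only [mul_assoc]
  one_mul x := by
    refine CentralExt.ext ?_ (one_mul _)
    change 1 * x.fst * f.fn 1 x.snd = x.fst
    rw [f.c2ss.1.1]; simp
  mul_one x := by
    refine CentralExt.ext ?_ (mul_one _)
    change x.fst * 1 * f.fn x.snd 1 = x.fst
    rw [f.c2ss.1.2.1]; simp
  inv_mul_cancel x := by
    refine CentralExt.ext ?_ (inv_mul_cancel _)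
    change x.fst⁻¹ * (f.fn x.snd⁻¹ x.snd)⁻¹ * x.fst * f.fn x.snd⁻¹ x.snd = 1
    rw [mul_right_comm, inv_mul_cancel_right, inv_mul_cancel]

theorem mul_fst {f : Z2ss MΓ MA 1} (x y : CentralExt f) :
    (x * y).fst = x.fst * y.fst * f.fn x.snd y.snd := rfl

theorem mul_snd {f : Z2ss MΓ MA 1} (x y : CentralExt f) : (x * y).snd = x.snd * y.snd := rfl

theorem one_fst {f : Z2ss MΓ MA 1} : (1 : CentralExt f).fst = 1 := rfl

theorem one_snd {f : Z2ss MΓ MA 1} : (1 : CentralExt f).snd = 1 := rfl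

/-- The quotient homomorphism `A ×_f Γ → Γ`. -/
def proj (f : Z2ss MΓ MA 1) : CentralExt f →* Γ where
  toFun x := x.snd
  map_one' := rfl
  map_mul' _ _ := rfl

/-- The inclusion `A → A ×_f Γ`. -/
def incl (f : Z2ss MΓ MA 1) : A →* CentralExt f where
  toFun a := ⟨a, 1⟩
  map_one' := rfl
  map_mul' a b := by
    refine CentralExt.ext ?_ (mul_one _).symm
    change a * b = a * b * f.fn 1 1
    rw [f.c2ss.1.1]; simp

/-- `L` is the Lie group structure on `A ×_f Γ` for which, for some open identity
neighbourhood `U` in `Γ`, the map `A × U → A ×_f Γ, (a, n) ↦ (a, n)` is a diffeomorphism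
onto an open subset. -/
def IsStandard {f : Z2ss MΓ MA 1} (L : LieGroupStr 𝕜 (CentralExt f)) : Prop :=
  ∃ U : Set Γ, MΓ.IsOpenIn U ∧ (1 : Γ) ∈ U ∧
    (MA.prod MΓ).SmoothOn L.toSmoothMfd (fun p => ⟨p.1, p.2⟩) (univ ×ˢ U) ∧
    L.IsOpenIn {x | x.snd ∈ U} ∧
    L.SmoothOn (MA.prod MΓ) (fun x => (x.fst, x.snd)) {x | x.snd ∈ U}

end CentralExt

/-! ### The action defined by `θ` and the obstruction class -/

section Crossed

variable {𝕜 : Type*} [RCLike 𝕜] {G Z : Type u} [Group G] [CommGroup Z]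
  {N : Subgroup G} [N.Normal]

/-- The set `Z^1_ss(G, C^1_s(N, Z))_f`: cocycles `θ` for the action
`(g.α)(n) = g.α(g⁻¹ n g)` of `G` on `C^1_s(N, Z)`, such that `(g, n) ↦ θ(g)(n)` is smooth in an
identity neighbourhood and, for each `n`, so is `g ↦ θ(g)(g.n) f(g.n, n⁻¹)`,
where `g.n = g n g⁻¹`. -/
structure IsZ1ss (LG : LieGroupStr 𝕜 G) (LZ : LieGroupStr 𝕜 Z) (LN : LieGroupStr 𝕜 N)
    (ρ : G →* MulAut Z) (f : Z2ss LN.toSmoothMfd LZ.toSmoothMfd 1) (θ : G → N → Z) : Prop where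
  c1s : ∀ g, IsC1s LN.toSmoothMfd LZ.toSmoothMfd (θ g)
  smooth : (LG.prod LN.toSmoothMfd).SmoothNear LZ.toSmoothMfd (fun p => θ p.1 p.2) (1, 1)
  orbit : ∀ n : N, LG.SmoothNear LZ.toSmoothMfd
    (fun g => θ g (MulAut.conjNormal g n) * f.fn (MulAut.conjNormal g n) n⁻¹) 1
  cocycle : ∀ (g g' : G) (n : N),
    θ (g * g') n = θ g n * ρ g (θ g' (MulAut.conjNormal g⁻¹ n))

/-- The relation `d_N(θ(g)) = g.f - f` for all `g ∈ G`, written multiplicatively. -/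
def IsCompatible {LN : LieGroupStr 𝕜 N} {LZ : LieGroupStr 𝕜 Z} (ρ : G →* MulAut Z)
    (f : Z2ss LN.toSmoothMfd LZ.toSmoothMfd 1) (θ : G → N → Z) : Prop :=
  ∀ (g : G) (n n' : N), θ g n' * (θ g (n * n'))⁻¹ * θ g n =
    ρ g (f.fn (MulAut.conjNormal g⁻¹ n) (MulAut.conjNormal g⁻¹ n')) * (f.fn n n')⁻¹

variable {LG : LieGroupStr 𝕜 G} {LZ : LieGroupStr 𝕜 Z} {LN : LieGroupStr 𝕜 N}
  {ρ : G →* MulAut Z} {f : Z2ss LN.toSmoothMfd LZ.toSmoothMfd 1} {θ : G → N → Z}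

theorem IsZ1ss.one (hθ : IsZ1ss LG LZ LN ρ f θ) (n : N) : θ 1 n = 1 := by
  have h := hθ.cocycle 1 1 n
  simpa using h

/-- The homomorphism `Ŝ : G → Aut(Z ×_f N)`,
`Ŝ(g)(z, n) = (g.z · θ(g)(g.n), g.n)` with `g.n = g n g⁻¹`. -/
def extAction (hθ : IsZ1ss LG LZ LN ρ f θ) (hc : IsCompatible ρ f θ) :
    G →* MulAut (CentralExt f) :=
  letI act : MulDistribMulAction G (CentralExt f) :=
    { smul := fun g x =>
        ⟨ρ g x.fst * θ g (MulAut.conjNormal g x.snd), MulAut.conjNormal g x.snd⟩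
      one_smul := by
        intro x
        refine CentralExt.ext ?_ ?_
        · change ρ 1 x.fst * θ 1 (MulAut.conjNormal 1 x.snd) = x.fst
          simp [hθ.one]
        · change MulAut.conjNormal (1 : G) x.snd = x.snd
          simp
      mul_smul := by
        intro g g' x
        refine CentralExt.ext ?_ ?_
        · change ρ (g * g') x.fst * θ (g * g') (MulAut.conjNormal (g * g') x.snd) =
            ρ g (ρ g' x.fst * θ g' (MulAut.conjNormal g' x.snd)) *
              θ g (MulAut.conjNormal g (MulAut.conjNormal g' x.snd))
          rw [hθ.cocycle, mul_comm (θ g _), ← mul_assoc]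
          simp
        · change MulAut.conjNormal (g * g') x.snd =
            MulAut.conjNormal g (MulAut.conjNormal g' x.snd)
          simp
      smul_one := by
        intro g
        refine CentralExt.ext ?_ ?_
        · change ρ g 1 * θ g (MulAut.conjNormal g 1) = 1
          simp [(hθ.c1s g).1]
        · change MulAut.conjNormal g (1 : N) = 1
          simp
      smul_mul := by
        intro g x y
        refine CentralExt.ext ?_ ?_
        · change ρ g (x.fst * y.fst * f.fn x.snd y.snd) *
              θ g (MulAut.conjNormal g (x.snd * y.snd)) =
            ρ g x.fst * θ g (MulAut.conjNormal g x.snd) *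
              (ρ g y.fst * θ g (MulAut.conjNormal g y.snd)) *
              f.fn (MulAut.conjNormal g x.snd) (MulAut.conjNormal g y.snd)
          have h := hc g (MulAut.conjNormal g x.snd) (MulAut.conjNormal g y.snd)
          simp only [← MulAut.mul_apply, ← map_mul, inv_mul_cancel, map_one,
            MulAut.one_apply] at h
          rw [eq_mul_inv_iff_mul_eq] at h
          rw [map_mul, map_mul, ← h]
          simp [mul_assoc, mul_comm, mul_left_comm]
        · change MulAut.conjNormal g (x.snd * y.snd) =
            MulAut.conjNormal g x.snd * MulAut.conjNormal g y.snd
          simp }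
  MulDistribMulAction.toMulAut G (CentralExt f)

theorem extAction_apply (hθ : IsZ1ss LG LZ LN ρ f θ) (hc : IsCompatible ρ f θ) (g : G)
    (x : CentralExt f) : extAction hθ hc g x =
      ⟨ρ g x.fst * θ g (MulAut.conjNormal g x.snd), MulAut.conjNormal g x.snd⟩ := rfl

/-- The homomorphism `α : Z ×_f N → G, (z, n) ↦ n`. -/
def alphaHom (f : Z2ss LN.toSmoothMfd LZ.toSmoothMfd 1) : CentralExt f →* G :=
  N.subtype.comp (CentralExt.proj f)

theorem IsSmoothCrossedModule.le_ker {hθ : IsZ1ss LG LZ LN ρ f θ} {hc : IsCompatible ρ f θ}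
    {L : LieGroupStr 𝕜 (CentralExt f)}
    (h : IsSmoothCrossedModule L LG (alphaHom f) (extAction hθ hc)) : N ≤ ρ.ker := by
  intro n hn
  rw [MonoidHom.mem_ker]
  ext z
  have h1 := h.peiffer ⟨1, ⟨n, hn⟩⟩ ⟨z, 1⟩
  have h2 : (⟨1, ⟨n, hn⟩⟩ : CentralExt f) * ⟨z, 1⟩ = ⟨z, 1⟩ * ⟨1, ⟨n, hn⟩⟩ := by
    refine CentralExt.ext ?_ ?_
    · simp [CentralExt.mul_fst, f.c2ss.1.1, f.c2ss.1.2.1]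
    · simp [CentralExt.mul_snd]
  rw [h2, mul_inv_cancel_right] at h1
  have h3 := congrArg CentralExt.fst h1
  rw [extAction_apply] at h3
  simpa [(hθ.c1s _).1, alphaHom, CentralExt.proj] using h3

/-- The action of `G ⧸ N` on `Z` induced by the action `ρ` of `G`, on which `N` acts trivially. -/
def quotAction (ρ : G →* MulAut Z) (h : N ≤ ρ.ker) : G ⧸ N →* MulAut Z :=
  QuotientGroup.lift N ρ h

/-- `σ : G/N → G` is a normalized locally smooth section, and `ω ∈ C^2_ss(G/N, Z ×_f N)`
lifts `δ_σ` to `Z ×_f N`. -/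
structure IsFactorData (LG : LieGroupStr 𝕜 G) (MQ : SmoothMfd 𝕜 (G ⧸ N))
    (L : LieGroupStr 𝕜 (CentralExt f)) (σ : G ⧸ N → G) (ω : G ⧸ N → G ⧸ N → CentralExt f) :
    Prop where
  section_eq : ∀ x, (σ x : G ⧸ N) = x
  section_c1s : IsC1s MQ LG.toSmoothMfd σ
  c2ss : IsC2ss MQ L.toSmoothMfd ω
  lift_eq : ∀ x y, ((CentralExt.proj f (ω x y) : N) : G) = deltaMap σ x y

/-- The function `w : (G/N)^3 → Z ×_f N` takes values in `Z`, is an element of `Z^3_s(G/N, Z)`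
and `Q` is its class in `H^3_ss(G/N, Z)`. -/
def HasClass {MQ : SmoothMfd 𝕜 (G ⧸ N)} {ρ' : G ⧸ N →* MulAut Z}
    (w : G ⧸ N → G ⧸ N → G ⧸ N → CentralExt f) (Q : H3ss MQ LZ.toSmoothMfd ρ') : Prop :=
  ∃ c : Z3s MQ LZ.toSmoothMfd ρ', (∀ x y z, w x y z = CentralExt.incl f (c.fn x y z)) ∧
    H3ss.mk c = Q

/-- There is a Lie group extension `Z → Ĝ → G` (homomorphisms `ι` and `q`) together with a
`G`-equivariant equivalence `φ : Z ×_f N → q⁻¹(N)` of extensions of `N` by `Z`. Here `q⁻¹(N)`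
carries its structure `LP` of a split Lie subgroup of `Ĝ`, and `g = q(ĝ) ∈ G` acts on it by
conjugation with `ĝ`. -/
def HasEquivariantExtension (LG : LieGroupStr 𝕜 G) (L : LieGroupStr 𝕜 (CentralExt f))
    (S : G →* MulAut (CentralExt f)) : Prop :=
  ∃ (Ghat : Type u) (_ : Group Ghat) (LGhat : LieGroupStr 𝕜 Ghat) (ι : Z →* Ghat)
      (q : Ghat →* G),
    IsLieGroupExtension LZ LGhat LG ι q ∧
    ∃ (LP : LieGroupStr 𝕜 (N.comap q)) (MP : SmoothMfd 𝕜 (Ghat ⧸ N.comap q)),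
      IsSplitLieSubgroup LGhat (N.comap q) LP MP ∧
      ∃ (ιP : Z →* N.comap q) (φ : CentralExt f →* N.comap q),
        (∀ z, (ιP z : Ghat) = ι z) ∧
        IsLieGroupExtension LZ LP LN ιP (q.subgroupComap N) ∧
        L.Smooth LP.toSmoothMfd φ ∧
        (∀ z, φ (CentralExt.incl f z) = ιP z) ∧
        (∀ x, q.subgroupComap N (φ x) = CentralExt.proj f x) ∧
        (∀ (a : Ghat) (x : CentralExt f), (φ (S (q a) x) : Ghat) = a * φ x * a⁻¹)

/-- The cocycle `F ∈ Z^2_ss(G, Z)` restricts to `f` on `N × N`, and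
`F̃(g)(n) = F(g, g⁻¹ n g) - F(n, g)` restricts to `θ` on `G × N`. -/
def Extends (F : Z2ss LG.toSmoothMfd LZ.toSmoothMfd ρ)
    (f : Z2ss LN.toSmoothMfd LZ.toSmoothMfd 1) (θ : G → N → Z) : Prop :=
  (∀ n n' : N, F.fn n n' = f.fn n n') ∧
    ∀ (g : G) (n : N), F.fn g (g⁻¹ * n * g) * (F.fn n g)⁻¹ = θ g n

end Crossed

/-!
Smooth cochains are only controlled near the identity, so every smoothness statement is made at a
point: a homomorphism is smooth once it is smooth at `1`, and a group with a chart around `1` in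
which the group operations and all conjugations are smooth at `1` is a Lie group for a unique
structure extending that chart. The condition defining `C^2_ss` says exactly that conjugations are
smooth at `1` in a twisted product, which gives the Lie groups `Z ×_f N` and `Z ×_F G`.

Since `α (ω x y) = δ_σ x y`, the crossed module axioms put `d_S ω` into `ker α = Z` and make it a
cocycle. Two operations on a pair `(σ, ω)` suffice to compare any two of them: multiplying `ω` by a
`Z`-valued cochain `β` multiplies `d_S ω` by `d β`, and replacing `σ` by `(α ∘ η) σ`, with the
corresponding twist of `ω`, leaves `d_S ω` unchanged. Hence the class of `d_S ω` is independent of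
the pair, and it vanishes exactly when `d_S ω = 1` for some pair.

Given such a pair, pull it back along `G → G ⧸ N` and choose `η` with `α (η g) σ(g) = g`. The twist
by `η` replaces the section by the identity of `G`, so the twisted `ω` has values in `ker α`: it is
a cocycle `F ∈ Z^2_ss(G, Z)`, and it extends `f` and `θ`. For such an `F`, the group `Z ×_f N` is
the preimage of `N` in `Z ×_F G`. Finally, if `φ` is an equivariant equivalence of `Z ×_f N` with
the preimage of `N` in an extension `q : Ĝ → G`, and `s` is a section of `q`, then `S(x)`
corresponds to conjugation by `s (σ x)`, so that `ω = φ⁻¹ ∘ δ_{s ∘ σ}` satisfies `d_S ω = 1` by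
associativity in `Ĝ`.
-/

/-! ### The chain rule -/

section DirectionalDerivative

variable {𝕜 : Type*} [RCLike 𝕜] {E F : Type*}
  [AddCommGroup E] [Module 𝕜 E] [AddCommGroup F] [Module 𝕜 F] [TopologicalSpace F]

/-- The derivative of `f` at each `x ∈ U` in each direction `h` is `df (x, h)`. -/
def HasDirDerivOn (𝕜 : Type*) [RCLike 𝕜] {E F : Type*} [AddCommGroup E] [Module 𝕜 E]
    [AddCommGroup F] [Module 𝕜 F] [TopologicalSpace F] (f : E → F) (df : E × E → F)
    (U : Set E) : Prop :=
  ∀ x ∈ U, ∀ h : E,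
    Tendsto (fun t : 𝕜 => t⁻¹ • (f (x + t • h) - f x)) (𝓝[≠] 0) (𝓝 (df (x, h)))

/-- The directional derivative `dirDeriv 𝕜 f (x, h) = df(x)(h)`, a junk value where the difference
quotients diverge. -/
noncomputable def dirDeriv (𝕜 : Type*) [RCLike 𝕜] {E F : Type*} [AddCommGroup E] [Module 𝕜 E]
    [AddCommGroup F] [Module 𝕜 F] [TopologicalSpace F] (f : E → F) (p : E × E) : F :=
  limUnder (𝓝[≠] (0 : 𝕜)) (fun t : 𝕜 => t⁻¹ • (f (p.1 + t • p.2) - f p.1))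

theorem HasDirDerivOn.dirDeriv_eq [T2Space F] {f : E → F} {df : E × E → F} {U : Set E}
    (h : HasDirDerivOn 𝕜 f df U) {p : E × E} (hp : p ∈ U ×ˢ univ) : dirDeriv 𝕜 f p = df p :=
  (h p.1 hp.1 p.2).limUnder_eq

theorem tendsto_add_smul_nhdsNE_zero [TopologicalSpace E] [ContinuousAdd E] [ContinuousSMul 𝕜 E]
    (x h : E) : Tendsto (fun t : 𝕜 => x + t • h) (𝓝[≠] 0) (𝓝 x) := by
  have hcont : Continuous fun t : 𝕜 => x + t • h := by fun_prop
  simpa only [zero_smul, add_zero] using (hcont.tendsto 0).mono_left nhdsWithin_le_nhds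

theorem HasDirDerivOn.congr [TopologicalSpace E] [ContinuousAdd E] [ContinuousSMul 𝕜 E]
    {f g : E → F} {df : E × E → F} {U : Set E} (h : HasDirDerivOn 𝕜 f df U) (hU : IsOpen U)
    (hfg : EqOn g f U) : HasDirDerivOn 𝕜 g df U := by
  intro x hx k
  refine (h x hx k).congr' ?_
  filter_upwards [tendsto_add_smul_nhdsNE_zero x k (hU.mem_nhds hx)] with t ht
  rw [hfg hx, hfg ht]

theorem eventually_forall_segment_mem {E K : Type*} [AddCommGroup E] [Module ℝ E]
    [TopologicalSpace E] [ContinuousAdd E] [ContinuousSMul ℝ E] [TopologicalSpace K]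
    {y : E} {k₀ : K} {W : Set (E × K)} (hW : W ∈ 𝓝 (y, k₀)) :
    ∀ᶠ p : E × K in 𝓝 (0, k₀), ∀ s ∈ Icc (0 : ℝ) 1, (y + s • p.1, p.2) ∈ W := by
  refine isCompact_Icc.eventually_forall_of_forall_eventually fun s _ => ?_
  have hcont : Continuous fun z : (E × K) × ℝ => (y + z.2 • z.1.1, z.1.2) := by fun_prop
  have hlim := hcont.tendsto ((0, k₀), s)
  simp only [smul_zero, add_zero] at hlim
  exact hlim hW

variable [Module ℝ E] [IsScalarTower ℝ 𝕜 E] [Module ℝ F] [IsScalarTower ℝ 𝕜 F]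

theorem HasDirDerivOn.hasDerivAt_segment {g : E → F} {dg : E × E → F} {V : Set E}
    (hg : HasDirDerivOn 𝕜 g dg V) (l : F →L[ℝ] ℝ) {y k : E} {t : 𝕜} (ht : t ≠ 0) {s : ℝ}
    (hs : y + s • t • k ∈ V) :
    HasDerivAt (fun r : ℝ => l (t⁻¹ • g (y + r • t • k))) (l (dg (y + s • t • k, k))) s := by
  rw [hasDerivAt_iff_tendsto_slope_zero]
  have hmul : Tendsto (fun r : ℝ => (r : 𝕜) * t) (𝓝[≠] 0) (𝓝[≠] 0) := by
    have hcont : Continuous fun r : ℝ => (r : 𝕜) * t := by fun_prop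
    refine tendsto_nhdsWithin_of_tendsto_nhds_of_eventually_within _ ?_ ?_
    · simpa only [map_zero, zero_mul] using (hcont.tendsto 0).mono_left nhdsWithin_le_nhds
    · filter_upwards [self_mem_nhdsWithin] with r hr
      exact mul_ne_zero (RCLike.ofReal_ne_zero.2 hr) ht
  refine ((l.continuous.tendsto _).comp ((hg _ hs k).comp hmul)).congr fun r => ?_
  have hsmul : ((r : 𝕜) * t) • k = r • t • k := by
    rw [← smul_assoc, ← RCLike.real_smul_eq_coe_mul]
  have hinv : ((r : 𝕜) * t)⁻¹ = r⁻¹ • t⁻¹ := by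
    rw [mul_inv, ← RCLike.ofReal_inv, RCLike.real_smul_eq_coe_mul]
  simp only [Function.comp_apply]
  rw [← map_sub, ← map_smul, ← smul_sub, hsmul, hinv, smul_assoc, add_smul, add_assoc]

theorem HasDirDerivOn.exists_apply_slope_eq {g : E → F} {dg : E × E → F} {V : Set E}
    (hg : HasDirDerivOn 𝕜 g dg V) (l : F →L[ℝ] ℝ) {y k : E} {t : 𝕜} (ht : t ≠ 0)
    (hV : ∀ s ∈ Icc (0 : ℝ) 1, y + s • t • k ∈ V) :
    ∃ s ∈ Icc (0 : ℝ) 1, l (t⁻¹ • (g (y + t • k) - g y)) = l (dg (y + s • t • k, k)) := by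
  have hder := fun s hs => hg.hasDerivAt_segment l ht (hV s hs)
  obtain ⟨s, hs, h⟩ := exists_hasDerivAt_eq_slope (fun s : ℝ => l (t⁻¹ • g (y + s • t • k)))
    (fun s => l (dg (y + s • t • k, k))) zero_lt_one
    (fun s hs => (hder s hs).continuousAt.continuousWithinAt)
    (fun s hs => hder s (Ioo_subset_Icc_self hs))
  refine ⟨s, Ioo_subset_Icc_self hs, ?_⟩
  rw [h]
  simp [smul_sub]

variable [TopologicalSpace E]

/-- This is where local convexity enters: if a difference quotient left a convex open
neighbourhood of the limit, the Hahn-Banach theorem would give a real functional contradicting the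
mean value theorem. -/
theorem HasDirDerivOn.tendsto_slope [IsTopologicalAddGroup E] [ContinuousSMul 𝕜 E]
    [IsTopologicalAddGroup F] [ContinuousSMul 𝕜 F] [LocallyConvexSpace ℝ F]
    {g : E → F} {dg : E × E → F} {V : Set E} (hg : HasDirDerivOn 𝕜 g dg V) (hV : IsOpen V)
    (hc : ContinuousOn dg (V ×ˢ univ)) {y : E} (hy : y ∈ V)
    {k : 𝕜 → E} {k₀ : E} (hk : Tendsto k (𝓝[≠] 0) (𝓝 k₀)) :
    Tendsto (fun t : 𝕜 => t⁻¹ • (g (y + t • k t) - g y)) (𝓝[≠] 0) (𝓝 (dg (y, k₀))) := by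
  have : ContinuousSMul ℝ E := IsScalarTower.continuousSMul 𝕜
  have : ContinuousSMul ℝ F := IsScalarTower.continuousSMul 𝕜
  refine (LocallyConvexSpace.convex_basis (𝕜 := ℝ) _).tendsto_right_iff.2 ?_
  rintro C ⟨hC, hCconv⟩
  have hdg : {q : E × E | q.1 ∈ V ∧ dg q ∈ interior C} ∈ 𝓝 (y, k₀) := by
    have hnhds : V ×ˢ univ ∈ 𝓝 (y, k₀) := (hV.prod isOpen_univ).mem_nhds ⟨hy, mem_univ _⟩
    filter_upwards [hnhds, hc.continuousAt hnhds (interior_mem_nhds.2 hC)] with q hq hqC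
    exact ⟨hq.1, hqC⟩
  have hsmul : Tendsto (fun t : 𝕜 => (t • k t, k t)) (𝓝[≠] 0) (𝓝 (0, k₀)) := by
    have hid : Tendsto (fun t : 𝕜 => t) (𝓝[≠] 0) (𝓝 0) := nhdsWithin_le_nhds
    simpa only [zero_smul] using (hid.smul hk).prodMk_nhds hk
  filter_upwards [hsmul.eventually (eventually_forall_segment_mem hdg), self_mem_nhdsWithin]
    with t ht ht0
  by_contra hnot
  obtain ⟨l, hl⟩ := geometric_hahn_banach_point_open hCconv.interior isOpen_interior
    (fun h => hnot (interior_subset h))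
  obtain ⟨s, hs, h⟩ := hg.exists_apply_slope_eq l ht0 fun s hs => (ht s hs).1
  exact (hl _ (ht s hs).2).ne h

end DirectionalDerivative

namespace LCContDiffOn

variable {𝕜 : Type*} [RCLike 𝕜] {E E' : Type u} {F H : Type*}
  [AddCommGroup E] [Module 𝕜 E] [TopologicalSpace E]
  [AddCommGroup E'] [Module 𝕜 E'] [TopologicalSpace E']
  [AddCommGroup F] [Module 𝕜 F] [TopologicalSpace F]
  [AddCommGroup H] [Module 𝕜 H] [TopologicalSpace H]
  {n : ℕ}

theorem mono {f : E → F} {U V : Set E} (h : LCContDiffOn 𝕜 n f U) (hV : V ⊆ U) :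
    LCContDiffOn 𝕜 n f V :=
  h.comp_linear n (ContinuousLinearMap.id 𝕜 E) hV

theorem of_succ {f : E → F} {U : Set E} (h : LCContDiffOn 𝕜 (n + 1) f U) :
    LCContDiffOn 𝕜 n f U := by
  induction n generalizing E with
  | zero => exact h.1
  | succ n ih =>
    obtain ⟨hc, df, hdf, hn⟩ := h
    exact ⟨hc, df, hdf, ih hn⟩

theorem continuousLinearMap (l : E →L[𝕜] F) (U : Set E) : LCContDiffOn 𝕜 n l U := by
  induction n generalizing E with
  | zero => exact l.continuous.continuousOn
  | succ n ih =>
    refine ⟨l.continuous.continuousOn, l.comp (ContinuousLinearMap.snd 𝕜 E E),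
      fun x _ k => ?_, ih _ _⟩
    refine (tendsto_const_nhds (x := l k)).congr' ?_
    filter_upwards [self_mem_nhdsWithin] with t ht
    rw [map_add, map_smul, add_sub_cancel_left, inv_smul_smul₀ ht]

theorem congr [IsTopologicalAddGroup E] [ContinuousSMul 𝕜 E] {f g : E → F} {U : Set E}
    (h : LCContDiffOn 𝕜 n f U) (hU : IsOpen U) (hfg : EqOn g f U) : LCContDiffOn 𝕜 n g U := by
  cases n with
  | zero => exact ContinuousOn.congr h hfg
  | succ n =>
    obtain ⟨hc, df, hdf, hn⟩ := h
    exact ⟨hc.congr hfg, df, HasDirDerivOn.congr hdf hU hfg, hn⟩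

theorem hasDirDerivOn [T2Space F] {f : E → F} {U : Set E} (h : LCContDiffOn 𝕜 (n + 1) f U) :
    HasDirDerivOn 𝕜 f (dirDeriv 𝕜 f) U := by
  obtain ⟨-, df, hdf, -⟩ := h
  intro x hx k
  rw [HasDirDerivOn.dirDeriv_eq hdf ⟨hx, mem_univ k⟩]
  exact hdf x hx k

theorem lcContDiffOn_dirDeriv [IsTopologicalAddGroup E] [ContinuousSMul 𝕜 E] [T2Space F]
    {f : E → F} {U : Set E} (h : LCContDiffOn 𝕜 (n + 1) f U) (hU : IsOpen U) :
    LCContDiffOn 𝕜 n (dirDeriv 𝕜 f) (U ×ˢ univ) := by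
  obtain ⟨-, df, hdf, hn⟩ := h
  exact hn.congr (hU.prod isOpen_univ) fun p hp => HasDirDerivOn.dirDeriv_eq hdf hp

theorem continuousOn_of_local {f : E → F} {U : Set E}
    (h : ∀ x ∈ U, ∃ V, IsOpen V ∧ x ∈ V ∧ LCContDiffOn 𝕜 n f V) : ContinuousOn f U :=
  continuousOn_of_locally_continuousOn fun x hx =>
    let ⟨V, hV, hxV, hf⟩ := h x hx
    ⟨V, hV, hxV, hf.continuousOn.mono inter_subset_right⟩

theorem of_local [IsTopologicalAddGroup E] [ContinuousSMul 𝕜 E] [T2Space F] {f : E → F}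
    {U : Set E} (h : ∀ x ∈ U, ∃ V, IsOpen V ∧ x ∈ V ∧ LCContDiffOn 𝕜 n f V) :
    LCContDiffOn 𝕜 n f U := by
  induction n generalizing E with
  | zero => exact continuousOn_of_local h
  | succ n ih =>
    refine ⟨continuousOn_of_local h, dirDeriv 𝕜 f, fun x hx k => ?_, ih ?_⟩
    · obtain ⟨V, -, hxV, hf⟩ := h x hx
      exact hf.hasDirDerivOn x hxV k
    · rintro p ⟨hp, -⟩
      obtain ⟨V, hV, hpV, hf⟩ := h p.1 hp
      exact ⟨V ×ˢ univ, hV.prod isOpen_univ, ⟨hpV, mem_univ _⟩, hf.lcContDiffOn_dirDeriv hV⟩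

theorem comp [Module ℝ E'] [IsScalarTower ℝ 𝕜 E'] [IsTopologicalAddGroup E']
    [ContinuousSMul 𝕜 E'] [Module ℝ H] [IsScalarTower ℝ 𝕜 H] [IsTopologicalAddGroup H]
    [ContinuousSMul 𝕜 H] [LocallyConvexSpace ℝ H] {g : E' → H} {f : E → E'} {U : Set E}
    {V : Set E'} (hV : IsOpen V) (hg : LCContDiffOn 𝕜 n g V) (hf : LCContDiffOn 𝕜 n f U)
    (hfU : MapsTo f U V) : LCContDiffOn 𝕜 n (fun x => g (f x)) U := by
  induction n generalizing E E' with
  | zero => exact ContinuousOn.comp hg hf hfU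
  | succ n ih =>
    have hf' : LCContDiffOn 𝕜 n f U := hf.of_succ
    obtain ⟨hgc, dg, hdg, hgn⟩ := hg
    obtain ⟨hfc, df, hdf, hfn⟩ := hf
    refine ⟨hgc.comp hfc hfU, fun p => dg (f p.1, df p), fun x hx k => ?_, ?_⟩
    · refine (HasDirDerivOn.tendsto_slope hdg hV hgn.continuousOn (hfU hx) (hdf x hx k)).congr' ?_
      filter_upwards [self_mem_nhdsWithin] with t ht
      rw [smul_inv_smul₀ ht, add_sub_cancel]
    · have hpair : LCContDiffOn 𝕜 n (fun p => (f p.1, df p)) (U ×ˢ univ) :=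
        (hf'.comp_linear n (ContinuousLinearMap.fst 𝕜 E E) fun p hp => hp.1).pair n hfn
      exact ih (hV.prod isOpen_univ) hgn hpair fun p hp => ⟨hfU hp.1, mem_univ _⟩

end LCContDiffOn

namespace LCSmoothOn

variable {𝕜 : Type*} [RCLike 𝕜] {E E' : Type u} {F H : Type*}
  [AddCommGroup E] [Module 𝕜 E] [TopologicalSpace E]
  [AddCommGroup E'] [Module 𝕜 E'] [TopologicalSpace E']
  [AddCommGroup F] [Module 𝕜 F] [TopologicalSpace F]
  [AddCommGroup H] [Module 𝕜 H] [TopologicalSpace H]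

theorem mono {f : E → F} {U V : Set E} (h : LCSmoothOn 𝕜 f U) (hV : V ⊆ U) :
    LCSmoothOn 𝕜 f V :=
  fun n => (h n).mono hV

theorem congr [IsTopologicalAddGroup E] [ContinuousSMul 𝕜 E] {f g : E → F} {U : Set E}
    (h : LCSmoothOn 𝕜 f U) (hU : IsOpen U) (hfg : EqOn g f U) : LCSmoothOn 𝕜 g U :=
  fun n => (h n).congr hU hfg

theorem of_local [IsTopologicalAddGroup E] [ContinuousSMul 𝕜 E] [T2Space F] {f : E → F}
    {U : Set E} (h : ∀ x ∈ U, ∃ V, IsOpen V ∧ x ∈ V ∧ LCSmoothOn 𝕜 f V) : LCSmoothOn 𝕜 f U :=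
  fun n => LCContDiffOn.of_local fun x hx => (h x hx).imp fun _ hV => ⟨hV.1, hV.2.1, hV.2.2 n⟩

theorem continuousLinearMap (l : E →L[𝕜] F) (U : Set E) : LCSmoothOn 𝕜 l U :=
  fun _ => LCContDiffOn.continuousLinearMap l U

theorem pair {f : E → F} {g : E → H} {U : Set E} (hf : LCSmoothOn 𝕜 f U)
    (hg : LCSmoothOn 𝕜 g U) : LCSmoothOn 𝕜 (fun x => (f x, g x)) U :=
  fun n => (hf n).pair n (hg n)

theorem comp [Module ℝ E'] [IsScalarTower ℝ 𝕜 E'] [IsTopologicalAddGroup E']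
    [ContinuousSMul 𝕜 E'] [Module ℝ H] [IsScalarTower ℝ 𝕜 H] [IsTopologicalAddGroup H]
    [ContinuousSMul 𝕜 H] [LocallyConvexSpace ℝ H] {g : E' → H} {f : E → E'} {U : Set E}
    {V : Set E'} (hV : IsOpen V) (hg : LCSmoothOn 𝕜 g V) (hf : LCSmoothOn 𝕜 f U)
    (hfU : MapsTo f U V) : LCSmoothOn 𝕜 (fun x => g (f x)) U :=
  fun n => LCContDiffOn.comp hV (hg n) (hf n) hfU

end LCSmoothOn

/-! ### Smoothness near a point -/

namespace SmoothMfd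

variable {𝕜 : Type*} [RCLike 𝕜] {M M₁ M₂ M₃ : Type u}
  {A : SmoothMfd 𝕜 M} {B : SmoothMfd 𝕜 M₁} {C : SmoothMfd 𝕜 M₂} {D : SmoothMfd 𝕜 M₃}

/-- The filter of neighbourhoods of `x` in the manifold `A`. -/
def nhd (A : SmoothMfd 𝕜 M) (x : M) : Filter M := @nhds M A.top x

theorem IsOpenIn.mem_nhd {U : Set M} (hU : A.IsOpenIn U) {x : M} (hx : x ∈ U) : U ∈ A.nhd x :=
  let := A.top; IsOpen.mem_nhds hU hx

theorem mem_nhd_iff {s : Set M} {x : M} : s ∈ A.nhd x ↔ ∃ U ⊆ s, A.IsOpenIn U ∧ x ∈ U :=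
  let := A.top; mem_nhds_iff

theorem IsOpenIn.inter {U V : Set M} (hU : A.IsOpenIn U) (hV : A.IsOpenIn V) :
    A.IsOpenIn (U ∩ V) :=
  let := A.top; IsOpen.inter hU hV

theorem isOpenIn_univ : A.IsOpenIn (univ : Set M) := @isOpen_univ M A.top

theorem mem_of_mem_nhd {s : Set M} {x : M} (h : s ∈ A.nhd x) : x ∈ s :=
  let := A.top; mem_of_mem_nhds h

theorem isOpenIn_iff_mem_nhd {U : Set M} : A.IsOpenIn U ↔ ∀ x ∈ U, U ∈ A.nhd x :=
  let := A.top; isOpen_iff_mem_nhds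

theorem nhd_prod (A : SmoothMfd 𝕜 M) (B : SmoothMfd 𝕜 M₁) (p : M × M₁) :
    (A.prod B).nhd p = A.nhd p.1 ×ˢ B.nhd p.2 :=
  @nhds_prod_eq M M₁ A.top B.top p.1 p.2

section Chart

variable {f : M → M₁} {W : Set M}
  {e : @OpenPartialHomeomorph M A.E A.top _} {e' : @OpenPartialHomeomorph M₁ B.E B.top _}

theorem continuousOn_of_chart (hWe : W ⊆ e.source) (hWf : MapsTo f W e'.source)
    (hf : ContinuousOn (fun v => e' (f (e.invFun v))) (e.target ∩ e.invFun ⁻¹' W)) :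
    @ContinuousOn M M₁ A.top B.top f W := by
  let := A.top
  let := B.top
  rw [e'.continuousOn_iff_continuousOn_comp_left hWf,
    e.symm.continuousOn_iff_continuousOn_comp_right hWe]
  exact hf

theorem lcSmoothOn_of_chart (hW : A.IsOpenIn W) (he : e ∈ A.atlas) (he' : e' ∈ B.atlas)
    (hWe : W ⊆ e.source) (hWf : MapsTo f W e'.source)
    (hf : LCSmoothOn 𝕜 (fun v => e' (f (e.invFun v))) (e.target ∩ e.invFun ⁻¹' W))
    {a : @OpenPartialHomeomorph M A.E A.top _} (ha : a ∈ A.atlas)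
    {b : @OpenPartialHomeomorph M₁ B.E B.top _} (hb : b ∈ B.atlas) :
    LCSmoothOn 𝕜 (fun v => b (f (a.invFun v))) (a.target ∩ a.invFun ⁻¹' (W ∩ f ⁻¹' b.source)) := by
  let := A.top
  let := B.top
  set O := a.target ∩ a.invFun ⁻¹' (W ∩ f ⁻¹' b.source)
  have hcont : ContinuousOn f W := continuousOn_of_chart hWe hWf (hf 0).continuousOn
  have hO : IsOpen O :=
    a.symm.isOpen_inter_preimage (hcont.isOpen_inter_preimage hW b.open_source)
  have hleft : ∀ v ∈ O, e.invFun (e (a.invFun v)) = a.invFun v := fun v hv =>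
    e.left_inv (hWe hv.2.1)
  have hleft' : ∀ v ∈ O, e'.invFun (e' (f (a.invFun v))) = f (a.invFun v) := fun v hv =>
    e'.left_inv (hWf hv.2.1)
  have hfa : LCSmoothOn 𝕜 (fun v => e' (f (e.invFun (e (a.invFun v))))) O :=
    LCSmoothOn.comp (g := fun v => e' (f (e.invFun v))) (e.symm.isOpen_inter_preimage hW) hf
      ((A.compat a ha e he).mono fun v hv => ⟨hv.1, hWe hv.2.1⟩) fun v hv =>
        ⟨e.map_source (hWe hv.2.1), mem_preimage.2 (mem_of_eq_of_mem (hleft v hv) hv.2.1)⟩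
  have hfa' : LCSmoothOn 𝕜 (fun v => e' (f (a.invFun v))) O :=
    hfa.congr hO fun v hv => by simp only [hleft v hv]
  have hba : LCSmoothOn 𝕜 (fun v => b (e'.invFun (e' (f (a.invFun v))))) O :=
    LCSmoothOn.comp (g := fun v => b (e'.invFun v))
      (e'.symm.isOpen_inter_preimage b.open_source) (B.compat e' he' b hb) hfa' fun v hv =>
        ⟨e'.map_source (hWf hv.2.1), mem_preimage.2 (mem_of_eq_of_mem (hleft' v hv) hv.2.2)⟩
  exact hba.congr hO fun v hv => by simp only [hleft' v hv]

theorem smoothOn_of_chart (hW : A.IsOpenIn W) (he : e ∈ A.atlas) (he' : e' ∈ B.atlas)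
    (hWe : W ⊆ e.source) (hWf : MapsTo f W e'.source)
    (hf : LCSmoothOn 𝕜 (fun v => e' (f (e.invFun v))) (e.target ∩ e.invFun ⁻¹' W)) :
    A.SmoothOn B f W :=
  ⟨continuousOn_of_chart hWe hWf (hf 0).continuousOn,
    fun _ ha _ hb => lcSmoothOn_of_chart hW he he' hWe hWf hf ha hb⟩

theorem SmoothNear.exists_chart {x : M} (h : A.SmoothNear B f x) (he : e ∈ A.atlas)
    (hx : x ∈ e.source) (he' : e' ∈ B.atlas) (hfx : f x ∈ e'.source) :
    ∃ W, A.IsOpenIn W ∧ x ∈ W ∧ W ⊆ e.source ∧ MapsTo f W e'.source ∧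
      @ContinuousOn M M₁ A.top B.top f W ∧
      LCSmoothOn 𝕜 (fun v => e' (f (e.invFun v))) (e.target ∩ e.invFun ⁻¹' W) := by
  let := A.top
  let := B.top
  obtain ⟨U, hU, hxU, hc, hs⟩ := h
  have hW : IsOpen (e.source ∩ (U ∩ f ⁻¹' e'.source)) :=
    e.open_source.inter (hc.isOpen_inter_preimage hU e'.open_source)
  exact ⟨_, hW, ⟨hx, hxU, hfx⟩, fun _ h => h.1, fun _ h => h.2.2, hc.mono fun _ h => h.2.1,
    (hs e he e' he').mono fun v hv => ⟨hv.1, hv.2.2⟩⟩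

theorem smoothNear_of_chart_linear {x : M} (hW : A.IsOpenIn W) (hx : x ∈ W) (he : e ∈ A.atlas)
    (he' : e' ∈ B.atlas) (hWe : W ⊆ e.source) (hWf : MapsTo f W e'.source) (l : A.E →L[𝕜] B.E)
    (hl : ∀ v ∈ e.target, e.invFun v ∈ W → e' (f (e.invFun v)) = l v) : A.SmoothNear B f x := by
  let := A.top
  exact ⟨W, hW, hx, smoothOn_of_chart hW he he' hWe hWf
    ((LCSmoothOn.continuousLinearMap l _).congr (e.symm.isOpen_inter_preimage hW)
      fun v hv => hl v hv.1 hv.2)⟩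

end Chart

theorem SmoothOn.smoothNear {f : M → M₁} {U : Set M} (h : A.SmoothOn B f U) (hU : A.IsOpenIn U)
    {x : M} (hx : x ∈ U) : A.SmoothNear B f x :=
  ⟨U, hU, hx, h⟩

theorem SmoothNear.tendsto {f : M → M₁} {x : M} (h : A.SmoothNear B f x) :
    Tendsto f (A.nhd x) (B.nhd (f x)) := by
  let := A.top
  let := B.top
  obtain ⟨U, hU, hxU, hc, -⟩ := h
  exact hc.continuousAt (IsOpen.mem_nhds hU hxU)

theorem smoothOn_iff {f : M → M₁} {U : Set M} (hU : A.IsOpenIn U) :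
    A.SmoothOn B f U ↔ ∀ x ∈ U, A.SmoothNear B f x := by
  let := A.top
  let := B.top
  refine ⟨fun h x hx => h.smoothNear hU hx, fun h => ⟨fun x hx => ?_, fun e he e' he' => ?_⟩⟩
  · exact ContinuousAt.continuousWithinAt (h x hx).tendsto
  · refine LCSmoothOn.of_local fun v hv => ?_
    obtain ⟨V, hV, hxV, hc, hs⟩ := h (e.invFun v) hv.2.1
    exact ⟨_, e.symm.isOpen_inter_preimage (hc.isOpen_inter_preimage hV e'.open_source),
      ⟨hv.1, hxV, hv.2.2⟩, hs e he e' he'⟩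

theorem smooth_iff {f : M → M₁} : A.Smooth B f ↔ ∀ x, A.SmoothNear B f x :=
  (smoothOn_iff isOpenIn_univ).trans ⟨fun h x => h x (mem_univ _), fun h x _ => h x⟩

theorem Smooth.smoothNear {f : M → M₁} (h : A.Smooth B f) (x : M) : A.SmoothNear B f x :=
  smooth_iff.1 h x

theorem Smooth.isOpenIn_preimage {f : M → M₁} (h : A.Smooth B f) {U : Set M₁}
    (hU : B.IsOpenIn U) : A.IsOpenIn (f ⁻¹' U) :=
  isOpenIn_iff_mem_nhd.2 fun x hx => (h.smoothNear x).tendsto (hU.mem_nhd hx)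

theorem SmoothNear.eventually {f : M → M₁} {x : M} (hf : A.SmoothNear B f x) :
    ∀ᶠ y in A.nhd x, A.SmoothNear B f y := by
  obtain ⟨U, hU, hx, h⟩ := hf
  exact mem_of_superset (hU.mem_nhd hx) fun y hy => h.smoothNear hU hy

theorem SmoothNear.comp {g : M₁ → M₂} {f : M → M₁} {x : M} (hg : B.SmoothNear C g (f x))
    (hf : A.SmoothNear B f x) : A.SmoothNear C (fun y => g (f y)) x := by
  let := A.top
  let := B.top
  let := C.top
  obtain ⟨e, he, hxe⟩ := A.cover x
  obtain ⟨e', he', hxe'⟩ := B.cover (f x)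
  obtain ⟨e'', he'', hxe''⟩ := C.cover (g (f x))
  obtain ⟨W, hW, hxW, hWe, hWf, hc, hs⟩ := hf.exists_chart he hxe he' hxe'
  obtain ⟨W', hW', hxW', -, hWg, -, hs'⟩ := hg.exists_chart he' hxe' he'' hxe''
  have hO : A.IsOpenIn (W ∩ f ⁻¹' W') := ContinuousOn.isOpen_inter_preimage hc hW hW'
  have hleft : ∀ v ∈ e.target ∩ e.invFun ⁻¹' (W ∩ f ⁻¹' W'),
      e'.invFun (e' (f (e.invFun v))) = f (e.invFun v) := fun v hv => e'.left_inv (hWf hv.2.1)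
  refine ⟨_, hO, ⟨hxW, hxW'⟩,
    smoothOn_of_chart hO he he'' (fun _ h => hWe h.1) (fun _ h => hWg h.2) ?_⟩
  have hgf := LCSmoothOn.comp (e'.symm.isOpen_inter_preimage hW') hs'
    (hs.mono (V := e.target ∩ e.invFun ⁻¹' (W ∩ f ⁻¹' W')) fun v hv => ⟨hv.1, hv.2.1⟩)
    fun v hv => ⟨e'.map_source (hWf hv.2.1),
      mem_preimage.2 (mem_of_eq_of_mem (hleft v hv) hv.2.2)⟩
  exact hgf.congr (e.symm.isOpen_inter_preimage hO) fun v hv => by simp only [hleft v hv]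

theorem SmoothNear.comp_of_eq {g : M₁ → M₂} {f : M → M₁} {x : M} {y : M₁}
    (hg : B.SmoothNear C g y) (hf : A.SmoothNear B f x) (hy : f x = y) :
    A.SmoothNear C (fun y => g (f y)) x := by
  subst hy; exact hg.comp hf

theorem SmoothNear.congr {f g : M → M₁} {x : M} (hf : A.SmoothNear B f x)
    (h : ∀ᶠ y in A.nhd x, g y = f y) : A.SmoothNear B g x := by
  let := A.top
  obtain ⟨e, he, hxe⟩ := A.cover x
  obtain ⟨e', he', hxe'⟩ := B.cover (f x)
  obtain ⟨W, hW, hxW, hWe, hWf, -, hs⟩ := hf.exists_chart he hxe he' hxe'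
  obtain ⟨V, hVs, hV, hxV⟩ := mem_nhd_iff.1 h
  have hWV : A.IsOpenIn (W ∩ V) := hW.inter hV
  have hgf : EqOn g f (W ∩ V) := fun y hy => hVs hy.2
  refine ⟨W ∩ V, hWV, ⟨hxW, hxV⟩, smoothOn_of_chart hWV he he' (fun _ h => hWe h.1)
    ((hWf.mono_left inter_subset_left).congr hgf.symm) ?_⟩
  exact (hs.mono fun v hv => ⟨hv.1, hv.2.1⟩).congr (e.symm.isOpen_inter_preimage hWV)
    fun v hv => congrArg e' (hgf hv.2)

theorem smoothNear_id (A : SmoothMfd 𝕜 M) (x : M) : A.SmoothNear A (fun y => y) x := by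
  let := A.top
  obtain ⟨e, he, hxe⟩ := A.cover x
  exact smoothNear_of_chart_linear e.open_source hxe he he subset_rfl (mapsTo_id _)
    (ContinuousLinearMap.id 𝕜 A.E) fun v hv _ => e.right_inv hv

theorem smoothNear_fst (A : SmoothMfd 𝕜 M) (B : SmoothMfd 𝕜 M₁) (p : M × M₁) :
    (A.prod B).SmoothNear A Prod.fst p := by
  let := A.top
  let := B.top
  obtain ⟨e, he, hxe⟩ := A.cover p.1
  obtain ⟨e', he', hxe'⟩ := B.cover p.2
  exact smoothNear_of_chart_linear (A := A.prod B) (e.prod e').open_source ⟨hxe, hxe'⟩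
    ⟨e, he, e', he', rfl⟩ he subset_rfl (fun _ h => h.1) (ContinuousLinearMap.fst 𝕜 A.E B.E)
    fun v hv _ => e.right_inv hv.1

theorem smoothNear_snd (A : SmoothMfd 𝕜 M) (B : SmoothMfd 𝕜 M₁) (p : M × M₁) :
    (A.prod B).SmoothNear B Prod.snd p := by
  let := A.top
  let := B.top
  obtain ⟨e, he, hxe⟩ := A.cover p.1
  obtain ⟨e', he', hxe'⟩ := B.cover p.2
  exact smoothNear_of_chart_linear (A := A.prod B) (e.prod e').open_source ⟨hxe, hxe'⟩
    ⟨e, he, e', he', rfl⟩ he' subset_rfl (fun _ h => h.2) (ContinuousLinearMap.snd 𝕜 A.E B.E)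
    fun v hv _ => e'.right_inv hv.2

theorem SmoothNear.prodMk {f : M → M₁} {g : M → M₂} {x : M} (hf : A.SmoothNear B f x)
    (hg : A.SmoothNear C g x) : A.SmoothNear (B.prod C) (fun y => (f y, g y)) x := by
  obtain ⟨e, he, hxe⟩ := A.cover x
  obtain ⟨e', he', hxe'⟩ := B.cover (f x)
  obtain ⟨e'', he'', hxe''⟩ := C.cover (g x)
  obtain ⟨W, hW, hxW, hWe, hWf, -, hs⟩ := hf.exists_chart he hxe he' hxe'
  obtain ⟨W', hW', hxW', -, hWg, -, hs'⟩ := hg.exists_chart he hxe he'' hxe''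
  exact ⟨W ∩ W', hW.inter hW', ⟨hxW, hxW'⟩, smoothOn_of_chart (B := B.prod C)
    (hW.inter hW') he ⟨e', he', e'', he'', rfl⟩ (fun _ h => hWe h.1)
    (fun y h => ⟨hWf h.1, hWg h.2⟩) ((hs.mono fun v hv => ⟨hv.1, hv.2.1⟩).pair
      (hs'.mono fun v hv => ⟨hv.1, hv.2.2⟩))⟩

theorem SmoothNear.fst {f : M → M₁ × M₂} {x : M} (h : A.SmoothNear (B.prod C) f x) :
    A.SmoothNear B (fun y => (f y).1) x :=
  (smoothNear_fst B C (f x)).comp h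

theorem SmoothNear.snd {f : M → M₁ × M₂} {x : M} (h : A.SmoothNear (B.prod C) f x) :
    A.SmoothNear C (fun y => (f y).2) x :=
  (smoothNear_snd B C (f x)).comp h

theorem SmoothNear.comp₂ {m : M₁ → M₂ → M₃} {f : M → M₁} {g : M → M₂} {x : M} {a : M₁} {b : M₂}
    (hm : (B.prod C).SmoothNear D (fun p => m p.1 p.2) (a, b))
    (hf : A.SmoothNear B f x) (hg : A.SmoothNear C g x) (ha : f x = a) (hb : g x = b) :
    A.SmoothNear D (fun y => m (f y) (g y)) x :=
  SmoothNear.comp_of_eq (g := fun p : M₁ × M₂ => m p.1 p.2) hm (hf.prodMk hg)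
    (Prod.ext ha hb)

section Transport

/-- The manifold structure on `M` for which the bijection `φ : M ≃ M₁` is a diffeomorphism. -/
def transport (B : SmoothMfd 𝕜 M₁) (φ : M ≃ M₁) : SmoothMfd 𝕜 M :=
  letI := B.top
  letI : TopologicalSpace M := TopologicalSpace.induced φ B.top
  let h : M ≃ₜ M₁ := φ.toHomeomorphOfIsInducing ⟨rfl⟩
  { E := B.E
    top := inferInstance
    t2 := haveI := B.t2; h.symm.t2Space
    atlas := {e | ∃ b ∈ B.atlas, e = h.transOpenPartialHomeomorph b}
    cover := by
      intro x
      obtain ⟨b, hb, hx⟩ := B.cover (φ x)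
      exact ⟨_, ⟨b, hb, rfl⟩, hx⟩
    compat := by
      rintro _ ⟨b, hb, rfl⟩ _ ⟨b', hb', rfl⟩
      have hφ : ∀ v, φ (φ.symm (b.symm v)) = b.symm v := fun v => φ.apply_symm_apply _
      refine ((B.compat b hb b' hb').mono fun v hv => ⟨hv.1, ?_⟩).congr
        ((h.transOpenPartialHomeomorph b).symm.isOpen_inter_preimage
          (h.transOpenPartialHomeomorph b').open_source) fun v _ => congrArg b' (hφ v)
      exact (congrArg (· ∈ b'.source) (hφ v)).mp hv.2 }

variable (B) (φ : M ≃ M₁)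

theorem transport_smoothNear (x : M) : (B.transport φ).SmoothNear B φ x := by
  let := B.top
  obtain ⟨b, hb, hx⟩ := B.cover (φ x)
  have hopen : (B.transport φ).IsOpenIn (φ ⁻¹' b.source) := ⟨b.source, b.open_source, rfl⟩
  exact smoothNear_of_chart_linear hopen hx ⟨b, hb, rfl⟩ hb subset_rfl (mapsTo_preimage φ _)
    (ContinuousLinearMap.id 𝕜 B.E)
    fun v hv _ => (congrArg b (φ.apply_symm_apply (b.symm v))).trans (b.right_inv hv)

theorem transport_symm_smoothNear (y : M₁) : B.SmoothNear (B.transport φ) φ.symm y := by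
  let := B.top
  obtain ⟨b, hb, hy⟩ := B.cover y
  exact smoothNear_of_chart_linear (B := B.transport φ) b.open_source hy hb ⟨b, hb, rfl⟩
    subset_rfl (fun z hz => mem_preimage.2 (mem_of_eq_of_mem (φ.apply_symm_apply z) hz))
    (ContinuousLinearMap.id 𝕜 B.E)
    fun v hv _ => (congrArg b (φ.apply_symm_apply (b.symm v))).trans (b.right_inv hv)

end Transport

end SmoothMfd

/-! ### Lie groups from local data -/

section LocalLieGroup

variable {𝕜 : Type*} [RCLike 𝕜] {K M : Type u} [Group K]

open SmoothMfd

namespace LieGroupStr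

variable {A : SmoothMfd 𝕜 M}

theorem smoothNear_mul (L : LieGroupStr 𝕜 K) {f g : M → K} {x : M}
    (hf : A.SmoothNear L.toSmoothMfd f x) (hg : A.SmoothNear L.toSmoothMfd g x) :
    A.SmoothNear L.toSmoothMfd (fun y => f y * g y) x :=
  (L.smooth_mul.smoothNear (f x, g x)).comp₂ (m := fun a b => a * b) hf hg rfl rfl

theorem smoothNear_inv (L : LieGroupStr 𝕜 K) {f : M → K} {x : M}
    (hf : A.SmoothNear L.toSmoothMfd f x) :
    A.SmoothNear L.toSmoothMfd (fun y => (f y)⁻¹) x :=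
  (L.smooth_inv.smoothNear (f x)).comp hf

end LieGroupStr

/-- A group with a manifold structure that makes it a Lie group near the identity: the group
operations and the conjugations are smooth in an identity neighbourhood. The structure away from
the identity is irrelevant, and is replaced by its left translates in
`IsLocalLieGroup.lieGroupStr`. -/
structure IsLocalLieGroup (A : SmoothMfd 𝕜 K) : Prop where
  mul : (A.prod A).SmoothNear A (fun p : K × K => p.1 * p.2) (1, 1)
  inv : A.SmoothNear A (fun g : K => g⁻¹) 1
  conj : ∀ g : K, A.SmoothNear A (fun x => g * x * g⁻¹) 1

namespace IsLocalLieGroup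

variable {A : SmoothMfd 𝕜 K} (h : IsLocalLieGroup A)

/-- The filter basis of identity neighbourhoods of the group topology. -/
abbrev filterBasis : GroupFilterBasis K where
  sets := (A.nhd 1).sets
  nonempty := ⟨univ, univ_mem⟩
  inter_sets := fun {x y} hx hy => ⟨x ∩ y, inter_mem hx hy, subset_rfl⟩
  one' := fun hU => mem_of_mem_nhd hU
  mul' := by
    intro U hU
    have hmul : Tendsto (fun p : K × K => p.1 * p.2) (A.nhd 1 ×ˢ A.nhd 1) (A.nhd 1) := by
      simpa only [nhd_prod, mul_one] using h.mul.tendsto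
    obtain ⟨V, hV, hVU⟩ := mem_prod_same_iff.1 (hmul hU)
    refine ⟨V, hV, ?_⟩
    rintro _ ⟨a, ha, b, hb, rfl⟩
    exact hVU (mk_mem_prod ha hb)
  inv' := fun {U} hU => ⟨_, h.inv.tendsto (by simpa using hU), subset_rfl⟩
  conj' := fun g {U} hU => ⟨_, (h.conj g).tendsto (by simpa using hU), subset_rfl⟩

/-- The group topology whose identity neighbourhoods are those of the manifold. -/
abbrev topology : TopologicalSpace K := h.filterBasis.topology

theorem isTopologicalGroup : @IsTopologicalGroup K h.topology _ :=
  h.filterBasis.isTopologicalGroup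

theorem nhds_one : @nhds K h.topology 1 = A.nhd 1 := by
  refine h.filterBasis.nhds_one_eq.trans (Filter.ext fun s => ?_)
  rw [FilterBasis.mem_filter_iff]
  exact ⟨fun ⟨t, ht, hts⟩ => mem_of_superset ht hts, fun hs => ⟨s, hs, subset_rfl⟩⟩

theorem t2Space : @T2Space K h.topology := by
  let := h.topology
  have := h.isTopologicalGroup
  refine IsTopologicalGroup.t2Space_of_one_sep fun x hx => ?_
  rw [h.nhds_one]
  let := A.top
  have := A.t2
  exact ⟨{x}ᶜ, isOpen_compl_singleton.mem_nhds hx.symm, fun h => h rfl⟩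

/-- An open identity neighbourhood in the manifold consisting of points `w` for which the left
translation by `w` is a local diffeomorphism at the identity. -/
def core (A : SmoothMfd 𝕜 K) : Set K :=
  @interior K A.top {w | A.SmoothNear A (fun x => w * x) 1 ∧ A.SmoothNear A (fun x => w⁻¹ * x) w}

theorem isOpenIn_core : A.IsOpenIn (core A) := @isOpen_interior K A.top _

theorem smoothNear_mul_left_of_mem_core {w : K} (hw : w ∈ core A) :
    A.SmoothNear A (fun x => w * x) 1 :=
  (@interior_subset K A.top _ w hw).1

theorem smoothNear_inv_mul_left_of_mem_core {w : K} (hw : w ∈ core A) :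
    A.SmoothNear A (fun x => w⁻¹ * x) w :=
  (@interior_subset K A.top _ w hw).2

include h in
theorem one_mem_core : (1 : K) ∈ core A := by
  have hmul : ∀ᶠ w in A.nhd 1, A.SmoothNear A (fun x => w * x) 1 := by
    have ht : Tendsto (fun w : K => (w, (1 : K))) (A.nhd 1) ((A.prod A).nhd (1, 1)) :=
      ((smoothNear_id A 1).prodMk (smoothNear_const A A (1 : K) 1)).tendsto
    filter_upwards [ht.eventually h.mul.eventually] with w hw
    exact hw.comp₂ (m := fun a b : K => a * b) (smoothNear_const A A w 1) (smoothNear_id A 1)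
      rfl rfl
  have hinv_mul : ∀ᶠ w in A.nhd 1, A.SmoothNear A (fun x => w⁻¹ * x) w := by
    have ht : Tendsto (fun w : K => (w⁻¹, w)) (A.nhd 1) ((A.prod A).nhd (1, 1)) := by
      simpa only [inv_one] using (h.inv.prodMk (smoothNear_id A 1)).tendsto
    filter_upwards [ht.eventually h.mul.eventually] with w hw
    exact hw.comp₂ (m := fun a b : K => a * b) (smoothNear_const A A w⁻¹ w) (smoothNear_id A w)
      rfl rfl
  exact (@mem_interior_iff_mem_nhds K A.top _ _).2 (hmul.and hinv_mul)

theorem nhds_eq_of_mem_core {w : K} (hw : w ∈ core A) : @nhds K h.topology w = A.nhd w := by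
  let := h.topology
  have := h.isTopologicalGroup
  rw [← map_mul_left_nhds_one w, h.nhds_one]
  refine le_antisymm ?_ ?_
  · have htendsto := (smoothNear_mul_left_of_mem_core hw).tendsto
    rw [mul_one] at htendsto
    exact htendsto
  · have htendsto := (smoothNear_inv_mul_left_of_mem_core hw).tendsto
    rw [inv_mul_cancel] at htendsto
    calc A.nhd w = map (fun x => w * x) (map (fun x => w⁻¹ * x) (A.nhd w)) := by
          simp only [map_map, Function.comp_def, mul_inv_cancel_left, map_id']
      _ ≤ map (fun x => w * x) (A.nhd 1) := map_mono htendsto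

theorem smoothNear_mul_left_of_mem_core_of_mem_core {c w : K} (hw : w ∈ core A)
    (hcw : c * w ∈ core A) : A.SmoothNear A (fun x => c * x) w := by
  have hcomp := (smoothNear_mul_left_of_mem_core hcw).comp_of_eq
    (smoothNear_inv_mul_left_of_mem_core hw) (inv_mul_cancel w)
  simpa only [mul_assoc, mul_inv_cancel_left] using hcomp

/-- The part over `core A` of a chart of `A`, as a chart for the group topology. -/
def restrChart (e : @OpenPartialHomeomorph K A.E A.top _) :
    @OpenPartialHomeomorph K A.E h.topology _ :=
  letI := h.topology
  { toFun := e.toFun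
    invFun := e.invFun
    source := e.source ∩ core A
    target := e.target ∩ e.invFun ⁻¹' core A
    map_source' := fun x hx =>
      ⟨e.map_source' hx.1, mem_preimage.2 (mem_of_eq_of_mem (e.left_inv' hx.1) hx.2)⟩
    map_target' := fun v hv => ⟨e.map_target' hv.1, hv.2⟩
    left_inv' := fun x hx => e.left_inv' hx.1
    right_inv' := fun v hv => e.right_inv' hv.1
    open_source := by
      refine isOpen_iff_mem_nhds.2 fun x hx => ?_
      rw [h.nhds_eq_of_mem_core hx.2]
      let := A.top
      exact (e.open_source.inter isOpenIn_core).mem_nhds hx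
    open_target := by
      let := A.top
      exact e.symm.isOpen_inter_preimage isOpenIn_core
    continuousOn_toFun := by
      refine fun x hx => ContinuousAt.continuousWithinAt ?_
      rw [ContinuousAt, h.nhds_eq_of_mem_core hx.2]
      let := A.top
      exact e.continuousAt hx.1
    continuousOn_invFun := by
      refine fun v hv => ContinuousAt.continuousWithinAt ?_
      rw [ContinuousAt, h.nhds_eq_of_mem_core hv.2]
      let := A.top
      exact e.symm.continuousAt hv.1 }

/-- The translate to `g` of a chart of `A` at the identity. -/
def translChart (g : K) (e : @OpenPartialHomeomorph K A.E A.top _) :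
    @OpenPartialHomeomorph K A.E h.topology _ :=
  letI := h.topology
  haveI := h.isTopologicalGroup
  (Homeomorph.mulLeft g⁻¹).transOpenPartialHomeomorph (h.restrChart e)

theorem translChart_invFun (g : K) (e : @OpenPartialHomeomorph K A.E A.top _) (v : A.E) :
    (h.translChart g e).invFun v = g * e.invFun v :=
  congrArg (· * e.invFun v) (inv_inv g)

/-- The manifold structure on `K` whose charts are the left translates of the charts of `A` at
the identity. -/
def mfd : SmoothMfd 𝕜 K where
  E := A.E
  top := h.topology
  t2 := h.t2Space
  atlas := {c | ∃ g, ∃ e ∈ A.atlas, c = h.translChart g e}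
  cover := by
    intro x
    obtain ⟨e, he, hxe⟩ := A.cover 1
    refine ⟨_, ⟨x, e, he, rfl⟩, ?_⟩
    change x⁻¹ * x ∈ e.source ∩ core A
    rw [inv_mul_cancel]
    exact ⟨hxe, h.one_mem_core⟩
  compat := by
    rintro _ ⟨g, e, he, rfl⟩ _ ⟨g', e', he', rfl⟩
    refine LCSmoothOn.of_local fun v hv => ?_
    have htransl : ∀ v, g'⁻¹ * (h.translChart g e).invFun v = g'⁻¹ * g * e.invFun v := fun v => by
      rw [translChart_invFun, mul_assoc]
    have hsource : g'⁻¹ * (h.translChart g e).invFun v ∈ e'.source ∩ core A := hv.2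
    rw [htransl] at hsource
    obtain ⟨U, hU, hvU, hc, hs⟩ :=
      smoothNear_mul_left_of_mem_core_of_mem_core hv.1.2 hsource.2
    let := A.top
    have hO := e.symm.isOpen_inter_preimage (hc.isOpen_inter_preimage hU e'.open_source)
    exact ⟨_, hO, ⟨hv.1.1, hvU, hsource.1⟩,
      (hs e he e' he').congr hO fun v _ => congrArg e' (htransl v)⟩

theorem smoothNear_translate (g : K) : A.SmoothNear h.mfd (fun x => g * x) 1 := by
  let := A.top
  obtain ⟨e, he, hxe⟩ := A.cover 1
  refine smoothNear_of_chart_linear (B := h.mfd) (e.open_source.inter isOpenIn_core)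
    ⟨hxe, h.one_mem_core⟩ he ⟨g, e, he, rfl⟩ inter_subset_left ?_
    (ContinuousLinearMap.id 𝕜 A.E) fun v hv _ => ?_
  · exact fun x hx => mem_preimage.2 (mem_of_eq_of_mem (inv_mul_cancel_left g x) hx)
  · exact (congrArg e (inv_mul_cancel_left g (e.symm v))).trans (e.right_inv hv)

theorem smoothNear_translate_inv (g : K) : h.mfd.SmoothNear A (fun x => g⁻¹ * x) g := by
  let := h.topology
  obtain ⟨e, he, hxe⟩ := A.cover 1
  refine smoothNear_of_chart_linear (A := h.mfd) (h.translChart g e).open_source ?_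
    ⟨g, e, he, rfl⟩ he subset_rfl (fun x hx => hx.1) (ContinuousLinearMap.id 𝕜 A.E)
    fun v hv _ => (h.translChart g e).right_inv hv
  change g⁻¹ * g ∈ e.source ∩ core A
  rw [inv_mul_cancel]
  exact ⟨hxe, h.one_mem_core⟩

theorem smooth_mul : (h.mfd.prod h.mfd).Smooth h.mfd (fun p : K × K => p.1 * p.2) := by
  refine smooth_iff.2 fun ⟨a, b⟩ => ?_
  have hfst := (h.smoothNear_translate_inv a).comp (smoothNear_fst h.mfd h.mfd (a, b))
  have hsnd := (h.smoothNear_translate_inv b).comp (smoothNear_snd h.mfd h.mfd (a, b))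
  have hconj := (h.conj b⁻¹).comp_of_eq hfst (inv_mul_cancel a)
  have hmul := h.mul.comp₂ (m := fun a b : K => a * b) hconj hsnd (by simp) (by simp)
  -- `x y = (a b) (b⁻¹ (a⁻¹ x) b) (b⁻¹ y)`
  refine ((h.smoothNear_translate (a * b)).comp_of_eq hmul (by simp)).congr ?_
  exact Eventually.of_forall fun p => by simp [mul_assoc]

theorem smooth_inv : h.mfd.Smooth h.mfd (fun g : K => g⁻¹) := by
  refine smooth_iff.2 fun a => ?_
  have hinv := h.inv.comp_of_eq (h.smoothNear_translate_inv a) (inv_mul_cancel a)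
  have hconj := (h.conj a).comp_of_eq hinv (by simp)
  -- `x⁻¹ = a⁻¹ (a (a⁻¹ x)⁻¹ a⁻¹)`
  refine ((h.smoothNear_translate a⁻¹).comp_of_eq hconj (by simp)).congr ?_
  exact Eventually.of_forall fun p => by simp [mul_assoc]

/-- The Lie group structure that has the same germ at the identity as the manifold `A`. -/
def lieGroupStr : LieGroupStr 𝕜 K :=
  { h.mfd with
    smooth_mul := h.smooth_mul
    smooth_inv := h.smooth_inv }

theorem smoothNear_lieGroupStr : A.SmoothNear h.lieGroupStr.toSmoothMfd (fun x => x) 1 := by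
  have htranslate := h.smoothNear_translate 1
  simp only [one_mul] at htranslate
  exact htranslate

theorem lieGroupStr_smoothNear : h.lieGroupStr.SmoothNear A (fun x => x) 1 := by
  have htranslate := h.smoothNear_translate_inv 1
  simp only [inv_one, one_mul] at htranslate
  exact htranslate

end IsLocalLieGroup

end LocalLieGroup

/-! ### Extensions by cocycles -/

section TwistedProduct

open SmoothMfd

variable {𝕜 : Type*} [RCLike 𝕜] {M M₁ M₂ : Type u} {A : SmoothMfd 𝕜 M}

theorem SmoothMfd.SmoothNear.transport {B : SmoothMfd 𝕜 M₁} {φ : M₂ ≃ M₁} {f : M → M₂} {x : M}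
    (h : A.SmoothNear B (fun y => φ (f y)) x) : A.SmoothNear (B.transport φ) f x := by
  simpa only [Equiv.symm_apply_apply] using
    (transport_symm_smoothNear B φ (φ (f x))).comp (f := fun y => φ (f y)) h

theorem SmoothMfd.IsOpenIn.univ_prod {B : SmoothMfd 𝕜 M₁} {U : Set M₁} (hU : B.IsOpenIn U)
    (A : SmoothMfd 𝕜 M) : (A.prod B).IsOpenIn (univ ×ˢ U) :=
  let := A.top
  let := B.top
  IsOpen.prod isOpen_univ hU

namespace LieGroupStr

variable {K P : Type u} [Group K] [Group P]

theorem smoothNear_mul_left (L : LieGroupStr 𝕜 K) (g x : K) :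
    L.SmoothNear L.toSmoothMfd (fun y => g * y) x :=
  L.smoothNear_mul (smoothNear_const _ _ _ _) (smoothNear_id _ _)

theorem smoothNear_conj (L : LieGroupStr 𝕜 K) (g x : K) :
    L.SmoothNear L.toSmoothMfd (fun y => g * y * g⁻¹) x :=
  L.smoothNear_mul (L.smoothNear_mul_left g x) (smoothNear_const _ _ _ _)

theorem smooth_of_smoothNear_one {LK : LieGroupStr 𝕜 K} {LP : LieGroupStr 𝕜 P} {φ : K →* P}
    (h : LK.SmoothNear LP.toSmoothMfd φ 1) : LK.Smooth LP.toSmoothMfd φ := by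
  refine smooth_iff.2 fun x => ?_
  have htranslate := (LP.smoothNear_mul_left (φ x) _).comp
    (h.comp_of_eq (LK.smoothNear_mul_left x⁻¹ x) (inv_mul_cancel x))
  simpa only [map_mul, map_inv, mul_inv_cancel_left] using htranslate

end LieGroupStr

theorem smoothNear_action {H P : Type u} [Group H] [Group P] {LH : LieGroupStr 𝕜 H}
    {LP : LieGroupStr 𝕜 P} {S : P →* MulAut H}
    (hS : (LP.prod LH.toSmoothMfd).Smooth LH.toSmoothMfd (fun p : P × H => S p.1 p.2))
    {f : M → P} {g : M → H} {x : M} (hf : A.SmoothNear LP.toSmoothMfd f x)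
    (hg : A.SmoothNear LH.toSmoothMfd g x) :
    A.SmoothNear LH.toSmoothMfd (fun y => S (f y) (g y)) x :=
  (hS.smoothNear _).comp₂ (m := fun a b => S a b) hf hg rfl rfl

variable {Γ Z K : Type u} [Group Γ] [Group K]

/-- `e.symm` is a diffeomorphism from `Z × U` onto an open subset of the Lie group `K`, for
some open identity neighbourhood `U` in `Γ`. For the evident `e : A ×_f Γ ≃ A × Γ` this is
`CentralExt.IsStandard`. -/
def IsStandardAlong (MΓ : SmoothMfd 𝕜 Γ) (MZ : SmoothMfd 𝕜 Z) (e : K ≃ Z × Γ)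
    (L : LieGroupStr 𝕜 K) : Prop :=
  ∃ U : Set Γ, MΓ.IsOpenIn U ∧ (1 : Γ) ∈ U ∧
    (MZ.prod MΓ).SmoothOn L.toSmoothMfd e.symm (univ ×ˢ U) ∧
    L.IsOpenIn {x | (e x).2 ∈ U} ∧
    L.SmoothOn (MZ.prod MΓ) e {x | (e x).2 ∈ U}

namespace IsStandardAlong

variable {MΓ : SmoothMfd 𝕜 Γ} {MZ : SmoothMfd 𝕜 Z} {e : K ≃ Z × Γ} {L : LieGroupStr 𝕜 K}

theorem symm_smoothNear (h : IsStandardAlong MΓ MZ e L) (z : Z) :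
    (MZ.prod MΓ).SmoothNear L.toSmoothMfd e.symm (z, 1) := by
  obtain ⟨U, hU, one_mem, hs, -⟩ := h
  exact hs.smoothNear (hU.univ_prod MZ) ⟨mem_univ _, one_mem⟩

theorem smoothNear (h : IsStandardAlong MΓ MZ e L) {x : K} (hx : (e x).2 = 1) :
    L.SmoothNear (MZ.prod MΓ) e x := by
  obtain ⟨U, -, one_mem, -, hO, hs⟩ := h
  exact hs.smoothNear hO (show (e x).2 ∈ U from hx ▸ one_mem)

theorem mk_smoothNear (h : IsStandardAlong MΓ MZ e L) {f : M → Z} {g : M → Γ} {x : M}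
    (hf : A.SmoothNear MZ f x) (hg : A.SmoothNear MΓ g x) (hx : g x = 1) :
    A.SmoothNear L.toSmoothMfd (fun y => e.symm (f y, g y)) x :=
  (h.symm_smoothNear (f x)).comp_of_eq (hf.prodMk hg) (by rw [hx])

end IsStandardAlong

variable [CommGroup Z]

/-- The bijection `e` identifies the group `K` with `Z × Γ`, with the multiplication
`(z, g) (z', g') = (z g.z' F(g, g'), g g')`. Besides the central extensions `A ×_f Γ` this covers
the extensions of `Γ` by the module `Z` on which `Γ` acts by `ρ`. -/
def IsTwistedProduct (ρ : Γ →* MulAut Z) (F : Γ → Γ → Z) (e : K ≃ Z × Γ) : Prop :=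
  ∀ x y, e (x * y) = ((e x).1 * ρ (e x).2 (e y).1 * F (e x).2 (e y).2, (e x).2 * (e y).2)

namespace IsTwistedProduct

variable {ρ : Γ →* MulAut Z} {F : Γ → Γ → Z} {e : K ≃ Z × Γ}

section Algebra

variable (h : IsTwistedProduct ρ F e) (hF : ∀ g, F 1 g = 1)

include h

theorem mul_fst (x y : K) :
    (e (x * y)).1 = (e x).1 * ρ (e x).2 (e y).1 * F (e x).2 (e y).2 := by rw [h x y]

theorem mul_snd (x y : K) : (e (x * y)).2 = (e x).2 * (e y).2 := by rw [h x y]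

theorem one_snd : (e 1).2 = 1 := by simpa using h.mul_snd 1 1

theorem inv_snd (x : K) : (e x⁻¹).2 = (e x).2⁻¹ := by
  rw [eq_inv_iff_mul_eq_one, ← h.mul_snd, inv_mul_cancel, h.one_snd]

theorem conj_snd (g x : K) : (e (g * x * g⁻¹)).2 = (e g).2 * (e x).2 * (e g).2⁻¹ := by
  rw [h.mul_snd, h.mul_snd, h.inv_snd]

theorem conj_fst (g x : K) : (e (g * x * g⁻¹)).1 = (e g).1 * ρ (e g).2 (e x).1 *
    (F (e g).2 (e x).2 * (F ((e g).2 * (e x).2 * (e g).2⁻¹) (e g).2)⁻¹) *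
    (ρ ((e g).2 * (e x).2 * (e g).2⁻¹) (e g).1)⁻¹ := by
  have hmul := h.mul_fst (g * x * g⁻¹) g
  rw [inv_mul_cancel_right, h.mul_fst, h.conj_snd] at hmul
  rw [← mul_assoc, hmul, mul_inv_cancel_right, mul_inv_cancel_right]

include hF

theorem one_eq : e 1 = (1, 1) := by
  refine Prod.ext ?_ h.one_snd
  simpa [h.one_snd, hF] using h.mul_fst 1 1

theorem inv_fst (x : K) :
    (e x⁻¹).1 = (ρ (e x).2⁻¹ (e x).1 * F (e x).2⁻¹ (e x).2)⁻¹ := by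
  have hmul := h.mul_fst x⁻¹ x
  rw [inv_mul_cancel, h.one_eq hF, h.inv_snd, mul_assoc] at hmul
  exact eq_inv_of_mul_eq_one_left hmul.symm

theorem symm_one_mul (z : Z) (x : K) : e (e.symm (z, 1) * x) = (z * (e x).1, (e x).2) := by
  rw [h]
  simp [hF]

theorem symm_mul_symm (z z' : Z) (g : Γ) :
    e.symm (z, 1) * e.symm (z', g) = e.symm (z * z', g) := by
  apply e.injective
  rw [h.symm_one_mul hF]
  simp only [e.apply_symm_apply]

/-- The inclusion `Z → K`. -/
def incl : Z →* K where
  toFun z := e.symm (z, 1)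
  map_one' := by rw [← h.one_eq hF, e.symm_apply_apply]
  map_mul' a b := (h.symm_mul_symm hF a b 1).symm

theorem apply_incl (z : Z) : e (h.incl hF z) = (z, 1) := e.apply_symm_apply _

omit hF in
/-- The projection `K → Γ`. -/
def proj : K →* Γ where
  toFun x := (e x).2
  map_one' := h.one_snd
  map_mul' := h.mul_snd

end Algebra

variable {LΓ : LieGroupStr 𝕜 Γ} {LZ : LieGroupStr 𝕜 Z}

theorem isLocalLieGroup (h : IsTwistedProduct ρ F e)
    (hρ : (LΓ.prod LZ.toSmoothMfd).Smooth LZ.toSmoothMfd (fun p : Γ × Z => ρ p.1 p.2))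
    (hF : IsC2ss LΓ.toSmoothMfd LZ.toSmoothMfd F) :
    IsLocalLieGroup ((LZ.prod LΓ.toSmoothMfd).transport e) := by
  set B := (LZ.prod LΓ.toSmoothMfd).transport e
  have hfst : ∀ x, B.SmoothNear LZ.toSmoothMfd (fun x => (e x).1) x := fun x =>
    (transport_smoothNear (LZ.prod LΓ.toSmoothMfd) e x).fst
  have hsnd : ∀ x, B.SmoothNear LΓ.toSmoothMfd (fun x => (e x).2) x := fun x =>
    (transport_smoothNear (LZ.prod LΓ.toSmoothMfd) e x).snd
  refine ⟨.transport ?_, .transport ?_, fun g => .transport ?_⟩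
  · have hx := smoothNear_fst B B ((1 : K), (1 : K))
    have hy := smoothNear_snd B B ((1 : K), (1 : K))
    have hx₂ := (hsnd 1).comp_of_eq hx rfl
    have hy₂ := (hsnd 1).comp_of_eq hy rfl
    simp only [h _ _]
    exact (LZ.smoothNear_mul
      (LZ.smoothNear_mul ((hfst 1).comp_of_eq hx rfl)
        (smoothNear_action hρ hx₂ ((hfst 1).comp_of_eq hy rfl)))
      (hF.1.2.2.comp₂ (m := F) hx₂ hy₂ h.one_snd h.one_snd)).prodMk (LΓ.smoothNear_mul hx₂ hy₂)
  · have hinv := LΓ.smoothNear_inv (hsnd 1)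
    refine SmoothNear.congr (.prodMk (LZ.smoothNear_inv (LZ.smoothNear_mul
      (smoothNear_action hρ hinv (hfst 1))
      (hF.1.2.2.comp₂ (m := F) hinv (hsnd 1) ?_ h.one_snd))) hinv)
      (Eventually.of_forall fun x => Prod.ext (h.inv_fst hF.1.1 x) (h.inv_snd x))
    rw [h.one_snd, inv_one]
  · have hconj := (LΓ.smoothNear_conj (e g).2 _).comp (hsnd 1)
    exact SmoothNear.congr (.prodMk (LZ.smoothNear_mul (LZ.smoothNear_mul (LZ.smoothNear_mul
      (smoothNear_const _ _ _ _) (smoothNear_action hρ (smoothNear_const _ _ _ _) (hfst 1)))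
      ((hF.2 (e g).2).comp_of_eq (hsnd 1) h.one_snd))
      (LZ.smoothNear_inv (smoothNear_action hρ hconj (smoothNear_const _ _ _ _)))) hconj)
      (Eventually.of_forall fun x => Prod.ext (h.conj_fst g x) (h.conj_snd g x))

section Standard

variable {L : LieGroupStr 𝕜 K}

theorem symm_smoothNear_of_one (h : IsTwistedProduct ρ F e) (hF : ∀ g, F 1 g = 1) {g : Γ}
    (hg : (LZ.prod LΓ.toSmoothMfd).SmoothNear L.toSmoothMfd e.symm (1, g)) (z : Z) :
    (LZ.prod LΓ.toSmoothMfd).SmoothNear L.toSmoothMfd e.symm (z, g) := by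
  have hdiv : (LZ.prod LΓ.toSmoothMfd).SmoothNear (LZ.prod LΓ.toSmoothMfd)
      (fun p => (z⁻¹ * p.1, p.2)) (z, g) :=
    .prodMk ((LZ.smoothNear_mul_left _ _).comp (smoothNear_fst _ _ _)) (smoothNear_snd _ _ _)
  refine ((L.smoothNear_mul_left (e.symm (z, 1)) _).comp
    (hg.comp_of_eq hdiv (by rw [inv_mul_cancel]))).congr (Eventually.of_forall fun p => ?_)
  rw [h.symm_mul_symm hF, mul_inv_cancel_left]

theorem smoothNear_of_symm_one (h : IsTwistedProduct ρ F e) (hF : ∀ g, F 1 g = 1) {x : K}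
    (hx : L.SmoothNear (LZ.prod LΓ.toSmoothMfd) e (e.symm (1, (e x).2))) :
    L.SmoothNear (LZ.prod LΓ.toSmoothMfd) e x := by
  have hdiv : (e.symm ((e x).1, 1))⁻¹ * x = e.symm (1, (e x).2) := by
    rw [inv_mul_eq_iff_eq_mul, h.symm_mul_symm hF, mul_one, e.symm_apply_apply]
  have htranslate := hx.comp_of_eq (L.smoothNear_mul_left (e.symm ((e x).1, 1))⁻¹ x) hdiv
  refine (((LZ.smoothNear_mul_left (e x).1 _).comp htranslate.fst).prodMk htranslate.snd).congr
    (Eventually.of_forall fun y => ?_)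
  rw [← h.symm_one_mul hF, mul_inv_cancel_left]

theorem isStandardAlong_of_smoothNear (h : IsTwistedProduct ρ F e) (hF : ∀ g, F 1 g = 1)
    (he : L.SmoothNear (LZ.prod LΓ.toSmoothMfd) e 1)
    (he' : (LZ.prod LΓ.toSmoothMfd).SmoothNear L.toSmoothMfd e.symm (1, 1)) :
    IsStandardAlong LΓ.toSmoothMfd LZ.toSmoothMfd e L := by
  have symm_one : e.symm (1, 1) = 1 := by rw [← h.one_eq hF, e.symm_apply_apply]
  have hmk : LΓ.SmoothNear (LZ.prod LΓ.toSmoothMfd) (fun g => (1, g)) 1 :=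
    (smoothNear_const _ _ _ _).prodMk (smoothNear_id _ _)
  have hlocal : ∀ᶠ g in LΓ.nhd 1,
      (LZ.prod LΓ.toSmoothMfd).SmoothNear L.toSmoothMfd e.symm (1, g) ∧
        L.SmoothNear (LZ.prod LΓ.toSmoothMfd) e (e.symm (1, g)) := by
    refine hmk.tendsto.eventually (he'.eventually.and (he'.tendsto.eventually ?_))
    rw [symm_one]
    exact he.eventually
  obtain ⟨U, hlocal, hU, one_mem⟩ := mem_nhd_iff.1 hlocal
  have hO : L.IsOpenIn (h.proj ⁻¹' U) :=
    (LieGroupStr.smooth_of_smoothNear_one (φ := h.proj) he.snd).isOpenIn_preimage hU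
  exact ⟨U, hU, one_mem,
    (smoothOn_iff (hU.univ_prod LZ.toSmoothMfd)).2 fun p hp =>
      h.symm_smoothNear_of_one hF (hlocal hp.2).1 p.1,
    hO, (smoothOn_iff hO).2 fun x hx => h.smoothNear_of_symm_one hF (hlocal hx).2⟩

theorem exists_isStandardAlong (h : IsTwistedProduct ρ F e)
    (hρ : (LΓ.prod LZ.toSmoothMfd).Smooth LZ.toSmoothMfd (fun p : Γ × Z => ρ p.1 p.2))
    (hF : IsC2ss LΓ.toSmoothMfd LZ.toSmoothMfd F) :
    ∃ L : LieGroupStr 𝕜 K, IsStandardAlong LΓ.toSmoothMfd LZ.toSmoothMfd e L := by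
  have hlocal := h.isLocalLieGroup hρ hF
  refine ⟨hlocal.lieGroupStr, h.isStandardAlong_of_smoothNear hF.1.1 ?_ ?_⟩
  · exact (transport_smoothNear (LZ.prod LΓ.toSmoothMfd) e 1).comp (f := fun x => x)
      hlocal.lieGroupStr_smoothNear
  · refine hlocal.smoothNear_lieGroupStr.comp_of_eq
      (transport_symm_smoothNear (LZ.prod LΓ.toSmoothMfd) e (1, 1)) ?_
    rw [← h.one_eq hF.1.1, e.symm_apply_apply]

theorem smooth_proj (h : IsTwistedProduct ρ F e)
    (hL : IsStandardAlong LΓ.toSmoothMfd LZ.toSmoothMfd e L) :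
    L.Smooth LΓ.toSmoothMfd h.proj :=
  LieGroupStr.smooth_of_smoothNear_one (hL.smoothNear h.one_snd).snd

theorem smooth_incl (h : IsTwistedProduct ρ F e) (hF : ∀ g, F 1 g = 1)
    (hL : IsStandardAlong LΓ.toSmoothMfd LZ.toSmoothMfd e L) :
    LZ.Smooth L.toSmoothMfd (h.incl hF) :=
  smooth_iff.2 fun _ => hL.mk_smoothNear (smoothNear_id _ _) (smoothNear_const _ _ 1 _) rfl

end Standard

end IsTwistedProduct

end TwistedProduct

/-! ### Coset bundles -/

section CosetBundle

open SmoothMfd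

variable {𝕜 : Type*} [RCLike 𝕜] {M H P B : Type u} [Group H] [Group P]
  {LH : LieGroupStr 𝕜 H} {LP : LieGroupStr 𝕜 P} {MB : SmoothMfd 𝕜 B} {A : SmoothMfd 𝕜 M}
  {ι : H →* P} {π : P → B}

/-- Near the identity, the homomorphism `ι` has a smooth left inverse on its image. This is how
the embeddedness of split Lie subgroups is used: see `HasLocalRetraction.smoothNear`. -/
def HasLocalRetraction (LH : LieGroupStr 𝕜 H) (LP : LieGroupStr 𝕜 P) (ι : H →* P) : Prop :=
  ∃ r : P → H, LP.SmoothNear LH.toSmoothMfd r 1 ∧ ∀ᶠ p in LP.nhd 1, ∀ h, ι h = p → r p = h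

theorem HasLocalRetraction.smoothNear (hι : HasLocalRetraction LH LP ι) {k : M → H} {x : M}
    (hk : A.SmoothNear LP.toSmoothMfd (fun y => ι (k y)) x) :
    A.SmoothNear LH.toSmoothMfd k x := by
  obtain ⟨r, hr, hev⟩ := hι
  have hdiv := (LP.smoothNear_mul_left (ι (k x))⁻¹ _).comp hk
  have htendsto := hdiv.tendsto
  rw [inv_mul_cancel] at htendsto
  refine ((LH.smoothNear_mul_left (k x) _).comp
    (hr.comp_of_eq hdiv (inv_mul_cancel _))).congr ?_
  filter_upwards [htendsto.eventually hev] with y hy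
  rw [hy ((k x)⁻¹ * k y) (by rw [map_mul, map_inv]), mul_inv_cancel_left]

namespace IsCosetBundle

theorem hasLocalRetraction (h : IsCosetBundle LH LP MB ι π) : HasLocalRetraction LH LP ι := by
  obtain ⟨U, hU, one_mem, s, k, -, -, hk, hsk⟩ := h.local_triv (π 1)
  have hO : LP.IsOpenIn (π ⁻¹' U) := h.smooth_proj.isOpenIn_preimage hU
  refine ⟨fun p => (k 1)⁻¹ * k p,
    (LH.smoothNear_mul_left _ _).comp (hk.smoothNear hO one_mem), ?_⟩
  filter_upwards [hO.mem_nhd one_mem] with p hp x hx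
  subst hx
  have hπ : π (ι x) = π 1 := ((h.fibre _ _).2 ⟨x, (one_mul _).symm⟩).symm
  have hone := hsk 1 one_mem
  have hx := hsk (ι x) hp
  rw [hπ] at hx
  apply h.injective
  rw [map_mul, map_inv, inv_mul_eq_iff_eq_mul]
  apply mul_left_cancel (a := s (π 1))
  rw [← hx, ← mul_assoc, ← hone, one_mul]

theorem exists_section (h : IsCosetBundle LH LP MB ι π) (b : B) :
    ∃ s : B → P, MB.SmoothNear LP.toSmoothMfd s b ∧ ∀ᶠ y in MB.nhd b, π (s y) = y := by
  obtain ⟨U, hU, hb, s, k, hs, hπs, -, -⟩ := h.local_triv b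
  exact ⟨s, hs.smoothNear hU hb, mem_of_superset (hU.mem_nhd hb) hπs⟩

theorem of_section (injective : Function.Injective ι) (smooth_incl : LH.Smooth LP.toSmoothMfd ι)
    (hr : HasLocalRetraction LH LP ι) (smooth_proj : LP.Smooth MB π)
    (fibre : ∀ p p' : P, π p = π p' ↔ ∃ h : H, p' = p * ι h)
    (hs : ∀ b, ∃ s : B → P, MB.SmoothNear LP.toSmoothMfd s b ∧ ∀ᶠ y in MB.nhd b, π (s y) = y) :
    IsCosetBundle LH LP MB ι π := by
  refine ⟨injective, smooth_incl, smooth_proj, fibre, fun b => ?_⟩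
  obtain ⟨s, hs, hπ⟩ := hs b
  obtain ⟨U, hsU, hU, hb⟩ := mem_nhd_iff.1 (hs.eventually.and hπ)
  have hfactor : ∀ p, ∃ h : H, π p ∈ U → p = s (π p) * ι h := by
    intro p
    by_cases hp : π p ∈ U
    · obtain ⟨h, hh⟩ := (fibre _ p).1 (hsU hp).2
      exact ⟨h, fun _ => hh⟩
    · exact ⟨1, fun h => absurd h hp⟩
  choose k hk using hfactor
  have hO : LP.IsOpenIn (π ⁻¹' U) := smooth_proj.isOpenIn_preimage hU
  refine ⟨U, hU, hb, s, k, (smoothOn_iff hU).2 fun y hy => (hsU hy).1, fun y hy => (hsU hy).2,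
    (smoothOn_iff hO).2 fun p hp => hr.smoothNear ?_, hk⟩
  have hdiv : LP.SmoothNear LP.toSmoothMfd (fun p => (s (π p))⁻¹ * p) p :=
    LP.smoothNear_mul (LP.smoothNear_inv ((hsU hp).1.comp (smooth_proj.smoothNear p)))
      (smoothNear_id _ _)
  refine hdiv.congr ?_
  filter_upwards [hO.mem_nhd hp] with p' hp'
  rw [eq_inv_mul_iff_mul_eq]
  exact (hk p' hp').symm

end IsCosetBundle

/-- The base of the bundle defined by a normal split Lie subgroup, as a Lie group. -/
def IsSplitLieSubgroup.quotient {N : Subgroup P} [N.Normal] {LN : LieGroupStr 𝕜 N}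
    {MQ : SmoothMfd 𝕜 (P ⧸ N)} (h : IsSplitLieSubgroup LP N LN MQ) : LieGroupStr 𝕜 (P ⧸ N) where
  toSmoothMfd := MQ
  smooth_mul := by
    refine smooth_iff.2 fun ⟨x, y⟩ => ?_
    obtain ⟨s, hs, hsx⟩ := IsCosetBundle.exists_section h x
    obtain ⟨t, ht, hty⟩ := IsCosetBundle.exists_section h y
    have hfst := smoothNear_fst MQ MQ (x, y)
    have hsnd := smoothNear_snd MQ MQ (x, y)
    refine ((h.smooth_proj.smoothNear _).comp
      (LP.smoothNear_mul (hs.comp hfst) (ht.comp hsnd))).congr ?_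
    filter_upwards [hfst.tendsto.eventually hsx, hsnd.tendsto.eventually hty] with p hp hp'
    rw [QuotientGroup.mk_mul, hp, hp']
  smooth_inv := by
    refine smooth_iff.2 fun x => ?_
    obtain ⟨s, hs, hsx⟩ := IsCosetBundle.exists_section h x
    refine ((h.smooth_proj.smoothNear _).comp (LP.smoothNear_inv hs)).congr ?_
    filter_upwards [hsx] with p hp
    rw [QuotientGroup.mk_inv, hp]

section Extension

variable [Group B] {LB : LieGroupStr 𝕜 B} {q : P →* B}

theorem IsLieGroupExtension.of_section (injective : Function.Injective ι)
    (exact : ι.range = q.ker) (surjective : Function.Surjective q)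
    (smooth_incl : LH.Smooth LP.toSmoothMfd ι)
    (hr : HasLocalRetraction LH LP ι) (smooth_proj : LP.Smooth LB.toSmoothMfd q)
    {s : B → P} (hs : LB.SmoothNear LP.toSmoothMfd s 1) (hqs : ∀ᶠ y in LB.nhd 1, q (s y) = y) :
    IsLieGroupExtension LH LP LB ι q := by
  refine ⟨exact, surjective, .of_section injective smooth_incl hr smooth_proj ?_ fun b => ?_⟩
  · intro p p'
    have hker : q p = q p' ↔ p⁻¹ * p' ∈ q.ker := by
      rw [MonoidHom.mem_ker, map_mul, map_inv, inv_mul_eq_one]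
    rw [hker, ← exact, MonoidHom.mem_range]
    exact exists_congr fun h => by rw [eq_inv_mul_iff_mul_eq, eq_comm]
  · obtain ⟨p, rfl⟩ := surjective b
    have htranslate := LB.smoothNear_mul_left (q p)⁻¹ (q p)
    have htendsto := htranslate.tendsto
    rw [inv_mul_cancel] at htendsto
    refine ⟨fun y => p * s ((q p)⁻¹ * y), (LP.smoothNear_mul_left p _).comp
      (hs.comp_of_eq htranslate (inv_mul_cancel _)), ?_⟩
    filter_upwards [htendsto.eventually hqs] with y hy
    rw [map_mul, hy, mul_inv_cancel_left]

end Extension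

theorem IsTwistedProduct.isLieGroupExtension {Γ Z K : Type u} [Group Γ] [CommGroup Z] [Group K]
    {ρ : Γ →* MulAut Z} {F : Γ → Γ → Z} {e : K ≃ Z × Γ} {LΓ : LieGroupStr 𝕜 Γ}
    {LZ : LieGroupStr 𝕜 Z} {L : LieGroupStr 𝕜 K} (h : IsTwistedProduct ρ F e)
    (hF : ∀ g, F 1 g = 1) (hL : IsStandardAlong LΓ.toSmoothMfd LZ.toSmoothMfd e L) :
    IsLieGroupExtension LZ L LΓ (h.incl hF) h.proj := by
  have proj_symm : ∀ g, h.proj (e.symm (1, g)) = g := fun g =>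
    congrArg Prod.snd (e.apply_symm_apply _)
  refine .of_section (s := fun g => e.symm (1, g)) ?_ ?_ (fun g => ⟨_, proj_symm g⟩)
    (h.smooth_incl hF hL) ⟨fun x => (e x).1, (hL.smoothNear h.one_snd).fst, ?_⟩
    (h.smooth_proj hL) (hL.mk_smoothNear (smoothNear_const _ _ _ _) (smoothNear_id _ _) rfl)
    (Eventually.of_forall proj_symm)
  · exact fun z z' hz => congrArg Prod.fst (e.symm.injective hz)
  · ext x
    constructor
    · rintro ⟨z, rfl⟩
      exact congrArg Prod.snd (h.apply_incl hF z)
    · exact fun hx => ⟨(e x).1, e.injective ((h.apply_incl hF _).trans (Prod.ext rfl hx.symm))⟩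
  · refine Eventually.of_forall fun p z hz => ?_
    subst hz
    exact congrArg Prod.fst (h.apply_incl hF z)

end CosetBundle

/-! ### Nonabelian cochains with values in a crossed module -/

section CrossedModuleCochains

variable {H P Γ : Type u} [Group H] [Group P] [Group Γ] {α : H →* P} {S : P →* MulAut H}

theorem mul_comm_of_peiffer (pf : ∀ h h' : H, S (α h) h' = h * h' * h⁻¹) {c : H} (hc : α c = 1)
    (h : H) : c * h = h * c := by
  have hconj := pf c h
  rw [hc, map_one, MulAut.one_apply, eq_mul_inv_iff_mul_eq] at hconj
  exact hconj.symm

theorem dTwo_mul_mul (T : Γ → MulAut H) (ω : Γ → Γ → H) (x y z : Γ) :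
    dTwo T ω x y z * (ω x y * ω (x * y) z) = T x (ω y z) * ω x (y * z) := by
  simp [dTwo, mul_assoc]

theorem dTwo_eq_of_mul_mul {T : Γ → MulAut H} {ω : Γ → Γ → H} {x y z : Γ} {c : H}
    (h : c * (ω x y * ω (x * y) z) = T x (ω y z) * ω x (y * z)) : dTwo T ω x y z = c :=
  mul_right_cancel ((dTwo_mul_mul T ω x y z).trans h.symm)

/-- The `2`-cochain obtained from `ω` when the section `σ` is replaced by `x ↦ α (h x) σ(x)`. -/
def twistCochain (S : P →* MulAut H) (σ : Γ → P) (ω : Γ → Γ → H) (h : Γ → H) (x y : Γ) : H :=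
  h x * S (σ x) (h y) * ω x y * (h (x * y))⁻¹

theorem twistCochain_of_peiffer (pf : ∀ h h' : H, S (α h) h' = h * h' * h⁻¹) (σ : Γ → P)
    (ω : Γ → Γ → H) (h : Γ → H) (x y : Γ) :
    twistCochain S σ ω h x y = S (α (h x) * σ x) (h y) * h x * ω x y * (h (x * y))⁻¹ := by
  rw [map_mul, MulAut.mul_apply, pf, inv_mul_cancel_right, twistCochain]

section OverDelta

variable (eqv : ∀ (g : P) (h : H), α (S g h) = g * α h * g⁻¹)
  (pf : ∀ h h' : H, S (α h) h' = h * h' * h⁻¹) {σ : Γ → P} {ω : Γ → Γ → H}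
  (hω : ∀ x y, α (ω x y) = deltaMap σ x y)

include eqv hω in
theorem map_dTwo_eq_one (x y z : Γ) : α (dTwo (fun x => S (σ x)) ω x y z) = 1 := by
  simp only [dTwo, map_mul, map_inv, eqv, hω, deltaMap]
  simp only [mul_assoc x y z]
  group

include eqv hω in
theorem map_twistCochain (h : Γ → H) (x y : Γ) :
    α (twistCochain S σ ω h x y) = deltaMap (fun x => α (h x) * σ x) x y := by
  simp only [twistCochain, map_mul, map_inv, eqv, hω, deltaMap]
  group

include pf hω in
theorem action_action (x y : Γ) (h : H) :
    S (σ x) (S (σ y) h) = ω x y * S (σ (x * y)) h * (ω x y)⁻¹ := by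
  rw [← pf, hω, ← MulAut.mul_apply, ← MulAut.mul_apply, ← map_mul, ← map_mul, deltaMap,
    inv_mul_cancel_right]

include eqv pf hω

theorem dTwo_comm (x y z : Γ) (h : H) :
    dTwo (fun x => S (σ x)) ω x y z * h = h * dTwo (fun x => S (σ x)) ω x y z :=
  mul_comm_of_peiffer pf (map_dTwo_eq_one eqv hω x y z) h

theorem dTwo_cocycle (x y z w : Γ) :
    S (σ x) (dTwo (fun x => S (σ x)) ω y z w) *
        (dTwo (fun x => S (σ x)) ω x (y * z) w * dTwo (fun x => S (σ x)) ω x y z) =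
      dTwo (fun x => S (σ x)) ω x y (z * w) * dTwo (fun x => S (σ x)) ω (x * y) z w := by
  set c := dTwo (fun x => S (σ x)) ω
  have hcomm : ∀ x y z h, c x y z * h = h * c x y z := dTwo_comm eqv pf hω
  have hspec : ∀ x y z, S (σ x) (ω y z) * ω x (y * z) = c x y z * (ω x y * ω (x * y) z) :=
    fun x y z => (dTwo_mul_mul (fun x => S (σ x)) ω x y z).symm
  -- `hinner` and `houter` collect the factors of the same product, starting with the inner and
  -- with the outer action respectively.
  have hinner : S (σ x) (S (σ y) (ω z w) * ω y (z * w)) * ω x (y * (z * w)) =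
      S (σ x) (c y z w) * (c x (y * z) w * c x y z) *
        (ω x y * ω (x * y) z * ω (x * y * z) w) := by
    have hspec' := hspec x (y * z) w
    rw [mul_assoc y z w] at hspec'
    calc _ = S (σ x) (c y z w) * (S (σ x) (ω y z) *
          (S (σ x) (ω (y * z) w) * ω x (y * (z * w)))) := by
          rw [hspec]; simp only [map_mul, mul_assoc]
      _ = S (σ x) (c y z w) * (c x (y * z) w * (S (σ x) (ω y z) * ω x (y * z)) *
          ω (x * (y * z)) w) := by
          rw [hspec', ← mul_assoc (S (σ x) (ω y z)), ← hcomm]; simp only [mul_assoc]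
      _ = _ := by rw [hspec]; simp only [mul_assoc]
  have houter : S (σ x) (S (σ y) (ω z w) * ω y (z * w)) * ω x (y * (z * w)) =
      c x y (z * w) * c (x * y) z w * (ω x y * ω (x * y) z * ω (x * y * z) w) := by
    calc _ = ω x y * S (σ (x * y)) (ω z w) * (ω x y)⁻¹ *
          (S (σ x) (ω y (z * w)) * ω x (y * (z * w))) := by
          rw [map_mul, action_action pf hω]; simp only [mul_assoc]
      _ = c x y (z * w) * (ω x y * (S (σ (x * y)) (ω z w) * ω (x * y) (z * w))) := by
          rw [hspec, ← mul_assoc _ (c x y (z * w)), ← hcomm]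
          simp only [mul_assoc, inv_mul_cancel_left]
      _ = _ := by
          rw [hspec, ← mul_assoc (ω x y), ← hcomm]; simp only [mul_assoc]
  exact mul_right_cancel (hinner.symm.trans houter)

theorem dTwo_twistCochain (h : Γ → H) (x y z : Γ) :
    dTwo (fun x => S (α (h x) * σ x)) (twistCochain S σ ω h) x y z =
      dTwo (fun x => S (σ x)) ω x y z := by
  have hcomm := dTwo_comm eqv pf hω x y z
  have hspec := dTwo_mul_mul (fun x => S (σ x)) ω x y z
  set c := dTwo (fun x => S (σ x)) ω x y z
  apply dTwo_eq_of_mul_mul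
  have htwist : S (σ x) (twistCochain S σ ω h y z) = S (σ x) (h y) *
      (ω x y * S (σ (x * y)) (h z) * (ω x y)⁻¹) * S (σ x) (ω y z) *
        (S (σ x) (h (y * z)))⁻¹ := by
    simp only [twistCochain, map_mul, map_inv, action_action pf hω]
  rw [map_mul, MulAut.mul_apply, pf, htwist]
  simp only [twistCochain]
  calc _ = h x * S (σ x) (h y) * (ω x y * S (σ (x * y)) (h z)) * (c * ω (x * y) z) *
        (h (x * y * z))⁻¹ := by
        rw [hcomm, hcomm]
        simp only [mul_assoc, inv_mul_cancel_left]
        rw [hcomm]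
    _ = h x * S (σ x) (h y) * (ω x y * S (σ (x * y)) (h z)) * (ω x y)⁻¹ *
        (c * (ω x y * ω (x * y) z)) * (h (x * y * z))⁻¹ := by
        rw [hcomm (ω (x * y) z), hcomm (ω x y * _)]
        simp only [mul_assoc, inv_mul_cancel_left]
    _ = _ := by
        rw [hspec]
        simp only [mul_assoc, inv_mul_cancel_left]

end OverDelta

theorem dTwo_mul_of_central (T : Γ → MulAut H) {β : Γ → Γ → H}
    (hβ : ∀ x y a, β x y * a = a * β x y) (ω : Γ → Γ → H) (x y z : Γ) :
    dTwo T (fun x y => β x y * ω x y) x y z = dTwo T β x y z * dTwo T ω x y z := by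
  have hcomm : ∀ x y a, Commute a (β x y) := fun x y a => (hβ x y a).symm
  apply dTwo_eq_of_mul_mul
  rw [(hcomm (x * y) z (ω x y)).mul_mul_mul_comm,
    ((hcomm x y (dTwo T ω x y z)).mul_right (hcomm (x * y) z _)).mul_mul_mul_comm,
    dTwo_mul_mul, dTwo_mul_mul, map_mul,
    (hcomm x (y * z) (T x (ω y z))).mul_mul_mul_comm]

theorem dTwo_map_mul {Z : Type u} [Group Z] {T : Γ → MulAut H} {R : Γ → MulAut Z} {ι : Z →* H}
    (hι : ∀ z h, ι z * h = h * ι z) (hR : ∀ x z, T x (ι z) = ι (R x z)) (β : Γ → Γ → Z)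
    (ω : Γ → Γ → H) (x y z : Γ) :
    dTwo T (fun x y => ι (β x y) * ω x y) x y z = ι (dTwo R β x y z) * dTwo T ω x y z := by
  rw [dTwo_mul_of_central T (β := fun x y => ι (β x y)) fun _ _ => hι _]
  simp only [dTwo, hR, map_mul, map_inv]

theorem dThree_eq_one_iff {Z : Type u} [CommGroup Z] {R : Γ → MulAut Z} {c : Γ → Γ → Γ → Z}
    {x y z w : Γ} : dThree R c x y z w = 1 ↔
      R x (c y z w) * (c x (y * z) w * c x y z) = c x y (z * w) * c (x * y) z w := by
  rw [dThree, ← mul_inv_eq_one (a := R x (c y z w) * _), mul_inv]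
  exact iff_of_eq (congrArg (· = 1) (by ac_rfl))

end CrossedModuleCochains

/-! ### Smooth nonabelian cochains -/

section SmoothCochains

open SmoothMfd

variable {𝕜 : Type*} [RCLike 𝕜] {Γ Γ' H P Z : Type u} [Group Γ] [Group Γ'] [Group H] [Group P]
  [CommGroup Z] {MΓ : SmoothMfd 𝕜 Γ} {MΓ' : SmoothMfd 𝕜 Γ'} {LΓ : LieGroupStr 𝕜 Γ}
  {LH : LieGroupStr 𝕜 H} {LP : LieGroupStr 𝕜 P} {LZ : LieGroupStr 𝕜 Z}

theorem isC2ss_one : IsC2ss MΓ LH.toSmoothMfd (fun _ _ => 1) :=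
  ⟨⟨fun _ => rfl, fun _ => rfl, smoothNear_const _ _ _ _⟩, fun _ => smoothNear_const _ _ _ _⟩

section Map

variable {ι : H →* P} (inj : Function.Injective ι) (hr : HasLocalRetraction LH LP ι)

include inj hr

theorem isC2ss_of_map {ω : Γ → Γ → H}
    (hω : IsC2ss MΓ LP.toSmoothMfd (fun x y => ι (ω x y))) : IsC2ss MΓ LH.toSmoothMfd ω := by
  refine ⟨⟨fun g => inj ?_, fun g => inj ?_, hr.smoothNear hω.1.2.2⟩, fun g => hr.smoothNear ?_⟩
  · rw [map_one]; exact hω.1.1 g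
  · rw [map_one]; exact hω.1.2.1 g
  · simpa only [map_mul, map_inv] using hω.2 g

theorem isC3s_of_map {c : Γ → Γ → Γ → H}
    (hc : IsC3s MΓ LP.toSmoothMfd (fun x y z => ι (c x y z))) : IsC3s MΓ LH.toSmoothMfd c := by
  refine ⟨fun x y => inj ?_, fun x y => inj ?_, fun x y => inj ?_, hr.smoothNear hc.2.2.2⟩
  · rw [map_one]; exact hc.1 x y
  · rw [map_one]; exact hc.2.1 x y
  · rw [map_one]; exact hc.2.2.1 x y

end Map

theorem isC2ss_deltaMap {h : Γ → H} (hh : IsC1s LΓ.toSmoothMfd LH.toSmoothMfd h) :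
    IsC2ss LΓ.toSmoothMfd LH.toSmoothMfd (deltaMap h) := by
  refine ⟨⟨fun g => ?_, fun g => ?_, ?_⟩, fun g => ?_⟩
  · simp [deltaMap, hh.1]
  · simp [deltaMap, hh.1]
  · have hfst := smoothNear_fst LΓ.toSmoothMfd LΓ.toSmoothMfd ((1 : Γ), (1 : Γ))
    have hsnd := smoothNear_snd LΓ.toSmoothMfd LΓ.toSmoothMfd ((1 : Γ), (1 : Γ))
    exact LH.smoothNear_mul
      (LH.smoothNear_mul (hh.2.comp_of_eq hfst rfl) (hh.2.comp_of_eq hsnd rfl))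
      (LH.smoothNear_inv (hh.2.comp_of_eq (LΓ.smoothNear_mul hfst hsnd) (mul_one _)))
  · refine (LH.smoothNear_mul ((LH.smoothNear_conj (h g) _).comp hh.2)
      (LH.smoothNear_inv (hh.2.comp_of_eq (LΓ.smoothNear_conj g 1) (by simp)))).congr
      (Eventually.of_forall fun x => ?_)
    simp [deltaMap, mul_assoc]

theorem isC2ss_twistCochain {S : P →* MulAut H}
    (hS : (LP.prod LH.toSmoothMfd).Smooth LH.toSmoothMfd (fun x : P × H => S x.1 x.2))
    {σ : Γ → P} (hσ : IsC1s LΓ.toSmoothMfd LP.toSmoothMfd σ) {ω : Γ → Γ → H}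
    (hω : IsC2ss LΓ.toSmoothMfd LH.toSmoothMfd ω) {h : Γ → H}
    (hh : IsC1s LΓ.toSmoothMfd LH.toSmoothMfd h) :
    IsC2ss LΓ.toSmoothMfd LH.toSmoothMfd (twistCochain S σ ω h) := by
  refine ⟨⟨fun g => ?_, fun g => ?_, ?_⟩, fun g => ?_⟩
  · simp [twistCochain, hσ.1, hh.1, hω.1.1]
  · simp [twistCochain, hh.1, hω.1.2.1]
  · have hfst := smoothNear_fst LΓ.toSmoothMfd LΓ.toSmoothMfd ((1 : Γ), (1 : Γ))
    have hsnd := smoothNear_snd LΓ.toSmoothMfd LΓ.toSmoothMfd ((1 : Γ), (1 : Γ))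
    exact LH.smoothNear_mul (LH.smoothNear_mul (LH.smoothNear_mul (hh.2.comp_of_eq hfst rfl)
      (smoothNear_action hS (hσ.2.comp_of_eq hfst rfl) (hh.2.comp_of_eq hsnd rfl))) hω.1.2.2)
      (LH.smoothNear_inv (hh.2.comp_of_eq (LΓ.smoothNear_mul hfst hsnd) (mul_one _)))
  · have hconj := LΓ.smoothNear_conj g 1
    have hleft := smoothNear_action hS
      (smoothNear_const LΓ.toSmoothMfd LP.toSmoothMfd (σ g) 1) hh.2
    have hright := smoothNear_action hS (hσ.2.comp_of_eq hconj (by simp))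
      (smoothNear_const LΓ.toSmoothMfd LH.toSmoothMfd (h g) 1)
    refine (LH.smoothNear_mul (LH.smoothNear_mul (LH.smoothNear_mul
      ((LH.smoothNear_mul_left (h g) _).comp hleft) (hω.2 g)) (LH.smoothNear_inv hright))
      (LH.smoothNear_inv (hh.2.comp_of_eq hconj (by simp)))).congr
      (Eventually.of_forall fun x => ?_)
    simp [twistCochain, mul_assoc]

section Central

variable {ι : Z →* H} (hι : ∀ z h, ι z * h = h * ι z) {β : Γ → Γ → Z} {ω : Γ → Γ → H}
  (hω : IsC2ss MΓ LH.toSmoothMfd ω)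

include hι

theorem map_mul_mul_inv_map_mul (z w : Z) (h k : H) :
    ι z * h * (ι w * k)⁻¹ = ι (z * w⁻¹) * (h * k⁻¹) := by
  rw [map_mul, mul_inv_rev, ← map_inv, mul_assoc, mul_assoc, ← hι w⁻¹, ← mul_assoc h,
    ← hι w⁻¹ h, mul_assoc]

include hω

theorem isC2ss_of_map_mul (inj : Function.Injective ι) (hr : HasLocalRetraction LZ LH ι)
    (hβω : IsC2ss MΓ LH.toSmoothMfd (fun x y => ι (β x y) * ω x y)) :
    IsC2ss MΓ LZ.toSmoothMfd β := by
  have hmap : ∀ x y, ι (β x y) = ι (β x y) * ω x y * (ω x y)⁻¹ := fun x y =>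
    (mul_inv_cancel_right _ _).symm
  refine ⟨⟨fun g => inj ?_, fun g => inj ?_, hr.smoothNear ?_⟩, fun g => hr.smoothNear ?_⟩
  · simpa [hω.1.1] using hβω.1.1 g
  · simpa [hω.1.2.1] using hβω.1.2.1 g
  · exact (LH.smoothNear_mul hβω.1.2.2 (LH.smoothNear_inv hω.1.2.2)).congr
      (Eventually.of_forall fun p => hmap p.1 p.2)
  · refine (LH.smoothNear_mul (hβω.2 g) (LH.smoothNear_inv (hω.2 g))).congr
      (Eventually.of_forall fun x => ?_)
    rw [map_mul_mul_inv_map_mul hι, mul_inv_cancel_right]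

theorem isC2ss_map_mul (hs : LZ.Smooth LH.toSmoothMfd ι)
    (hβ : IsC2ss MΓ LZ.toSmoothMfd β) :
    IsC2ss MΓ LH.toSmoothMfd (fun x y => ι (β x y) * ω x y) := by
  refine ⟨⟨fun g => ?_, fun g => ?_, ?_⟩, fun g => ?_⟩
  · simp [hβ.1.1, hω.1.1]
  · simp [hβ.1.2.1, hω.1.2.1]
  · exact LH.smoothNear_mul ((hs.smoothNear _).comp hβ.1.2.2) hω.1.2.2
  · refine (LH.smoothNear_mul ((hs.smoothNear _).comp (hβ.2 g)) (hω.2 g)).congr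
      (Eventually.of_forall fun x => ?_)
    rw [map_mul_mul_inv_map_mul hι]

end Central

section Abelian

variable {β γ : Γ → Γ → Z}

theorem isC2ss_inv (hβ : IsC2ss MΓ LZ.toSmoothMfd β) :
    IsC2ss MΓ LZ.toSmoothMfd (fun x y => (β x y)⁻¹) := by
  refine ⟨⟨fun g => ?_, fun g => ?_, LZ.smoothNear_inv hβ.1.2.2⟩, fun g => ?_⟩
  · simp [hβ.1.1]
  · simp [hβ.1.2.1]
  · exact (LZ.smoothNear_inv (hβ.2 g)).congr (Eventually.of_forall fun x => by simp [mul_comm])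

theorem isC2ss_mul (hβ : IsC2ss MΓ LZ.toSmoothMfd β)
    (hγ : IsC2ss MΓ LZ.toSmoothMfd γ) :
    IsC2ss MΓ LZ.toSmoothMfd (fun x y => β x y * γ x y) :=
  isC2ss_map_mul (ι := MonoidHom.id Z) mul_comm hγ (smooth_iff.2 (smoothNear_id _)) hβ

theorem dTwo_inv (ρ : Γ → MulAut Z) (β : Γ → Γ → Z) (x y z : Γ) :
    dTwo ρ (fun x y => (β x y)⁻¹) x y z = (dTwo ρ β x y z)⁻¹ := by
  simp only [dTwo, map_inv, mul_inv]

theorem dTwo_mul (ρ : Γ → MulAut Z) (β γ : Γ → Γ → Z) (x y z : Γ) :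
    dTwo ρ (fun x y => β x y * γ x y) x y z = dTwo ρ β x y z * dTwo ρ γ x y z :=
  dTwo_mul_of_central ρ (fun _ _ => mul_comm _) γ x y z

theorem dTwo_one (ρ : Γ → MulAut Z) (x y z : Γ) : dTwo ρ (fun _ _ => 1) x y z = 1 := by
  simp [dTwo]

theorem H3ss.mk_eq_mk_iff {ρ : Γ →* MulAut Z} {c c' : Z3s MΓ LZ.toSmoothMfd ρ} :
    H3ss.mk c = H3ss.mk c' ↔ ∃ β : Γ → Γ → Z, IsC2ss MΓ LZ.toSmoothMfd β ∧
      ∀ x y z, c'.fn x y z = c.fn x y z * dTwo ρ β x y z := by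
  have cohomologous : Equivalence (fun c c' : Z3s MΓ LZ.toSmoothMfd ρ =>
      ∃ β : Γ → Γ → Z, IsC2ss MΓ LZ.toSmoothMfd β ∧
        ∀ x y z, c'.fn x y z = c.fn x y z * dTwo ρ β x y z) := by
    refine ⟨fun c => ?_, ?_, ?_⟩
    · refine ⟨_, isC2ss_one, fun x y z => ?_⟩
      rw [dTwo_one, mul_one]
    · rintro c c' ⟨β, hβ, h⟩
      refine ⟨_, isC2ss_inv hβ, fun x y z => ?_⟩
      rw [dTwo_inv, h, mul_inv_cancel_right]
    · rintro c c' c'' ⟨β, hβ, h⟩ ⟨γ, hγ, h'⟩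
      refine ⟨_, isC2ss_mul hβ hγ, fun x y z => ?_⟩
      rw [dTwo_mul, h', h, mul_assoc]
  exact Quot.eq.trans cohomologous.eqvGen_iff

end Abelian

/-! ### Factor systems of crossed modules -/

/-- `(τ, ω)` is a locally smooth factor system of `Γ` with values in the crossed module
`α : H → P`: the cochain `ω ∈ C^2_ss(Γ, H)` lifts the defect `δ_τ` of `τ ∈ C^1_s(Γ, P)` from being
a homomorphism. -/
structure IsFactorSystem (MΓ : SmoothMfd 𝕜 Γ) (LP : LieGroupStr 𝕜 P) (LH : LieGroupStr 𝕜 H)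
    (α : H →* P) (τ : Γ → P) (ω : Γ → Γ → H) : Prop where
  c1s : IsC1s MΓ LP.toSmoothMfd τ
  c2ss : IsC2ss MΓ LH.toSmoothMfd ω
  lift_eq : ∀ x y, α (ω x y) = deltaMap τ x y

/-- The smooth homomorphism `ι` identifies `Z` with the kernel of `α`, and its inverse is smooth
in the sense of `HasLocalRetraction`. -/
structure IsEmbeddedKernel (LZ : LieGroupStr 𝕜 Z) (LH : LieGroupStr 𝕜 H) (ι : Z →* H)
    (α : H →* P) : Prop where
  injective : Function.Injective ι
  range_eq : ι.range = α.ker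
  smooth : LZ.Smooth LH.toSmoothMfd ι
  retraction : HasLocalRetraction LZ LH ι

section Kernel

variable {α : H →* P} {ι : Z →* H}

namespace IsEmbeddedKernel

variable (hι : IsEmbeddedKernel LZ LH ι α)

include hι

theorem map_eq_one (z : Z) : α (ι z) = 1 :=
  MonoidHom.mem_ker.1 (hι.range_eq ▸ MonoidHom.mem_range.2 ⟨z, rfl⟩)

theorem exists_eq {h : H} (hh : α h = 1) : ∃ z, ι z = h :=
  MonoidHom.mem_range.1 (hι.range_eq ▸ MonoidHom.mem_ker.2 hh)

theorem exists_map_mul_eq {h k : H} (hhk : α h = α k) : ∃ z, h = ι z * k := by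
  obtain ⟨z, hz⟩ := hι.exists_eq (h := h * k⁻¹) (by rw [map_mul, map_inv, hhk, mul_inv_cancel])
  exact ⟨z, by rw [hz, inv_mul_cancel_right]⟩

theorem comm {S : P →* MulAut H} (hα : IsSmoothCrossedModule LH LP α S) (z : Z) (h : H) :
    ι z * h = h * ι z :=
  mul_comm_of_peiffer hα.peiffer (hι.map_eq_one z) h

end IsEmbeddedKernel

end Kernel

namespace IsFactorSystem

variable {α : H →* P} {S : P →* MulAut H} {τ : Γ → P} {ω ω' : Γ → Γ → H}

theorem comp (h : IsFactorSystem MΓ LP LH α τ ω) {φ : Γ' →* Γ} (hφ : MΓ'.Smooth MΓ φ) :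
    IsFactorSystem MΓ' LP LH α (fun x => τ (φ x)) (fun x y => ω (φ x) (φ y)) := by
  refine ⟨⟨?_, ?_⟩, ⟨⟨fun x => ?_, fun x => ?_, ?_⟩, fun x => ?_⟩, fun x y => ?_⟩
  · simp only [map_one, h.c1s.1]
  · exact h.c1s.2.comp_of_eq (hφ.smoothNear 1) (map_one φ)
  · simp only [map_one, h.c2ss.1.1]
  · simp only [map_one, h.c2ss.1.2.1]
  · exact h.c2ss.1.2.2.comp₂ (m := ω) ((hφ.smoothNear _).comp (smoothNear_fst MΓ' MΓ' (1, 1)))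
      ((hφ.smoothNear _).comp (smoothNear_snd MΓ' MΓ' (1, 1))) (map_one φ) (map_one φ)
  · simpa only [map_mul, map_inv] using
      (h.c2ss.2 (φ x)).comp_of_eq (hφ.smoothNear 1) (map_one φ)
  · simpa only [deltaMap, map_mul] using h.lift_eq (φ x) (φ y)

section CrossedModule

variable (hα : IsSmoothCrossedModule LH LP α S)

include hα

theorem twist (h : IsFactorSystem LΓ.toSmoothMfd LP LH α τ ω) {η : Γ → H}
    (hη : IsC1s LΓ.toSmoothMfd LH.toSmoothMfd η) :
    IsFactorSystem LΓ.toSmoothMfd LP LH α (fun x => α (η x) * τ x) (twistCochain S τ ω η) where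
  c1s := ⟨by simp only [hη.1, map_one, one_mul, h.c1s.1],
    LP.smoothNear_mul ((hα.smooth_hom.smoothNear _).comp hη.2) h.c1s.2⟩
  c2ss := isC2ss_twistCochain hα.smooth_action h.c1s h.c2ss hη
  lift_eq := map_twistCochain hα.equivariant h.lift_eq η

theorem isC3s_dTwo (h : IsFactorSystem LΓ.toSmoothMfd LP LH α τ ω) :
    IsC3s LΓ.toSmoothMfd LH.toSmoothMfd (dTwo (fun x => S (τ x)) ω) := by
  obtain ⟨⟨map_one_left, map_one_right, smooth⟩, -⟩ := h.c2ss
  refine ⟨fun x y => ?_, fun x y => ?_, fun x y => ?_, ?_⟩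
  · simp [dTwo, h.c1s.1, map_one_left]
  · simp [dTwo, map_one_left, map_one_right]
  · simp [dTwo, map_one_right]
  · set B := LΓ.toSmoothMfd
    have hx := smoothNear_fst B (B.prod B) ((1 : Γ), (1 : Γ), (1 : Γ))
    have hyz := smoothNear_snd B (B.prod B) ((1 : Γ), (1 : Γ), (1 : Γ))
    exact LH.smoothNear_mul (LH.smoothNear_mul (LH.smoothNear_mul
      (smoothNear_action hα.smooth_action (h.c1s.2.comp_of_eq hx rfl)
        (smooth.comp₂ (m := ω) hyz.fst hyz.snd rfl rfl))
      (smooth.comp₂ (m := ω) hx (LΓ.smoothNear_mul hyz.fst hyz.snd) rfl (mul_one _)))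
      (LH.smoothNear_inv
        (smooth.comp₂ (m := ω) (LΓ.smoothNear_mul hx hyz.fst) hyz.snd (mul_one _) rfl)))
      (LH.smoothNear_inv (smooth.comp₂ (m := ω) hx hyz.fst rfl rfl))

section Kernel

variable {ι : Z →* H} (hι : IsEmbeddedKernel LZ LH ι α)

include hι

theorem map_mul (h : IsFactorSystem MΓ LP LH α τ ω) {β : Γ → Γ → Z}
    (hβ : IsC2ss MΓ LZ.toSmoothMfd β) :
    IsFactorSystem MΓ LP LH α τ (fun x y => ι (β x y) * ω x y) where
  c1s := h.c1s
  c2ss := isC2ss_map_mul (hι.comm hα) h.c2ss hι.smooth hβ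
  lift_eq x y := by rw [_root_.map_mul, hι.map_eq_one, one_mul, h.lift_eq]

theorem exists_eq_map_mul (h : IsFactorSystem MΓ LP LH α τ ω)
    (h' : IsFactorSystem MΓ LP LH α τ ω') : ∃ β : Γ → Γ → Z, IsC2ss MΓ LZ.toSmoothMfd β ∧
      ω' = fun x y => ι (β x y) * ω x y := by
  choose β hβ using fun x y =>
    hι.exists_map_mul_eq ((h'.lift_eq x y).trans (h.lift_eq x y).symm)
  obtain rfl : ω' = fun x y => ι (β x y) * ω x y := funext₂ hβ
  exact ⟨β, isC2ss_of_map_mul (hι.comm hα) h.c2ss hι.injective hι.retraction h'.c2ss, rfl⟩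

variable {R : Γ →* MulAut Z}

theorem exists_z3s (h : IsFactorSystem LΓ.toSmoothMfd LP LH α τ ω)
    (hR : ∀ x z, S (τ x) (ι z) = ι (R x z)) :
    ∃ c : Z3s LΓ.toSmoothMfd LZ.toSmoothMfd R,
      ∀ x y z, dTwo (fun x => S (τ x)) ω x y z = ι (c.fn x y z) := by
  choose c hc using fun x y z => hι.exists_eq (map_dTwo_eq_one hα.equivariant h.lift_eq x y z)
  have hcω : dTwo (fun x => S (τ x)) ω = fun x y z => ι (c x y z) :=
    funext₃ fun x y z => (hc x y z).symm
  refine ⟨⟨c, isC3s_of_map hι.injective hι.retraction (hcω ▸ h.isC3s_dTwo hα),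
    fun x y z w => dThree_eq_one_iff.2 (hι.injective ?_)⟩, fun x y z => (hc x y z).symm⟩
  have cocycle := dTwo_cocycle hα.equivariant hα.peiffer h.lift_eq x y z w
  simpa only [hcω, hR, _root_.map_mul] using cocycle

omit hα in
theorem exists_z2ss {φ : Γ →* P} (h : IsFactorSystem MΓ LP LH α φ ω)
    (hR : ∀ x z, S (φ x) (ι z) = ι (R x z))
    (hd : ∀ x y z, dTwo (fun x => S (φ x)) ω x y z = 1) :
    ∃ F : Z2ss MΓ LZ.toSmoothMfd R, ∀ x y, ω x y = ι (F.fn x y) := by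
  choose F hF using fun x y => hι.exists_eq
    (show α (ω x y) = 1 by rw [h.lift_eq, deltaMap, _root_.map_mul, mul_inv_cancel])
  obtain rfl : ω = fun x y => ι (F x y) := funext₂ fun x y => (hF x y).symm
  refine ⟨⟨F, isC2ss_of_map hι.injective hι.retraction h.c2ss,
    fun x y z => hι.injective ?_⟩, fun _ _ => rfl⟩
  have cocycle := hd x y z
  simpa only [dTwo, hR, _root_.map_mul, map_inv, map_one] using cocycle

end Kernel

end CrossedModule

end IsFactorSystem

end SmoothCochains

/-! ### The obstruction class -/

namespace CentralExt

open SmoothMfd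

variable {𝕜 : Type*} [RCLike 𝕜] {Γ Z : Type u} [Group Γ] [CommGroup Z]

/-- The bijection of `Z ×_f Γ` with `Z × Γ`, as a coordinate for `IsTwistedProduct`. -/
def equivProd {MΓ : SmoothMfd 𝕜 Γ} {MZ : SmoothMfd 𝕜 Z} (f : Z2ss MΓ MZ 1) :
    CentralExt f ≃ Z × Γ where
  toFun x := (x.fst, x.snd)
  invFun p := ⟨p.1, p.2⟩
  left_inv _ := rfl
  right_inv _ := rfl

theorem isTwistedProduct {MΓ : SmoothMfd 𝕜 Γ} {MZ : SmoothMfd 𝕜 Z} (f : Z2ss MΓ MZ 1) :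
    IsTwistedProduct 1 f.fn (equivProd f) := fun _ _ => rfl

theorem incl_mul {MΓ : SmoothMfd 𝕜 Γ} {MZ : SmoothMfd 𝕜 Z} (f : Z2ss MΓ MZ 1) (z : Z)
    (x : CentralExt f) : incl f z * x = ⟨z * x.fst, x.snd⟩ :=
  (equivProd f).injective ((isTwistedProduct f).symm_one_mul f.c2ss.1.1 z x)

variable {LΓ : LieGroupStr 𝕜 Γ} {LZ : LieGroupStr 𝕜 Z} (f : Z2ss LΓ.toSmoothMfd LZ.toSmoothMfd 1)

theorem exists_isStandard : ∃ L : LieGroupStr 𝕜 (CentralExt f), IsStandard L :=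
  (isTwistedProduct f).exists_isStandardAlong
    (smooth_iff.2 fun p => smoothNear_snd _ _ p) f.c2ss

variable {f} {L : LieGroupStr 𝕜 (CentralExt f)}

theorem IsStandard.isStandardAlong (hL : IsStandard L) :
    IsStandardAlong LΓ.toSmoothMfd LZ.toSmoothMfd (equivProd f) L := hL

theorem IsStandard.isLieGroupExtension (hL : IsStandard L) :
    IsLieGroupExtension LZ L LΓ (incl f) (proj f) :=
  (isTwistedProduct f).isLieGroupExtension f.c2ss.1.1 hL.isStandardAlong

end CentralExt

section Obstruction

open SmoothMfd CentralExt

variable {𝕜 : Type*} [RCLike 𝕜] {G Z : Type u} [Group G] [CommGroup Z]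
  {N : Subgroup G} {LG : LieGroupStr 𝕜 G} {LZ : LieGroupStr 𝕜 Z}
  {LN : LieGroupStr 𝕜 N} {MQ : SmoothMfd 𝕜 (G ⧸ N)}
  {ρ : G →* MulAut Z} {f : Z2ss LN.toSmoothMfd LZ.toSmoothMfd 1}
  {L : LieGroupStr 𝕜 (CentralExt f)}

theorem CentralExt.IsStandard.isEmbeddedKernel (hL : IsStandard L) :
    IsEmbeddedKernel LZ L (incl f) (alphaHom f) where
  injective := hL.isLieGroupExtension.2.2.injective
  range_eq := by
    rw [hL.isLieGroupExtension.1, alphaHom]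
    exact (MonoidHom.ker_comp_of_injective _ _ N.subtype_injective).symm
  smooth := hL.isLieGroupExtension.2.2.smooth_incl
  retraction := hL.isLieGroupExtension.2.2.hasLocalRetraction

variable [N.Normal]

theorem exists_isC1s_alphaHom_mul_eq (hN : IsSplitLieSubgroup LG N LN MQ) (hL : IsStandard L)
    {Γ : Type u} [Group Γ] {MΓ : SmoothMfd 𝕜 Γ} {τ τ' : Γ → G}
    (hτ : IsC1s MΓ LG.toSmoothMfd τ) (hτ' : IsC1s MΓ LG.toSmoothMfd τ')
    (h : ∀ x, (τ x : G ⧸ N) = τ' x) :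
    ∃ η : Γ → CentralExt f, IsC1s MΓ L.toSmoothMfd η ∧
      ∀ x, (η x).fst = 1 ∧ alphaHom f (η x) * τ x = τ' x := by
  have hmem : ∀ x, τ' x * (τ x)⁻¹ ∈ N := fun x => by
    rw [← QuotientGroup.eq_one_iff, QuotientGroup.mk_mul, QuotientGroup.mk_inv, h,
      mul_inv_cancel]
  have hone : (⟨τ' 1 * (τ 1)⁻¹, hmem 1⟩ : N) = 1 := Subtype.ext (by simp [hτ.1, hτ'.1])
  refine ⟨fun x => ⟨1, ⟨τ' x * (τ x)⁻¹, hmem x⟩⟩, ⟨CentralExt.ext rfl hone, ?_⟩,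
    fun x => ⟨rfl, inv_mul_cancel_right _ _⟩⟩
  exact hL.isStandardAlong.mk_smoothNear (smoothNear_const _ _ _ _)
    ((IsCosetBundle.hasLocalRetraction hN).smoothNear
      (LG.smoothNear_mul hτ'.2 (LG.smoothNear_inv hτ.2))) hone

variable {θ : G → N → Z} {hθ : IsZ1ss LG LZ LN ρ f θ} {hc : IsCompatible ρ f θ}

theorem extAction_incl (g : G) (z : Z) :
    extAction hθ hc g (incl f z) = incl f (ρ g z) := by
  rw [extAction_apply]
  refine CentralExt.ext ?_ ?_
  · simp [incl, (hθ.c1s g).1]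
  · simp [incl]

theorem quotAction_of_section (hρN : N ≤ ρ.ker) {σ : G ⧸ N → G}
    (hσ : ∀ x, (σ x : G ⧸ N) = x) (x : G ⧸ N) : quotAction ρ hρN x = ρ (σ x) := by
  conv_lhs => rw [← hσ x]
  rfl

namespace IsFactorData

variable {σ σ' : G ⧸ N → G} {ω ω' : G ⧸ N → G ⧸ N → CentralExt f}

theorem isFactorSystem (h : IsFactorData LG MQ L σ ω) :
    IsFactorSystem MQ LG L (alphaHom f) σ ω :=
  ⟨h.section_c1s, h.c2ss, h.lift_eq⟩

theorem of_isFactorSystem (hσ : ∀ x, (σ x : G ⧸ N) = x)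
    (h : IsFactorSystem MQ LG L (alphaHom f) σ ω) : IsFactorData LG MQ L σ ω :=
  ⟨hσ, h.c1s, h.c2ss, h.lift_eq⟩

theorem extAction_section_incl (h : IsFactorData LG MQ L σ ω) (hρN : N ≤ ρ.ker)
    (x : G ⧸ N) (z : Z) :
    extAction hθ hc (σ x) (incl f z) = incl f (quotAction ρ hρN x z) := by
  rw [extAction_incl, quotAction_of_section hρN h.section_eq]

variable (hN : IsSplitLieSubgroup LG N LN MQ) (hL : IsStandard L)
  (hα : IsSmoothCrossedModule L LG (alphaHom f) (extAction hθ hc))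

include hN hL

theorem exists_cocycle (h : IsFactorData LG MQ L σ ω) :
    ∃ c : Z3s MQ LZ.toSmoothMfd (quotAction ρ hα.le_ker),
      ∀ x y z, dTwo (fun x => extAction hθ hc (σ x)) ω x y z = incl f (c.fn x y z) :=
  IsFactorSystem.exists_z3s (LΓ := hN.quotient) hα hL.isEmbeddedKernel h.isFactorSystem
    (h.extAction_section_incl hα.le_ker)

include hα in
theorem exists_dTwo_eq (h : IsFactorData LG MQ L σ ω) (hσ' : IsC1s MQ LG.toSmoothMfd σ')
    (section_eq : ∀ x, (σ' x : G ⧸ N) = x) :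
    ∃ ω'', IsFactorData LG MQ L σ' ω'' ∧ ∀ x y z,
      dTwo (fun x => extAction hθ hc (σ' x)) ω'' x y z =
        dTwo (fun x => extAction hθ hc (σ x)) ω x y z := by
  obtain ⟨η, hη, hησ⟩ := exists_isC1s_alphaHom_mul_eq hN hL h.section_c1s hσ'
    fun x => (h.section_eq x).trans (section_eq x).symm
  obtain rfl : (fun x => alphaHom f (η x) * σ x) = σ' := funext fun x => (hησ x).2
  exact ⟨_, .of_isFactorSystem section_eq
    (h.isFactorSystem.twist (LΓ := hN.quotient) hα hη),
    dTwo_twistCochain hα.equivariant hα.peiffer h.lift_eq η⟩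

theorem hasClass_of_isFactorData (h : IsFactorData LG MQ L σ ω)
    (h' : IsFactorData LG MQ L σ' ω') {Q : H3ss MQ LZ.toSmoothMfd (quotAction ρ hα.le_ker)}
    (hQ : HasClass (dTwo (fun x => extAction hθ hc (σ x)) ω) Q) :
    HasClass (dTwo (fun x => extAction hθ hc (σ' x)) ω') Q := by
  have hι := hL.isEmbeddedKernel
  obtain ⟨c, hcω, rfl⟩ := hQ
  obtain ⟨c', hcω'⟩ := h'.exists_cocycle hN hL hα
  obtain ⟨ω'', h'', hω''⟩ := h.exists_dTwo_eq hN hL hα h'.section_c1s h'.section_eq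
  obtain ⟨β, hβ, rfl⟩ := h''.isFactorSystem.exists_eq_map_mul hα hι h'.isFactorSystem
  refine ⟨c', hcω', (H3ss.mk_eq_mk_iff.2 ⟨β, hβ, fun x y z => hι.injective ?_⟩).symm⟩
  rw [← hcω', dTwo_map_mul (hι.comm hα) (h'.extAction_section_incl hα.le_ker), hω'', hcω, ← map_mul,
    mul_comm]

theorem eq_trivial_iff (h : IsFactorData LG MQ L σ ω)
    {Q : H3ss MQ LZ.toSmoothMfd (quotAction ρ hα.le_ker)}
    (hQ : HasClass (dTwo (fun x => extAction hθ hc (σ x)) ω) Q) :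
    Q = H3ss.trivial MQ LZ.toSmoothMfd (quotAction ρ hα.le_ker) ↔
      ∃ σ' ω', IsFactorData LG MQ L σ' ω' ∧
        ∀ x y z, dTwo (fun x => extAction hθ hc (σ' x)) ω' x y z = 1 := by
  have hι := hL.isEmbeddedKernel
  constructor
  · rintro rfl
    obtain ⟨c, hcω, htriv⟩ := hQ
    obtain ⟨β, hβ, hβc⟩ := H3ss.mk_eq_mk_iff.1 htriv
    refine ⟨σ, _, .of_isFactorSystem h.section_eq (h.isFactorSystem.map_mul hα hι hβ),
      fun x y z => ?_⟩
    rw [dTwo_map_mul (hι.comm hα) (h.extAction_section_incl hα.le_ker), hcω, ← map_mul, mul_comm,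
      ← hβc]
    exact map_one _
  · rintro ⟨σ', ω', h', hd⟩
    obtain ⟨c, hcω, rfl⟩ := h.hasClass_of_isFactorData hN hL hα h' hQ
    refine H3ss.mk_eq_mk_iff.2 ⟨_, isC2ss_one, fun x y z => hι.injective ?_⟩
    rw [dTwo_one, mul_one, ← hcω, hd]
    exact map_one _

end IsFactorData

end Obstruction

/-! ### Morphisms of extensions -/

section Morphisms

open SmoothMfd

variable {𝕜 : Type*} [RCLike 𝕜] {Z H P E B Γ : Type u} [Group Z] [Group H] [Group P] [Group E]
  [Group B] [Group Γ] {LZ : LieGroupStr 𝕜 Z} {LH : LieGroupStr 𝕜 H} {LP : LieGroupStr 𝕜 P}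
  {LE : LieGroupStr 𝕜 E} {LB : LieGroupStr 𝕜 B} {LΓ : LieGroupStr 𝕜 Γ}

namespace HasLocalRetraction

theorem of_rightInverse {φ : H →* P} (hφ : Function.Injective φ) {r : P → H}
    (right_inv : Function.RightInverse r φ) (hr : LP.SmoothNear LH.toSmoothMfd r 1) :
    HasLocalRetraction LH LP φ :=
  ⟨r, hr, Eventually.of_forall fun p _ hh => hφ ((right_inv p).trans hh.symm)⟩

theorem exists_map_one {ι : H →* P} (hι : HasLocalRetraction LH LP ι) :
    ∃ r : P → H, r 1 = 1 ∧ LP.SmoothNear LH.toSmoothMfd r 1 ∧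
      ∀ᶠ p in LP.nhd 1, ∀ h, ι h = p → r p = h := by
  obtain ⟨r, hr, hev⟩ := hι
  exact ⟨r, mem_of_mem_nhd (s := {p | ∀ h, ι h = p → r p = h}) hev 1 (map_one ι), hr, hev⟩

theorem comp {φ : H →* P} {ι : P →* E} (hι : HasLocalRetraction LP LE ι)
    (hφ : HasLocalRetraction LH LP φ) : HasLocalRetraction LH LE (ι.comp φ) := by
  obtain ⟨r, hr, hrφ⟩ := hφ
  obtain ⟨k, k_one, hk, hkι⟩ := hι.exists_map_one
  have htendsto := hk.tendsto
  rw [k_one] at htendsto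
  refine ⟨fun p => r (k p), hr.comp_of_eq hk k_one, ?_⟩
  filter_upwards [hkι, htendsto.eventually hrφ] with p hp hkp x hx
  exact hkp x (hp (φ x) hx).symm

end HasLocalRetraction

namespace LieGroupStr

/-- The Lie group structure for which the group isomorphism `φ` is a diffeomorphism; it equips
preimages of subgroups under extensions with a Lie group structure. -/
def transport (L : LieGroupStr 𝕜 P) (φ : H ≃* P) : LieGroupStr 𝕜 H where
  toSmoothMfd := L.toSmoothMfd.transport φ.toEquiv
  smooth_mul := smooth_iff.2 fun p => .transport <| by
    have hφ := transport_smoothNear L.toSmoothMfd φ.toEquiv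
    exact (L.smoothNear_mul ((hφ p.1).comp (smoothNear_fst _ _ p))
      ((hφ p.2).comp (smoothNear_snd _ _ p))).congr (Eventually.of_forall fun _ => map_mul φ _ _)
  smooth_inv := smooth_iff.2 fun x => .transport <|
    (L.smoothNear_inv (transport_smoothNear L.toSmoothMfd φ.toEquiv x)).congr
      (Eventually.of_forall fun _ => map_inv φ _)

theorem transport_smooth (L : LieGroupStr 𝕜 P) (φ : H ≃* P) :
    (L.transport φ).Smooth L.toSmoothMfd φ :=
  smooth_iff.2 (transport_smoothNear L.toSmoothMfd φ.toEquiv)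

theorem transport_symm_smooth (L : LieGroupStr 𝕜 P) (φ : H ≃* P) :
    L.Smooth (L.transport φ).toSmoothMfd φ.symm :=
  smooth_iff.2 (transport_symm_smoothNear L.toSmoothMfd φ.toEquiv)

end LieGroupStr

namespace IsLieGroupExtension

variable {ι : Z →* P} {q : P →* B}

theorem exists_normalized_section (h : IsLieGroupExtension LZ LP LB ι q) :
    ∃ s : B → P, (∀ y, q (s y) = y) ∧ IsC1s LB.toSmoothMfd LP.toSmoothMfd s := by
  classical
  obtain ⟨s, hs, hqs⟩ := h.2.2.exists_section 1
  choose t ht using h.2.1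
  have hqs_one : q (s 1) = 1 := mem_of_mem_nhd (s := {y | q (s y) = y}) hqs
  have hlocal : ∀ᶠ y in LB.nhd 1, q (s y * (s 1)⁻¹) = y := by
    filter_upwards [hqs] with y hy
    rw [map_mul, map_inv, hqs_one, hy, inv_one, mul_one]
  refine ⟨fun y => if q (s y * (s 1)⁻¹) = y then s y * (s 1)⁻¹ else t y, fun y => ?_, ?_, ?_⟩
  · by_cases hy : q (s y * (s 1)⁻¹) = y
    · simpa only [if_pos hy] using hy
    · simp only [if_neg hy, ht]
  · simp only [mul_inv_cancel, map_one, if_true]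
  · refine (LP.smoothNear_mul hs (smoothNear_const _ LP.toSmoothMfd (s 1)⁻¹ _)).congr ?_
    filter_upwards [hlocal] with y hy using if_pos hy

theorem transport (h : IsLieGroupExtension LZ LP LB ι q) (φ : H ≃* P) :
    IsLieGroupExtension LZ (LP.transport φ) LB (φ.symm.toMonoidHom.comp ι)
      (q.comp φ.toMonoidHom) := by
  have hφ := LP.transport_smooth φ
  have hφ_symm := LP.transport_symm_smooth φ
  obtain ⟨s, hqs, -, hs⟩ := h.exists_normalized_section
  have retraction : HasLocalRetraction LP (LP.transport φ) φ.symm.toMonoidHom :=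
    .of_rightInverse φ.symm.injective φ.symm_apply_apply (hφ.smoothNear 1)
  refine .of_section (s := fun y => φ.symm (s y)) (φ.symm.injective.comp h.2.2.injective) ?_
    (h.2.1.comp φ.surjective) ?_ (retraction.comp h.2.2.hasLocalRetraction) ?_
    ((hφ_symm.smoothNear _).comp hs) (Eventually.of_forall fun y => ?_)
  · rw [MonoidHom.range_comp, h.1]
    exact Subgroup.map_equiv_eq_comap_symm φ.symm q.ker
  · exact smooth_iff.2 fun z => (hφ_symm.smoothNear _).comp (h.2.2.smooth_incl.smoothNear z)
  · exact smooth_iff.2 fun x => (h.2.2.smooth_proj.smoothNear _).comp (hφ.smoothNear x)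
  · exact (congrArg q (φ.apply_symm_apply _)).trans (hqs y)

section Equivalence

variable {ι' : Z →* H} {q' : H →* B} {φ : H →* P}
  (h' : IsLieGroupExtension LZ LH LB ι' q') (h : IsLieGroupExtension LZ LP LB ι q)
  (hι : ∀ z, φ (ι' z) = ι z) (hq : ∀ x, q (φ x) = q' x)

include h' h hι hq

theorem injective_of_commutes : Function.Injective φ := by
  rw [injective_iff_map_eq_one]
  intro x hx
  obtain ⟨z, rfl⟩ : x ∈ ι'.range := by rw [h'.1, MonoidHom.mem_ker, ← hq, hx, map_one]
  rw [hι, ← map_one ι] at hx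
  rw [h.2.2.injective hx, map_one]

theorem exists_smooth_rightInverse (hφ : LH.Smooth LP.toSmoothMfd φ) :
    ∃ r : P → H, Function.RightInverse r φ ∧ LP.SmoothNear LH.toSmoothMfd r 1 := by
  obtain ⟨s, hs, -, hss⟩ := h'.exists_normalized_section
  have hlift : ∀ p, ∃ z, ι z = p * (φ (s (q p)))⁻¹ := fun p => by
    rw [← MonoidHom.mem_range, h.1, MonoidHom.mem_ker, map_mul, map_inv, hq, hs, mul_inv_cancel]
  choose k hk using hlift
  have hsq := hss.comp_of_eq (h.2.2.smooth_proj.smoothNear 1) (map_one q)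
  have hιk : LP.SmoothNear LP.toSmoothMfd (fun p => ι (k p)) 1 := by
    simp only [hk]
    exact LP.smoothNear_mul (smoothNear_id _ _)
      (LP.smoothNear_inv ((hφ.smoothNear _).comp hsq))
  refine ⟨fun p => ι' (k p) * s (q p), fun p => ?_, LH.smoothNear_mul
    ((h'.2.2.smooth_incl.smoothNear _).comp (h.2.2.hasLocalRetraction.smoothNear hιk)) hsq⟩
  rw [map_mul, hι, hk, inv_mul_cancel_right]

end Equivalence

end IsLieGroupExtension

theorem exists_isFactorSystem_of_lift {α : H →* P} {T : Γ → MulAut H} {j : H →* E} {q : E →* P}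
    (hj : Function.Injective j) (hr : HasLocalRetraction LH LE j) (hqj : ∀ h, q (j h) = α h)
    {τ : Γ → P} (hτ : IsC1s LΓ.toSmoothMfd LP.toSmoothMfd τ)
    {t : Γ → E} (ht : IsC1s LΓ.toSmoothMfd LE.toSmoothMfd t) (hqt : ∀ x, q (t x) = τ x)
    (hconj : ∀ x h, j (T x h) = t x * j h * (t x)⁻¹) (hmem : ∀ x y, deltaMap t x y ∈ j.range) :
    ∃ ω, IsFactorSystem LΓ.toSmoothMfd LP LH α τ ω ∧ ∀ x y z, dTwo T ω x y z = 1 := by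
  choose ω hω using hmem
  refine ⟨ω, ⟨hτ, isC2ss_of_map hj hr ?_, fun x y => ?_⟩,
    fun x y z => dTwo_eq_of_mul_mul (hj ?_)⟩
  · simpa only [hω] using isC2ss_deltaMap ht
  · rw [← hqj, hω]
    simp only [deltaMap, map_mul, map_inv, hqt]
  · simp only [map_mul, hconj, hω, map_one, deltaMap, mul_assoc x y z]
    group

end Morphisms

/-- The set underlying the extension `A ×_F Γ` defined by `F ∈ Z^2_ss(Γ, A)`, where `Γ` may act
nontrivially on `A`, unlike in `CentralExt`. -/
@[ext]
structure ModuleExt {𝕜 : Type*} [RCLike 𝕜] {Γ A : Type u} [Group Γ] [CommGroup A]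
    {MΓ : SmoothMfd 𝕜 Γ} {MA : SmoothMfd 𝕜 A} {ρ : Γ →* MulAut A} (F : Z2ss MΓ MA ρ) where
  fst : A
  snd : Γ

namespace ModuleExt

variable {𝕜 : Type*} [RCLike 𝕜] {Γ A : Type u} [Group Γ] [CommGroup A]
  {MΓ : SmoothMfd 𝕜 Γ} {MA : SmoothMfd 𝕜 A} {ρ : Γ →* MulAut A}

instance (F : Z2ss MΓ MA ρ) : Group (ModuleExt F) where
  mul x y := ⟨x.fst * ρ x.snd y.fst * F.fn x.snd y.snd, x.snd * y.snd⟩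
  one := ⟨1, 1⟩
  inv x := ⟨(ρ x.snd⁻¹ x.fst * F.fn x.snd⁻¹ x.snd)⁻¹, x.snd⁻¹⟩
  mul_assoc x y z := by
    refine ModuleExt.ext ?_ (mul_assoc _ _ _)
    change x.fst * ρ x.snd y.fst * F.fn x.snd y.snd * ρ (x.snd * y.snd) z.fst *
        F.fn (x.snd * y.snd) z.snd =
      x.fst * ρ x.snd (y.fst * ρ y.snd z.fst * F.fn y.snd z.snd) * F.fn x.snd (y.snd * z.snd)
    have cocycle := dTwo_mul_mul ρ F.fn x.snd y.snd z.snd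
    rw [F.cocycle, one_mul] at cocycle
    rw [mul_right_comm _ (F.fn x.snd y.snd), mul_assoc, cocycle]
    simp only [map_mul, MulAut.mul_apply, mul_assoc]
  one_mul x := by
    refine ModuleExt.ext ?_ (one_mul _)
    change 1 * ρ 1 x.fst * F.fn 1 x.snd = x.fst
    rw [F.c2ss.1.1, map_one, MulAut.one_apply, one_mul, mul_one]
  mul_one x := by
    refine ModuleExt.ext ?_ (mul_one _)
    change x.fst * ρ x.snd 1 * F.fn x.snd 1 = x.fst
    rw [F.c2ss.1.2.1, map_one, mul_one, mul_one]
  inv_mul_cancel x := by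
    refine ModuleExt.ext ?_ (inv_mul_cancel _)
    change (ρ x.snd⁻¹ x.fst * F.fn x.snd⁻¹ x.snd)⁻¹ * ρ x.snd⁻¹ x.fst *
      F.fn x.snd⁻¹ x.snd = 1
    rw [mul_assoc, inv_mul_cancel]

/-- The bijection of `A ×_F Γ` with `A × Γ`, as a coordinate for `IsTwistedProduct`. -/
def equivProd (F : Z2ss MΓ MA ρ) : ModuleExt F ≃ A × Γ where
  toFun x := (x.fst, x.snd)
  invFun p := ⟨p.1, p.2⟩
  left_inv _ := rfl
  right_inv _ := rfl

theorem isTwistedProduct (F : Z2ss MΓ MA ρ) : IsTwistedProduct ρ F.fn (equivProd F) :=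
  fun _ _ => rfl

end ModuleExt

section Preimage

open SmoothMfd

variable {𝕜 : Type*} [RCLike 𝕜] {Z P B : Type u} [Group Z] [Group P] [Group B]

/-- The bijection of `P ⧸ q⁻¹(K)` with `B ⧸ K` induced by the surjective homomorphism
`q : P → B`. -/
noncomputable def quotientComapEquiv (q : P →* B) (hq : Function.Surjective q) (K : Subgroup B) :
    P ⧸ K.comap q ≃ B ⧸ K :=
  .ofBijective
    (Quotient.map' q fun p p' h => by
      rw [QuotientGroup.leftRel_apply] at h ⊢
      simpa only [map_mul, map_inv] using Subgroup.mem_comap.1 h)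
    ⟨fun x y => Quotient.inductionOn₂' x y fun p p' h =>
      QuotientGroup.eq.2 (Subgroup.mem_comap.2 (by
        simpa only [map_mul, map_inv] using QuotientGroup.eq.1 h)),
    fun y => Quotient.inductionOn' y fun b =>
      let ⟨p, hp⟩ := hq b
      ⟨(p : P ⧸ K.comap q), congrArg (fun b : B => (b : B ⧸ K)) hp⟩⟩

theorem IsLieGroupExtension.isSplitLieSubgroup_comap {LZ : LieGroupStr 𝕜 Z}
    {LP : LieGroupStr 𝕜 P} {LB : LieGroupStr 𝕜 B} {ι : Z →* P} {q : P →* B}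
    (h : IsLieGroupExtension LZ LP LB ι q) {K : Subgroup B} {LK : LieGroupStr 𝕜 K}
    {MQ : SmoothMfd 𝕜 (B ⧸ K)} (hK : IsSplitLieSubgroup LB K LK MQ)
    {LC : LieGroupStr 𝕜 (K.comap q)} (smooth_incl : LC.Smooth LP.toSmoothMfd (K.comap q).subtype)
    (hr : HasLocalRetraction LC LP (K.comap q).subtype) :
    IsSplitLieSubgroup LP (K.comap q) LC (MQ.transport (quotientComapEquiv q h.2.1 K)) := by
  set ψ := quotientComapEquiv q h.2.1 K
  refine .of_section Subtype.val_injective smooth_incl hr ?_ (fun p p' => ?_) fun b => ?_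
  · exact smooth_iff.2 fun x =>
      .transport ((hK.smooth_proj.smoothNear _).comp (h.2.2.smooth_proj.smoothNear x))
  · rw [QuotientGroup.eq]
    refine ⟨fun hmem => ⟨⟨_, hmem⟩, (mul_inv_cancel_left p p').symm⟩, ?_⟩
    rintro ⟨k, rfl⟩
    rw [inv_mul_cancel_left]
    exact k.2
  · obtain ⟨s, hs, hπs⟩ := IsCosetBundle.exists_section hK (ψ b)
    obtain ⟨t, ht, hqt⟩ := h.2.2.exists_section (s (ψ b))
    have hψ := transport_smoothNear MQ ψ b
    have hsψ := hs.comp hψ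
    refine ⟨fun y => t (s (ψ y)), ht.comp (f := fun y => s (ψ y)) hsψ, ?_⟩
    filter_upwards [hψ.tendsto.eventually hπs, hsψ.tendsto.eventually hqt] with y hsy hty
    exact ψ.injective ((congrArg (fun g : B => (g : B ⧸ K)) hty).trans hsy)

end Preimage

/-! ### Equivalence of the three conditions -/

theorem apply_eq_of_le_ker {G M : Type*} [Group G] [MulOneClass M] {ρ : G →* MulAut M}
    {H : Subgroup G} (h : H ≤ ρ.ker) (g : H) (m : M) : ρ g m = m := by
  rw [MonoidHom.mem_ker.1 (h g.2), MulAut.one_apply]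

section Equivalence

open SmoothMfd CentralExt

variable {𝕜 : Type*} [RCLike 𝕜] {G Z : Type u} [Group G] [CommGroup Z]
  {N : Subgroup G} [N.Normal] {LG : LieGroupStr 𝕜 G} {LZ : LieGroupStr 𝕜 Z}
  {LN : LieGroupStr 𝕜 N} {MQ : SmoothMfd 𝕜 (G ⧸ N)}
  {ρ : G →* MulAut Z} {f : Z2ss LN.toSmoothMfd LZ.toSmoothMfd 1} {θ : G → N → Z}
  {hθ : IsZ1ss LG LZ LN ρ f θ} {hc : IsCompatible ρ f θ} {L : LieGroupStr 𝕜 (CentralExt f)}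

theorem HasEquivariantExtension.exists_factorData (hN : IsSplitLieSubgroup LG N LN MQ)
    (hL : IsStandard L) (hE : HasEquivariantExtension LG L (extAction hθ hc)) {σ : G ⧸ N → G}
    (hσ : ∀ x, (σ x : G ⧸ N) = x) (hσs : IsC1s MQ LG.toSmoothMfd σ) :
    ∃ ω, IsFactorData LG MQ L σ ω ∧
      ∀ x y z, dTwo (fun x => extAction hθ hc (σ x)) ω x y z = 1 := by
  obtain ⟨E, _, LE, ι, q, hext, LP, MP, hP, ιP, φ, -, hPext, hφ, hφι, hφq, equivariant⟩ := hE
  have injective := hL.isLieGroupExtension.injective_of_commutes hPext hφι hφq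
  obtain ⟨r, right_inv, hr⟩ :=
    hL.isLieGroupExtension.exists_smooth_rightInverse hPext hφι hφq hφ
  obtain ⟨s, hqs, hs⟩ := hext.exists_normalized_section
  have hmem : ∀ x y, deltaMap (fun x => s (σ x)) x y ∈ N.comap q := fun x y => by
    rw [Subgroup.mem_comap, ← QuotientGroup.eq_one_iff]
    simp only [deltaMap, map_mul, map_inv, hqs, QuotientGroup.mk_mul, QuotientGroup.mk_inv, hσ,
      mul_inv_cancel]
  have conj : ∀ x h, (φ (extAction hθ hc (σ x) h) : E) = s (σ x) * φ h * (s (σ x))⁻¹ :=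
    fun x h => by simpa only [hqs] using equivariant (s (σ x)) h
  obtain ⟨ω, hω, hd⟩ := exists_isFactorSystem_of_lift (LΓ := hN.quotient) (LP := LG)
    (α := alphaHom f) (T := fun x => extAction hθ hc (σ x)) (j := (N.comap q).subtype.comp φ)
    (Subtype.val_injective.comp injective)
    ((IsCosetBundle.hasLocalRetraction hP).comp (.of_rightInverse injective right_inv hr))
    (fun x => congrArg Subtype.val (hφq x)) hσs (t := fun x => s (σ x))
    ⟨by simp only [hσs.1, hs.1], hs.2.comp_of_eq hσs.2 hσs.1⟩ (fun x => hqs _) conj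
    fun x y => ⟨r ⟨_, hmem x y⟩, congrArg Subtype.val (right_inv _)⟩
  exact ⟨ω, .of_isFactorSystem hσ hω, hd⟩

theorem extAction_conj (g : G) (n : N) :
    extAction hθ hc g ⟨1, MulAut.conjNormal g⁻¹ n⟩ = incl f (θ g n) * ⟨1, n⟩ := by
  rw [extAction_apply, incl_mul, ← MulAut.mul_apply, ← map_mul, mul_inv_cancel, map_one, map_one,
    one_mul, mul_one, MulAut.one_apply]

namespace IsFactorData

section Restriction

variable {σ : G ⧸ N → G} {ω : G ⧸ N → G ⧸ N → CentralExt f} (h : IsFactorData LG MQ L σ ω)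
  {η : G → CentralExt f} (hη : ∀ g : G, (η g).fst = 1 ∧ alphaHom f (η g) * σ g = g)

include h

theorem section_coe (n : N) : σ (n : G) = 1 := by
  rw [(QuotientGroup.eq_one_iff (n : G)).2 n.2, h.section_c1s.1]

include hη

theorem eq_of_alphaHom_mul_section (n : N) : η n = ⟨1, n⟩ := by
  refine CentralExt.ext (hη n).1 (Subtype.ext ?_)
  have := (hη n).2
  rwa [h.section_coe, mul_one] at this

theorem twistCochain_coe_left (n : N) (g : G) :
    twistCochain (extAction hθ hc) (fun g : G => σ g) (fun g g' : G => ω g g') η n g =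
      ⟨1, n⟩ * η g * (η (n * g))⁻¹ := by
  simp only [twistCochain]
  rw [h.eq_of_alphaHom_mul_section hη, h.section_coe, map_one, MulAut.one_apply,
    (QuotientGroup.eq_one_iff (n : G)).2 n.2, h.c2ss.1.1, mul_one]

theorem twistCochain_coe (n n' : N) :
    twistCochain (extAction hθ hc) (fun g : G => σ g) (fun g g' : G => ω g g') η n n' =
      incl f (f.fn n n') := by
  rw [h.twistCochain_coe_left hη, ← Subgroup.coe_mul, h.eq_of_alphaHom_mul_section hη,
    h.eq_of_alphaHom_mul_section hη, mul_inv_eq_iff_eq_mul, incl_mul]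
  exact CentralExt.ext (by rw [mul_fst, one_mul, one_mul, mul_one]) rfl

theorem twistCochain_conj
    (pf : ∀ x y : CentralExt f, extAction hθ hc (alphaHom f x) y = x * y * x⁻¹) (g : G) (n : N) :
    twistCochain (extAction hθ hc) (fun g : G => σ g) (fun g g' : G => ω g g') η g
        (g⁻¹ * n * g) =
      incl f (θ g n) *
        twistCochain (extAction hθ hc) (fun g : G => σ g) (fun g g' : G => ω g g') η n g := by
  have hconj : g⁻¹ * n * g = (MulAut.conjNormal g⁻¹ n : N) := by simp
  have hω : ω g (g⁻¹ * n * g : G) = 1 := by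
    rw [hconj, (QuotientGroup.eq_one_iff _).2 (MulAut.conjNormal g⁻¹ n).2, h.c2ss.1.2.1]
  have hmul : g * (g⁻¹ * n * g) = n * g := by group
  rw [twistCochain_of_peiffer pf, (hη g).2, hω, hmul, hconj, h.eq_of_alphaHom_mul_section hη,
    extAction_conj, mul_one, h.twistCochain_coe_left hη, mul_assoc, mul_assoc, mul_assoc]

end Restriction

theorem exists_extends {σ : G ⧸ N → G} {ω : G ⧸ N → G ⧸ N → CentralExt f}
    (h : IsFactorData LG MQ L σ ω) (hN : IsSplitLieSubgroup LG N LN MQ) (hL : IsStandard L)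
    (hα : IsSmoothCrossedModule L LG (alphaHom f) (extAction hθ hc))
    (hd : ∀ x y z, dTwo (fun x => extAction hθ hc (σ x)) ω x y z = 1) :
    ∃ F : Z2ss LG.toSmoothMfd LZ.toSmoothMfd ρ, Extends F f θ := by
  have hι := hL.isEmbeddedKernel
  have pullback := h.isFactorSystem.comp (φ := QuotientGroup.mk' N) hN.smooth_proj
  obtain ⟨η, hηs, hη⟩ := exists_isC1s_alphaHom_mul_eq hN hL pullback.c1s (τ' := fun g => g)
    ⟨rfl, smoothNear_id _ _⟩ fun g => h.section_eq g
  have hid : (fun g : G => alphaHom f (η g) * σ g) = MonoidHom.id G := funext fun g => (hη g).2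
  have twist := pullback.twist (LΓ := LG) hα hηs
  have dTwo_twist := dTwo_twistCochain hα.equivariant hα.peiffer pullback.lift_eq η
  obtain ⟨F, hF⟩ := (hid ▸ twist).exists_z2ss hι (fun g z => extAction_incl g z) fun x y z => by
    simp only [← hid]
    exact (dTwo_twist x y z).trans (hd x y z)
  refine ⟨F, fun n n' => hι.injective ?_, fun g n => hι.injective ?_⟩
  · rw [← hF]
    exact h.twistCochain_coe hη n n'
  · rw [map_mul, map_inv, ← hF, ← hF, mul_inv_eq_iff_eq_mul]
    exact h.twistCochain_conj hη hα.peiffer g n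

end IsFactorData

namespace Extends

variable {F : Z2ss LG.toSmoothMfd LZ.toSmoothMfd ρ} (hF : Extends F f θ) (hρN : N ≤ ρ.ker)

/-- The isomorphism of `Z ×_f N` with the preimage of `N` in `Z ×_F G`, where `F` extends `f`. -/
def comapEquiv : CentralExt f ≃* N.comap (ModuleExt.isTwistedProduct F).proj where
  toFun x := ⟨⟨x.fst, x.snd⟩, x.snd.2⟩
  invFun p := ⟨p.1.fst, ⟨p.1.snd, p.2⟩⟩
  left_inv _ := rfl
  right_inv _ := rfl
  map_mul' x y := Subtype.ext <| ModuleExt.ext (by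
    change x.fst * y.fst * f.fn x.snd y.snd = x.fst * ρ x.snd y.fst * F.fn x.snd y.snd
    rw [apply_eq_of_le_ker hρN, hF.1]) rfl

theorem comapEquiv_extAction (a : ModuleExt F) (x : CentralExt f) :
    (hF.comapEquiv hρN (extAction hθ hc a.snd x) : ModuleExt F) =
      a * hF.comapEquiv hρN x * a⁻¹ := by
  rw [eq_mul_inv_iff_mul_eq]
  set n := MulAut.conjNormal a.snd x.snd with hn
  have hconj : a.snd⁻¹ * n * a.snd = x.snd := by simp [hn, mul_assoc]
  have hθF := hF.2 a.snd n
  rw [hconj, mul_inv_eq_iff_eq_mul] at hθF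
  refine ModuleExt.ext ?_ ?_
  · change ρ a.snd x.fst * θ a.snd n * ρ n a.fst * F.fn n a.snd =
      a.fst * ρ a.snd x.fst * F.fn a.snd x.snd
    rw [apply_eq_of_le_ker hρN, hθF]
    ac_rfl
  · change (n : G) * a.snd = a.snd * x.snd
    rw [← hconj]
    group

variable {LE : LieGroupStr 𝕜 (ModuleExt F)} (hL : IsStandard L)
  (hLE : IsStandardAlong LG.toSmoothMfd LZ.toSmoothMfd (ModuleExt.equivProd F) LE)

include hL hLE

omit [N.Normal] in
theorem smooth_subtype_comp_comapEquiv (hN : IsSplitLieSubgroup LG N LN MQ) :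
    L.Smooth LE.toSmoothMfd
      ((N.comap (ModuleExt.isTwistedProduct F).proj).subtype.comp
        (hF.comapEquiv hρN).toMonoidHom) := by
  have he : L.SmoothNear (LZ.prod LN.toSmoothMfd) (equivProd f) 1 :=
    hL.isStandardAlong.smoothNear rfl
  exact LieGroupStr.smooth_of_smoothNear_one
    (hLE.mk_smoothNear he.fst ((hN.smooth_incl.smoothNear _).comp he.snd) rfl)

omit [N.Normal] in
theorem hasLocalRetraction_subtype_comp_comapEquiv (hN : IsSplitLieSubgroup LG N LN MQ) :
    HasLocalRetraction L LE
      ((N.comap (ModuleExt.isTwistedProduct F).proj).subtype.comp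
        (hF.comapEquiv hρN).toMonoidHom) := by
  have he : LE.SmoothNear (LZ.prod LG.toSmoothMfd) (ModuleExt.equivProd F) 1 := hLE.smoothNear rfl
  obtain ⟨r, r_one, hr, hrN⟩ := (IsCosetBundle.hasLocalRetraction hN).exists_map_one
  refine ⟨fun p => ⟨p.fst, r p.snd⟩,
    hL.isStandardAlong.mk_smoothNear he.fst (hr.comp_of_eq he.snd rfl) r_one, ?_⟩
  filter_upwards [he.snd.tendsto.eventually hrN] with p hp x hx
  subst hx
  exact CentralExt.ext rfl (hp x.snd rfl)

omit hLE in
include hF hρN in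
theorem hasEquivariantExtension (hN : IsSplitLieSubgroup LG N LN MQ)
    (hρ : (LG.prod LZ.toSmoothMfd).Smooth LZ.toSmoothMfd (fun p : G × Z => ρ p.1 p.2)) :
    HasEquivariantExtension LG L (extAction hθ hc) := by
  have twisted := ModuleExt.isTwistedProduct F
  obtain ⟨LE, hLE⟩ := twisted.exists_isStandardAlong hρ F.c2ss
  have hext := twisted.isLieGroupExtension F.c2ss.1.1 hLE
  set φ := hF.comapEquiv hρN
  have hφ := L.transport_symm_smooth φ.symm
  have hφ_symm := L.transport_smooth φ.symm
  have retraction : HasLocalRetraction (L.transport φ.symm) L φ.symm.toMonoidHom :=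
    .of_rightInverse φ.symm.injective φ.symm_apply_apply (hφ.smoothNear 1)
  have subtype_eq : (N.comap twisted.proj).subtype =
      ((N.comap twisted.proj).subtype.comp φ.toMonoidHom).comp φ.symm.toMonoidHom := rfl
  have hsplit := hext.isSplitLieSubgroup_comap hN (LC := L.transport φ.symm)
    (smooth_iff.2 fun x => ((hF.smooth_subtype_comp_comapEquiv hρN hL hLE hN).smoothNear _).comp
      (hφ_symm.smoothNear x))
    (subtype_eq ▸ (hF.hasLocalRetraction_subtype_comp_comapEquiv hρN hL hLE hN).comp retraction)
  exact ⟨ModuleExt F, inferInstance, LE, _, _, hext, _, _, hsplit,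
    φ.toMonoidHom.comp (CentralExt.incl f), φ.toMonoidHom, fun _ => rfl,
    hL.isLieGroupExtension.transport φ.symm, hφ, fun _ => rfl, fun _ => rfl,
    hF.comapEquiv_extAction hρN⟩

end Extends

end Equivalence

theorem mainTheorem5 {𝕜 : Type*} [RCLike 𝕜] {G Z : Type u} [Group G] [CommGroup Z]
    (LG : LieGroupStr 𝕜 G) (LZ : LieGroupStr 𝕜 Z)
    (ρ : G →* MulAut Z)
    (hρ : (LG.prod LZ.toSmoothMfd).Smooth LZ.toSmoothMfd (fun p : G × Z => ρ p.1 p.2))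
    (N : Subgroup G) [N.Normal] (LN : LieGroupStr 𝕜 N) (MQ : SmoothMfd 𝕜 (G ⧸ N))
    (hN : IsSplitLieSubgroup LG N LN MQ)
    (f : Z2ss LN.toSmoothMfd LZ.toSmoothMfd 1) :
    (∃ L : LieGroupStr 𝕜 (CentralExt f), CentralExt.IsStandard L) ∧
    ∀ (L : LieGroupStr 𝕜 (CentralExt f)) (_ : CentralExt.IsStandard L)
      (θ : G → N → Z) (hθ : IsZ1ss LG LZ LN ρ f θ) (hc : IsCompatible ρ f θ)
      (hα : IsSmoothCrossedModule L LG (alphaHom f) (extAction hθ hc))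
      (σ : G ⧸ N → G) (ω : G ⧸ N → G ⧸ N → CentralExt f) (_ : IsFactorData LG MQ L σ ω),
      ∃ Q : H3ss MQ LZ.toSmoothMfd (quotAction ρ hα.le_ker),
        HasClass (dTwo (fun x => extAction hθ hc (σ x)) ω) Q ∧
        (∀ (σ' : G ⧸ N → G) (ω' : G ⧸ N → G ⧸ N → CentralExt f), IsFactorData LG MQ L σ' ω' →
          HasClass (dTwo (fun x => extAction hθ hc (σ' x)) ω') Q) ∧
        List.TFAE [
          Q = H3ss.trivial MQ LZ.toSmoothMfd (quotAction ρ hα.le_ker),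
          HasEquivariantExtension LG L (extAction hθ hc),
          ∃ F : Z2ss LG.toSmoothMfd LZ.toSmoothMfd ρ, Extends F f θ] := by
  refine ⟨CentralExt.exists_isStandard f, fun L hL θ hθ hc hα σ ω h => ?_⟩
  obtain ⟨c, hcω⟩ := h.exists_cocycle hN hL hα
  have hQ : HasClass (dTwo (fun x => extAction hθ hc (σ x)) ω) (H3ss.mk c) := ⟨c, hcω, rfl⟩
  refine ⟨H3ss.mk c, hQ, fun σ' ω' h' => h.hasClass_of_isFactorData hN hL hα h' hQ, ?_⟩
  have trivial_iff := h.eq_trivial_iff hN hL hα hQ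
  tfae_have 1 → 3 := fun hQ1 =>
    have ⟨_, _, h', hd⟩ := trivial_iff.1 hQ1
    h'.exists_extends hN hL hα hd
  tfae_have 3 → 2 := fun ⟨_, hF⟩ => hF.hasEquivariantExtension hα.le_ker hL hN hρ
  tfae_have 2 → 1 := fun hE =>
    have ⟨ω', h', hd⟩ := hE.exists_factorData hN hL h.section_eq h.section_c1s
    trivial_iff.2 ⟨σ, ω', h', hd⟩
  tfae_finish
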